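/- **Definitions.** A Fisher market has a non-empty finite set $B$ of buyers with budgets $e_i>0$ and a finite set $G$ of divisible goods, one unit of each. Buyer $i$ has a separable piecewise-linear concave utility $u_i(x_i)=\sum_{j\in G}u_{ij}(x_{ij})$, where $u_{ij}:\mathbb{R}_{\ge 0}\to\mathbb{R}_{\ge 0}$ is piecewise linear, concave, non-decreasing, with $u_{ij}(0)=0$. For $\varepsilon,\delta\in[0,1]$, an *$(\varepsilon,\delta)$-approximate market equilibrium* consists of prices $p\ge 0$ and bundles $x_i\ge 0$ such that, for every buyer $i$, $\sum_j p_jx_{ij}\le e_i$ and $u_i(x_i)$ is at least $(1-\delta)$ times the supremum of $u_i$ over all affordable bundles, and such that $|\sum_i x_{ij}-1|\le\varepsilon$ for every good $j$. Markets (with rational data) and (rational) equilibria are written down as strings, with numbers in binary. A family of Fisher markets is *simple* if all budgets equal $1$, every $u_{ij}$ is linear capped ($u_{ij}(x)=\min\{ax,b\}$ with $a\in[0,\infty)$, $b\in[0,\infty]$), every buyer $i$ has a good $j$ for which $u_{ij}$ is linear with positive slope, and there are constants, the same for all markets of the family, that bound the number of goods $j$ with $u_{ij}\neq 0$ for each buyer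 $i$, the number of buyers $i$ with $u_{ij}\ne 0$ for each good $j$, and, for each buyer, the ratio of any two non-zero slopes occurring in that buyer's utility functions. A *Pure-Circuit* instance consists of nodes $V=[n]$ and gates $(T,u,v,w)$ with distinct $u,v,w\in V$ and $T\in\{\mathsf{NAND},\mathsf{PURIFY}\}$, such that every node is the output of exactly one gate; $\mathsf{NAND}$ has inputs $u,v$ and output $w$, and $\mathsf{PURIFY}$ has input $u$ and outputs $v,w$. An assignment $\mathbf{x}:V\to\{0,1,\bot\}$ satisfies a $\mathsf{NAND}$ gate if $\mathbf{x}[u]=\mathbf{x}[v]=1$ implies $\mathbf{x}[w]=0$, and $\mathbf{x}[u]=0$ or $\mathbf{x}[v]=0$ implies $\mathbf{x}[w]=1$; it satisfies a $\mathsf{PURIFY}$ gate if at least one of $\mathbf{x}[v],\mathbf{x}[w]$ is in $\{0,1\}$, and $\mathbf{x}[u]\in\{0,1\}$ implies $\mathbf{x}[v]=\mathbf{x}[w]=\mathbf{x}[u]$. In $\delta$-Pure-Circuit one has to find an assignment that satisfies at least a $(1-\delta)$ fraction of the gates. The *PCP-for-PPAD conjecture* states that there is a constant $\delta\in(0,1]$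 such that $\delta$-Pure-Circuit is PPAD-hard, even when every node is the input to exactly one gate. PPAD is the class of total NP search problems that reduce in polynomial time to End-of-the-Line, and a search problem is PPAD-hard if every problem in PPAD reduces to it in polynomial time. (A reduction of $A$ to $B$ is a pair of polynomial-time computable functions $f,g$ such that $f$ maps instances of $A$ to instances of $B$, and, for every solution $y$ of $f(I)$, $g(I,y)$ is a solution of $I$.) **Theorem.** Fix any constant $0\le\varepsilon<1/9$. 1. For every constant $\delta_c\in(0,1]$ there are a constant $\delta\in(0,1]$ and a simple family of Fisher markets such that $\delta_c$-Pure-Circuit, on the instances in which every node is the input to exactly one gate, reduces in polynomial time to the problem of finding an $(\varepsilon,\delta)$-approximate market equilibrium in the markets of this family. 2. Consequently, assuming the PCP-for-PPAD conjecture, there is a constant $\delta\in(0,1]$ such that finding an $(\varepsilon,\delta)$-approximate market equilibrium is PPAD-hard in a simple family of Fisher markets (linear capped utilities, all budgets equal to $1$, constant degree, bounded slope ratios). -/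

import Mathlib

open Computability (Γ')

namespace FisherPCP

/-! ### Strings and encodings

All instances and solutions are written as strings over the fixed finite alphabet `Γ'`
(blank, the bits `0` and `1`, an opening and a closing bracket, a comma). Numbers are written
in binary. -/

/-- A self-delimiting encoding of the elements of `α` by strings. -/
structure Code (α : Type) where
  enc : α → List Γ'
  uniq : ∀ a b s t, enc a ++ s = enc b ++ t → a = b ∧ s = t

theorem Code.injective {α : Type} (c : Code α) : Function.Injective c.enc := fun a b h =>
  (c.uniq a b [] [] (by simpa using h)).1

theorem bits_uniq : ∀ (l m : List Bool) (s t : List Γ'),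
    l.map Γ'.bit ++ Γ'.comma :: s = m.map Γ'.bit ++ Γ'.comma :: t → l = m ∧ s = t
  | [], [], s, t, h => by simpa using h
  | [], b :: m, s, t, h => by simp at h
  | a :: l, [], s, t, h => by simp at h
  | a :: l, b :: m, s, t, h => by
    simp only [List.map_cons, List.cons_append, List.cons.injEq, Γ'.bit.injEq] at h
    obtain ⟨h1, h2⟩ := bits_uniq l m s t h.2
    exact ⟨by rw [h.1, h1], h2⟩

/-- A natural number: its binary digits, then a comma. -/
def Code.nat : Code ℕ where
  enc n := (Computability.encodeNat n).map Γ'.bit ++ [Γ'.comma]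
  uniq a b s t h := by
    obtain ⟨h1, h2⟩ := bits_uniq _ _ s t (by simpa using h)
    exact ⟨Computability.encodingNatBool.encode_injective h1, h2⟩

/-- A truth value: one bit. -/
def Code.bool : Code Bool where
  enc b := [Γ'.bit b]
  uniq a b s t h := by simpa using h

/-- A pair: the first component, then the second one. -/
def Code.prod {α β : Type} (c : Code α) (d : Code β) : Code (α × β) where
  enc x := c.enc x.1 ++ d.enc x.2
  uniq a b s t h := by
    simp only [List.append_assoc] at h
    obtain ⟨h1, h2⟩ := c.uniq _ _ _ _ h
    obtain ⟨h3, h4⟩ := d.uniq _ _ _ _ h2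
    exact ⟨Prod.ext h1 h3, h4⟩

/-- The code of a list: every element is preceded by an opening bracket, and a closing bracket
ends the list. -/
def encList {α : Type} (e : α → List Γ') : List α → List Γ'
  | [] => [Γ'.ket]
  | a :: l => Γ'.bra :: (e a ++ encList e l)

theorem encList_uniq {α : Type} (c : Code α) : ∀ (l m : List α) (s t : List Γ'),
    encList c.enc l ++ s = encList c.enc m ++ t → l = m ∧ s = t
  | [], [], s, t, h => by simpa [encList] using h
  | [], b :: m, s, t, h => by simp [encList] at h
  | a :: l, [], s, t, h => by simp [encList] at h
  | a :: l, b :: m, s, t, h => by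
    simp only [encList, List.cons_append, List.append_assoc, List.cons.injEq, true_and] at h
    obtain ⟨h1, h2⟩ := c.uniq _ _ _ _ h
    obtain ⟨h3, h4⟩ := encList_uniq c l m s t h2
    exact ⟨by rw [h1, h3], h4⟩

def Code.list {α : Type} (c : Code α) : Code (List α) where
  enc := encList c.enc
  uniq := encList_uniq c

/-- Encode an object through data that determine it. -/
def Code.map {α β : Type} (c : Code β) (f : α → β) (hf : Function.Injective f) : Code α where
  enc a := c.enc (f a)
  uniq _ _ _ _ h := ⟨hf (c.uniq _ _ _ _ h).1, (c.uniq _ _ _ _ h).2⟩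

/-- A nonnegative rational number: numerator and denominator in lowest terms. -/
def Code.nnrat : Code ℚ≥0 :=
  (Code.nat.prod Code.nat).map (fun q => (q.num, q.den)) (by
    intro p q h
    simp only [Prod.mk.injEq] at h
    exact NNRat.ext_num_den h.1 h.2)

/-- The encoding, in the sense of Mathlib, that is given by a code. -/
noncomputable def Code.toEncoding {α : Type} (c : Code α) : Computability.Encoding α Γ' where
  encode := c.enc
  decode := Function.partialInv c.enc
  decode_encode := Function.partialInv_left c.injective

/-! ### Search problems, polynomial-time reductions, PPAD -/

/-- `f` is computable in polynomial time (by a Turing machine with finitely many stacks) with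
respect to the encodings `ea` of the inputs and `eb` of the outputs. -/
def PolyTime {α β A B : Type} (ea : α → List A) (eb : β → List B) (f : α → β) : Prop :=
  Nonempty (Turing.TM2ComputableInPolyTime ea eb f)

/-- A search problem: given an instance `I`, find a `y` with `IsSol I y`. -/
structure SearchProblem where
  Inst : Type
  Sol : Type
  instEnc : Computability.Encoding Inst Γ'
  solEnc : Computability.Encoding Sol Γ'
  IsSol : Inst → Sol → Prop

/-- Polynomial-time (many-one) reducibility of search problems: `f` maps instances of `A` to
instances of `B`, and `g` maps solutions of `f I` back to solutions of `I`. -/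
def Reduces (A B : SearchProblem) : Prop :=
  ∃ (f : A.Inst → B.Inst) (g : A.Inst × B.Sol → A.Sol),
    PolyTime A.instEnc.encode B.instEnc.encode f ∧
    PolyTime (Computability.encodingProd A.instEnc B.solEnc).encode A.solEnc.encode g ∧
    ∀ I y, B.IsSol (f I) y → A.IsSol I (g (I, y))

open Classical in
/-- Total NP search problems: valid instances and pairs (instance, solution) can be recognised in
polynomial time, solutions are polynomially bounded, and every instance has a solution. -/
def InTFNP (A : SearchProblem) : Prop :=
  PolyTime (Computability.encodingList Γ').encode Computability.encodeBool
    (fun s => decide (∃ I, A.instEnc.encode I = s)) ∧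
  PolyTime
    (Computability.encodingProd (Computability.encodingList Γ')
      (Computability.encodingList Γ')).encode
    Computability.encodeBool
    (fun st => decide (∃ I y, A.instEnc.encode I = st.1 ∧ A.solEnc.encode y = st.2 ∧
      A.IsSol I y)) ∧
  (∃ q : Polynomial ℕ, ∀ I y, A.IsSol I y →
    (A.solEnc.encode y).length ≤ q.eval (A.instEnc.encode I).length) ∧
  ∀ I, ∃ y, A.IsSol I y

/-- A gate of a Boolean circuit, applied to the wires with the given numbers. -/
inductive BoolGate
  | and (i j : ℕ)
  | or (i j : ℕ)
  | not (i : ℕ)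

/-- The wires read by a gate. -/
def BoolGate.inputs : BoolGate → List ℕ
  | and i j => [i, j]
  | or i j => [i, j]
  | not i => [i]

/-- The value of a gate, given the values of the wires. -/
def BoolGate.eval (w : List Bool) : BoolGate → Bool
  | and i j => w.getD i false && w.getD j false
  | or i j => w.getD i false || w.getD j false
  | not i => !w.getD i false

/-- A Boolean circuit with `n` inputs and `n` outputs. The wires `0, …, n - 1` are the inputs,
wire `n + k` carries the value of the `k`-th gate, which reads earlier wires only. -/
structure BoolCircuit (n : ℕ) where
  gates : List BoolGate
  outputs : List ℕ
  gates_wf : ∀ k (hk : k < gates.length), ∀ i ∈ gates[k].inputs, i < n + k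
  outputs_wf : ∀ i ∈ outputs, i < n + gates.length
  outputs_length : outputs.length = n

/-- The output of the circuit on the input `x`. -/
def BoolCircuit.eval {n : ℕ} (c : BoolCircuit n) (x : List Bool) : List Bool :=
  let w := c.gates.foldl (fun w g => w ++ [g.eval w]) x
  c.outputs.map fun i => w.getD i false

/-- An instance of End-of-the-Line: a successor and a predecessor circuit on `n`-bit strings,
for which the all-zero string is a source. -/
structure EndOfLineInst where
  n : ℕ
  S : BoolCircuit n
  P : BoolCircuit n
  pred_zero : P.eval (List.replicate n false) = List.replicate n false
  succ_zero : S.eval (List.replicate n false) ≠ List.replicate n false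

def BoolGate.data : BoolGate → ℕ × ℕ × ℕ
  | and i j => (0, i, j)
  | or i j => (1, i, j)
  | not i => (2, i, 0)

theorem BoolGate.data_injective : Function.Injective BoolGate.data := by
  intro a b h
  cases a <;> cases b <;> simp_all [BoolGate.data]

def BoolCircuit.data {n : ℕ} (c : BoolCircuit n) : List BoolGate × List ℕ := (c.gates, c.outputs)

theorem BoolCircuit.data_injective {n : ℕ} : Function.Injective (@BoolCircuit.data n) := by
  intro a b h
  cases a; cases b
  simp_all [BoolCircuit.data]

def EndOfLineInst.data (I : EndOfLineInst) :
    ℕ × (List BoolGate × List ℕ) × (List BoolGate × List ℕ) := (I.n, I.S.data, I.P.data)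

theorem EndOfLineInst.data_injective : Function.Injective EndOfLineInst.data := by
  rintro ⟨n, S, P, h1, h2⟩ ⟨n', S', P', h1', h2'⟩ h
  simp only [EndOfLineInst.data, Prod.mk.injEq] at h
  obtain ⟨rfl, hS, hP⟩ := h
  cases BoolCircuit.data_injective hS
  cases BoolCircuit.data_injective hP
  rfl

def BoolCircuit.dataCode : Code (List BoolGate × List ℕ) :=
  (((Code.nat.prod (Code.nat.prod Code.nat)).map BoolGate.data
    BoolGate.data_injective).list).prod Code.nat.list

/-- End-of-the-Line: find an `n`-bit string `x` with `P (S x) ≠ x`, or with `S (P x) ≠ x` and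
`x ≠ 0`. -/
noncomputable def endOfLine : SearchProblem where
  Inst := EndOfLineInst
  Sol := List Bool
  instEnc := ((Code.nat.prod (BoolCircuit.dataCode.prod BoolCircuit.dataCode)).map
    EndOfLineInst.data EndOfLineInst.data_injective).toEncoding
  solEnc := Code.bool.list.toEncoding
  IsSol I x := x.length = I.n ∧
    (I.P.eval (I.S.eval x) ≠ x ∨
      (I.S.eval (I.P.eval x) ≠ x ∧ x ≠ List.replicate I.n false))

/-- The class PPAD. -/
def InPPAD (A : SearchProblem) : Prop := InTFNP A ∧ Reduces A endOfLine

def PPADHard (B : SearchProblem) : Prop := ∀ A, InPPAD A → Reduces A B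

/-! ### Pure-Circuit and the PCP-for-PPAD conjecture -/

/-- The values of a node: `0`, `1` and `⊥`. -/
inductive Val
  | zero
  | one
  | bot
  deriving DecidableEq

/-- A gate: `nand u v w` has inputs `u`, `v` and output `w`; `purify u v w` has input `u` and
outputs `v`, `w`. -/
inductive Gate (n : ℕ)
  | nand (u v w : Fin n)
  | purify (u v w : Fin n)

namespace Gate

variable {n : ℕ}

def inputs : Gate n → List (Fin n)
  | nand u v _ => [u, v]
  | purify u _ _ => [u]

def outputs : Gate n → List (Fin n)
  | nand _ _ w => [w]
  | purify _ v w => [v, w]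

/-- The assignment `x` satisfies the gate. -/
def Sat (x : Fin n → Val) : Gate n → Prop
  | nand u v w =>
    (x u = Val.one ∧ x v = Val.one → x w = Val.zero) ∧
      (x u = Val.zero ∨ x v = Val.zero → x w = Val.one)
  | purify u v w =>
    (x v ≠ Val.bot ∨ x w ≠ Val.bot) ∧ (x u ≠ Val.bot → x v = x u ∧ x w = x u)

instance (x : Fin n → Val) : DecidablePred (Sat x) := fun g =>
  match g with
  | nand u v w => inferInstanceAs (Decidable
      ((x u = Val.one ∧ x v = Val.one → x w = Val.zero) ∧
        (x u = Val.zero ∨ x v = Val.zero → x w = Val.one)))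
  | purify u v w => inferInstanceAs (Decidable
      ((x v ≠ Val.bot ∨ x w ≠ Val.bot) ∧ (x u ≠ Val.bot → x v = x u ∧ x w = x u)))

def data : Gate n → Bool × ℕ × ℕ × ℕ
  | nand u v w => (false, u, v, w)
  | purify u v w => (true, u, v, w)

theorem data_injective : Function.Injective (@data n) := by
  intro a b h
  cases a <;> cases b <;> simp_all [data, Fin.ext_iff]

end Gate

/-- A Pure-Circuit instance on the nodes `0, …, n - 1`: the three nodes of a gate are distinct,
and every node is the output of exactly one gate. -/
structure PureCircuit where
  n : ℕ
  gates : List (Gate n)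
  distinct : ∀ g ∈ gates, (g.inputs ++ g.outputs).Nodup
  output_once : ∀ w, (gates.flatMap Gate.outputs).count w = 1

/-- Every node is the input to exactly one gate. -/
def PureCircuit.InputOnce (C : PureCircuit) : Prop :=
  ∀ w, (C.gates.flatMap Gate.inputs).count w = 1

def PureCircuit.data (C : PureCircuit) : ℕ × List (Bool × ℕ × ℕ × ℕ) :=
  (C.n, C.gates.map Gate.data)

theorem PureCircuit.data_injective : Function.Injective PureCircuit.data := by
  rintro ⟨n, G, h1, h2⟩ ⟨n', G', h1', h2'⟩ h
  simp only [PureCircuit.data, Prod.mk.injEq] at h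
  obtain ⟨rfl, hG⟩ := h
  cases Gate.data_injective.list_map hG
  rfl

def PureCircuit.code : Code PureCircuit :=
  (Code.nat.prod (Code.bool.prod (Code.nat.prod (Code.nat.prod Code.nat))).list).map
    PureCircuit.data PureCircuit.data_injective

/-- One symbol for each of the three values. -/
def Val.code : Code Val where
  enc
    | zero => [Γ'.bit false]
    | one => [Γ'.bit true]
    | bot => [Γ'.blank]
  uniq a b s t h := by cases a <;> cases b <;> simp_all

/-- `δ`-Pure-Circuit, restricted to the instances in which every node is the input to exactly one
gate: find an assignment (the list of the values of all nodes) that satisfies at least a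
`1 - δ` fraction of the gates. -/
noncomputable def pureCircuit (δ : ℝ) : SearchProblem where
  Inst := {C : PureCircuit // C.InputOnce}
  Sol := List Val
  instEnc := (PureCircuit.code.map Subtype.val Subtype.val_injective).toEncoding
  solEnc := Val.code.list.toEncoding
  IsSol C x := x.length = C.1.n ∧
    (1 - δ) * C.1.gates.length ≤
      (C.1.gates.countP fun g => decide (g.Sat fun v => x.getD v Val.bot) : ℕ)

/-- The PCP-for-PPAD conjecture. -/
def PCPforPPAD : Prop := ∃ δ : ℝ, 0 < δ ∧ δ ≤ 1 ∧ PPADHard (pureCircuit δ)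

/-! ### Fisher markets -/

/-- The value at `x ≥ 0` of the piecewise-linear function with `f 0 = 0` that has linear pieces of
the given (slope, length), followed by an infinite piece of slope `last`. -/
noncomputable def evalPieces (last : ℚ≥0) : List (ℚ≥0 × ℚ≥0) → ℝ → ℝ
  | [], x => last * x
  | (s, l) :: t, x => s * min x l + evalPieces last t (max (x - l) 0)

/-- A non-decreasing piecewise-linear concave function on `[0, ∞)` with value `0` at `0`. -/
structure PLC where
  pieces : List (ℚ≥0 × ℚ≥0)
  last : ℚ≥0
  length_pos : ∀ q ∈ pieces, 0 < q.2
  slopes_decreasing : (pieces.map Prod.fst ++ [last]).Pairwise (· > ·)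

namespace PLC

def slopes (f : PLC) : List ℚ≥0 := f.pieces.map Prod.fst ++ [f.last]

noncomputable def value (f : PLC) (x : ℝ) : ℝ := evalPieces f.last f.pieces x

/-- The zero function. -/
def zero : PLC := ⟨[], 0, by simp, by simp⟩

/-- `f` is not the zero function. -/
def NonZero (f : PLC) : Prop := ∃ x, 0 ≤ x ∧ f.value x ≠ 0

/-- `f x = min (a x) b` with `a ≥ 0` and `b ∈ [0, ∞]`. -/
def IsLinearCapped (f : PLC) : Prop :=
  ∃ a : ℝ, 0 ≤ a ∧ ((∀ x, 0 ≤ x → f.value x = a * x) ∨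
    ∃ b : ℝ, 0 ≤ b ∧ ∀ x, 0 ≤ x → f.value x = min (a * x) b)

/-- `f` is linear (uncapped) with strictly positive slope. -/
def IsLinearPos (f : PLC) : Prop := ∃ a : ℝ, 0 < a ∧ ∀ x, 0 ≤ x → f.value x = a * x

def data (f : PLC) : List (ℚ≥0 × ℚ≥0) × ℚ≥0 := (f.pieces, f.last)

theorem data_injective : Function.Injective data := by
  intro a b h
  cases a; cases b
  simp_all [data]

def code : Code PLC := ((Code.nnrat.prod Code.nnrat).list.prod Code.nnrat).map data data_injective

end PLC

/-- A buyer in a market with `m` goods: the budget, and the utility functions of those goods that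
are listed; for every other good the utility function is zero. -/
structure Buyer (m : ℕ) where
  budget : ℚ≥0
  utility : List (Fin m × PLC)
  budget_pos : 0 < budget
  nodup : (utility.map Prod.fst).Nodup

/-- A Fisher market with separable piecewise-linear concave utilities and one unit of each good. -/
structure FisherMarket where
  numGoods : ℕ
  buyers : List (Buyer numGoods)
  buyers_nonempty : buyers ≠ []

def Buyer.data {m : ℕ} (b : Buyer m) : ℚ≥0 × List (ℕ × PLC) :=
  (b.budget, b.utility.map fun e => ((e.1 : ℕ), e.2))

theorem Buyer.data_injective {m : ℕ} : Function.Injective (@Buyer.data m) := by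
  rintro ⟨e, u, h1, h2⟩ ⟨e', u', h1', h2'⟩ h
  simp only [Buyer.data, Prod.mk.injEq] at h
  obtain ⟨rfl, hu⟩ := h
  have hinj : Function.Injective (fun e : Fin m × PLC => ((e.1 : ℕ), e.2)) := by
    rintro ⟨a, b⟩ ⟨a', b'⟩ h
    simpa [Fin.ext_iff] using h
  cases hinj.list_map hu
  rfl

namespace FisherMarket

def data (M : FisherMarket) : ℕ × List (ℚ≥0 × List (ℕ × PLC)) :=
  (M.numGoods, M.buyers.map Buyer.data)

theorem data_injective : Function.Injective data := by
  rintro ⟨n, B, h1⟩ ⟨n', B', h1'⟩ h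
  simp only [data, Prod.mk.injEq] at h
  obtain ⟨rfl, hB⟩ := h
  cases Buyer.data_injective.list_map hB
  rfl

def code : Code FisherMarket :=
  (Code.nat.prod (Code.nnrat.prod (Code.nat.prod PLC.code).list).list).map data data_injective

variable (M : FisherMarket)

/-- The goods. -/
abbrev Good : Type := Fin M.numGoods

/-- The (indices of the) buyers. -/
abbrev Buyers : Type := Fin M.buyers.length

/-- The budget of buyer `i`. -/
def budget (i : M.Buyers) : ℚ≥0 := (M.buyers.get i).budget

/-- The utility function of buyer `i` for good `j`. -/
def util (i : M.Buyers) (j : M.Good) : PLC :=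
  ((M.buyers.get i).utility.lookup j).getD PLC.zero

/-- The utility that buyer `i` derives from the bundle `y`. -/
noncomputable def utility (i : M.Buyers) (y : M.Good → ℝ) : ℝ := ∑ j, (M.util i j).value (y j)

/-- The bundles that buyer `i` can afford at prices `p`. -/
def Feasible (p : M.Good → ℝ) (i : M.Buyers) : Set (M.Good → ℝ) :=
  {y | (∀ j, 0 ≤ y j) ∧ ∑ j, p j * y j ≤ M.budget i}

/-- The `(1 - δ)`-optimal bundles of buyer `i` at prices `p`: the utility is at least `1 - δ` times
the utility of every affordable bundle, hence there are none if `δ < 1` and the utilities of the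
affordable bundles are unbounded. -/
def ApproxOpt (δ : ℝ) (p : M.Good → ℝ) (i : M.Buyers) : Set (M.Good → ℝ) :=
  {y | y ∈ M.Feasible p i ∧ ∀ z ∈ M.Feasible p i, (1 - δ) * M.utility i z ≤ M.utility i y}

/-- `(ε, δ)`-approximate market equilibria. -/
def IsApproxEquilibrium (ε δ : ℝ) (p : M.Good → ℝ) (x : M.Buyers → M.Good → ℝ) : Prop :=
  (∀ j, 0 ≤ p j) ∧ (∀ i, x i ∈ M.ApproxOpt δ p i) ∧ ∀ j, |∑ i, x i j - 1| ≤ ε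

/-- The conditions on a market in a simple family with constants `D₁`, `D₂`, `R`. -/
structure IsSimple (D₁ D₂ : ℕ) (R : ℝ) : Prop where
  linear_capped : ∀ i j, (M.util i j).IsLinearCapped
  budget_one : ∀ i, M.budget i = 1
  buyer_degree : ∀ i, {j | (M.util i j).NonZero}.ncard ≤ D₁
  good_degree : ∀ j, {i | (M.util i j).NonZero}.ncard ≤ D₂
  slope_ratio : ∀ i j j', ∀ s ∈ (M.util i j).slopes, ∀ s' ∈ (M.util i j').slopes,
    s ≠ 0 → s' ≠ 0 → (s : ℝ) ≤ R * s'
  nonsatiated : ∀ i, ∃ j, (M.util i j).IsLinearPos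

end FisherMarket

/-- A family of Fisher markets is simple if the conditions hold with the same constants for all
markets of the family. -/
def IsSimpleFamily (F : Set FisherMarket) : Prop :=
  ∃ (D₁ D₂ : ℕ) (R : ℝ), ∀ M ∈ F, M.IsSimple D₁ D₂ R

/-- The problem of computing an `(ε, δ)`-approximate market equilibrium in the markets of the
family `F`. A solution lists the prices of all goods and, for every buyer, the amounts of all goods
allocated to that buyer. -/
noncomputable def fisherEquilibrium (F : Set FisherMarket) (ε δ : ℝ) : SearchProblem where
  Inst := {M : FisherMarket // M ∈ F}
  Sol := List ℚ≥0 × List (List ℚ≥0)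
  instEnc := (FisherMarket.code.map Subtype.val Subtype.val_injective).toEncoding
  solEnc := (Code.nnrat.list.prod Code.nnrat.list.list).toEncoding
  IsSol M y := y.1.length = M.1.numGoods ∧ y.2.length = M.1.buyers.length ∧
    (∀ r ∈ y.2, r.length = M.1.numGoods) ∧
    M.1.IsApproxEquilibrium ε δ (fun j => (y.1.getD j 0 : ℚ≥0))
      (fun i j => ((y.2.getD i []).getD j 0 : ℚ≥0))

end FisherPCP

/-! Every node `v` becomes four goods, and every good `k` has its own buyer, who values good `k`
linearly with slope 1 and a few other goods with slope `10 ^ 8` up to a cap. Two regimes drive the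
construction. A buyer whose own good is not very cheap first buys nearly the full capped amounts of
the other goods (`Eqm.demand`). What the capped goods cannot absorb is spent on the buyer's own good
(`Eqm.alive`).

Together they give an inverter, `Eqm.kill`. Suppose buyer `k` may consume 0.88 units of good `j`. If
buyer `j` spends at least 0.279 on good `j`, then good `k` must be very cheap: otherwise buyer `k`
would take 0.88 of the at most 10/9 units sold, and too little would be left for buyer `j`. If good
`j` is cheap, buyer `k` keeps its money for good `k`. The goods `d`, `r`, `i` of a node form two
inverters in series. The node has value 0 if `r` is cheap, 1 if `r` is not cheap but `i` is, and `⊥`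
otherwise.

For NAND, the buyer of the output's `d` consumes both input goods `i` (`nand_sat`). For PURIFY, two
buyers with caps 0.371 and 0.515 consume the same input good; the different caps give different
price thresholds, so for no price of the input good are both outputs undetermined (`purify_sat`).
The useful demand of other buyers for a good is at most 0.371 + 0.515 = 0.886 < 8/9, so a buyer
always holds some of its own good and prices are bounded.

Approximate optimality and clearing allow goods to be allocated where they are useless. This waste
is at most a constant times `δ` per good on average (`Eqm.sum_waste_le`). A gate whose nodes have
little waste is satisfied (`gate_sat`), and every node lies in two gates, so averaging leaves a
fraction of at most `10 ^ 25 * δ` unsatisfied (`sat_fraction`). Hence `δ = δc / 10 ^ 25`.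

Polynomial time is proved for actual machines. The market is written by a finite-state transducer
that reads a string with suitable repetitions. The assignment is read off the prices alone by
comparing the binary lengths of numerators and denominators. The second claim composes this with a
given reduction to Pure-Circuit; the backward map needs no circuit, so it only has to carry the
original instance along. -/

namespace FisherPCP

open Turing StateTransition

/-! ### Composition of polynomial-time computations -/

/-- `f` leads from `a` to `b` in exactly `n` steps. -/
def Runs {σ : Type*} (f : σ → Option σ) (n : ℕ) (a b : σ) : Prop :=
  (flip bind f)^[n] (some a) = some b

namespace Runs

variable {σ : Type*} {f : σ → Option σ} {a b c : σ} {m n : ℕ}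

theorem refl (f : σ → Option σ) (a : σ) : Runs f 0 a a := rfl

theorem trans (h₁ : Runs f m a b) (h₂ : Runs f n b c) : Runs f (m + n) a c := by
  unfold Runs at *
  rw [Nat.add_comm, Function.iterate_add_apply, h₁, h₂]

theorem single (h : f a = some b) : Runs f 1 a b := h

theorem head (h : f a = some b) (h₂ : Runs f n b c) : Runs f (n + 1) a c := by
  rw [Nat.add_comm]; exact (single h).trans h₂

theorem cast (h : Runs f n a b) (e : n = m) : Runs f m a b := e ▸ h

theorem succ_iff : Runs f (n + 1) a c ↔ ∃ b, f a = some b ∧ Runs f n b c := by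
  constructor
  · intro h
    unfold Runs at h
    rw [Function.iterate_succ_apply] at h
    change (flip bind f)^[n] (f a) = some c at h
    rcases hfa : f a with _ | b
    · rw [hfa] at h
      exfalso
      clear hfa
      induction n with
      | zero => simp at h
      | succ k ih => rw [Function.iterate_succ_apply] at h; exact ih h
    · exact ⟨b, rfl, by rw [hfa] at h; exact h⟩
  · rintro ⟨b, h₁, h₂⟩
    exact head h₁ h₂

theorem simulate {τ : Type*} {g : τ → Option τ} (t : σ → τ)
    (H : ∀ a b, f a = some b → g (t a) = some (t b)) :
    ∀ {n : ℕ} {a b : σ}, Runs f n a b → Runs g n (t a) (t b)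
  | 0, a, b, h => by
    cases Option.some.inj h
    exact refl _ _
  | n + 1, a, b, h => by
    obtain ⟨c, h₁, h₂⟩ := succ_iff.1 h
    exact head (H _ _ h₁) (simulate t H h₂)

theorem simulate_mul {τ : Type*} {g : τ → Option τ} (t : σ → τ) {k : ℕ}
    (H : ∀ a b, f a = some b → Runs g k (t a) (t b)) :
    ∀ {n : ℕ} {a b : σ}, Runs f n a b → Runs g (k * n) (t a) (t b)
  | 0, a, b, h => by
    cases Option.some.inj h
    exact refl _ _
  | n + 1, a, b, h => by
    obtain ⟨c, h₁, h₂⟩ := succ_iff.1 h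
    exact ((H _ _ h₁).trans (simulate_mul t H h₂)).cast (by ring)

end Runs

theorem initList_eq (tm : FinTM2) (s : List (tm.Γ tm.k₀)) :
    initList tm s = ⟨some tm.main, tm.initialState, Function.update (fun _ => []) tm.k₀ s⟩ := by
  unfold initList
  congr 1
  funext k
  by_cases h : k = tm.k₀
  · subst h; simp
  · simp [h]

theorem haltList_eq (tm : FinTM2) (s : List (tm.Γ tm.k₁)) :
    haltList tm s = ⟨none, tm.initialState, Function.update (fun _ => []) tm.k₁ s⟩ := by
  unfold haltList
  congr 1
  funext k
  by_cases h : k = tm.k₁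
  · subst h; simp
  · simp [h]

/-- The machine `tm` turns `l` into `l'` in at most `m` steps. -/
def Outputs (tm : FinTM2) (l : List (tm.Γ tm.k₀)) (l' : List (tm.Γ tm.k₁)) (m : ℕ) : Prop :=
  ∃ n ≤ m, Runs tm.step n
    ⟨some tm.main, tm.initialState, Function.update (fun _ => []) tm.k₀ l⟩
    ⟨none, tm.initialState, Function.update (fun _ => []) tm.k₁ l'⟩

/-- Replaces the bundled evaluation data by a step count, a form in which machines can be
constructed and composed. -/
theorem polyTime_iff {α β A B : Type} {ea : α → List A} {eb : β → List B} {f : α → β} :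
    PolyTime ea eb f ↔ ∃ (tm : FinTM2) (i : tm.Γ tm.k₀ ≃ A) (o : tm.Γ tm.k₁ ≃ B)
      (t : Polynomial ℕ), ∀ a, Outputs tm ((ea a).map i.symm) ((eb (f a)).map o.symm)
        (t.eval (ea a).length) := by
  constructor
  · rintro ⟨⟨⟨tm, i, o⟩, t, h⟩⟩
    refine ⟨tm, i, o, t, fun a => ?_⟩
    obtain ⟨⟨n, h1⟩, h2⟩ := h a
    refine ⟨n, h2, ?_⟩
    rw [initList_eq] at h1
    refine h1.trans ?_
    exact congrArg some (haltList_eq _ _)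
  · rintro ⟨tm, i, o, t, h⟩
    refine ⟨⟨⟨tm, i, o⟩, t, fun a => Classical.choice ?_⟩⟩
    obtain ⟨n, h1, h2⟩ := h a
    refine ⟨⟨⟨n, ?_⟩, h1⟩⟩
    rw [initList_eq]
    exact Eq.trans h2 (congrArg some (haltList_eq _ _).symm)

/-- An upper bound on the number of symbols that a statement pushes. -/
def pushes {K : Type*} {Γ : K → Type*} {Λ σ : Type*} : TM2.Stmt Γ Λ σ → ℕ
  | .push _ _ q => pushes q + 1
  | .peek _ _ q => pushes q
  | .pop _ _ q => pushes q
  | .load _ q => pushes q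
  | .branch _ q₁ q₂ => max (pushes q₁) (pushes q₂)
  | .goto _ => 0
  | .halt => 0

theorem stepAux_length_le {K : Type*} [DecidableEq K] {Γ : K → Type*} {Λ σ : Type*} (k : K) :
    ∀ (q : TM2.Stmt Γ Λ σ) (v : σ) (S : ∀ k, List (Γ k)),
      ((TM2.stepAux q v S).stk k).length ≤ (S k).length + pushes q
  | .push k' f q, v, S => by
    refine (stepAux_length_le k q v _).trans ?_
    by_cases h : k = k'
    · subst h; simp only [Function.update_self, List.length_cons, pushes]; omega
    · simp [h, pushes]
  | .peek k' f q, v, S => stepAux_length_le k q _ S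
  | .pop k' f q, v, S => by
    refine (stepAux_length_le k q _ _).trans ?_
    by_cases h : k = k'
    · subst h; simp [pushes]
    · simp [h, pushes]
  | .load f q, v, S => stepAux_length_le k q _ S
  | .branch f q₁ q₂, v, S => by
    simp only [TM2.stepAux, pushes]
    have h₁ := stepAux_length_le k q₁ v S
    have h₂ := stepAux_length_le k q₂ v S
    cases f v
    · exact h₂.trans (by omega)
    · exact h₁.trans (by omega)
  | .goto f, v, S => by simp [pushes]
  | .halt, v, S => by simp [pushes]

/-- A step runs one statement, and `d` is the largest number of pushes over the finitely many
labels. This bounds the intermediate string when two machines run in sequence. -/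
theorem exists_step_length_le (tm : FinTM2) : ∃ d : ℕ, ∀ (n : ℕ) (a b : tm.Cfg),
    Runs tm.step n a b → ∀ k, (b.stk k).length ≤ (a.stk k).length + d * n := by
  have := tm.ΛFin
  refine ⟨Finset.univ.sup fun l => pushes (tm.m l), fun n => ?_⟩
  induction n with
  | zero =>
    intro a b h k
    cases Option.some.inj h
    simp
  | succ n ih =>
    intro a b h k
    obtain ⟨c, h₁, h₂⟩ := Runs.succ_iff.1 h
    refine (ih _ _ h₂ k).trans ?_
    obtain ⟨l, v, S⟩ := a
    cases l with
    | none => cases h₁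
    | some l =>
      cases Option.some.inj h₁
      have h₃ := stepAux_length_le k (tm.m l) v S
      have h₄ : pushes (tm.m l) ≤ Finset.univ.sup fun l => pushes (tm.m l) :=
        Finset.le_sup (f := fun l => pushes (tm.m l)) (Finset.mem_univ l)
      change _ ≤ (S k).length + _
      rw [Nat.mul_succ]
      omega

/-! ### Sequential composition of two machines. -/

section comp

variable (M₁ M₂ : FinTM2) (e : M₁.Γ M₁.k₁ ≃ M₂.Γ M₂.k₀)

/-- The stack alphabets of the composed machine: those of both machines and an auxiliary stack. -/
abbrev CompΓ : M₁.K ⊕ (M₂.K ⊕ Unit) → Type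
  | .inl k => M₁.Γ k
  | .inr (.inl k) => M₂.Γ k
  | .inr (.inr _) => M₂.Γ M₂.k₀

/-- The labels of the composed machine: those of both machines, and those of two copying loops. -/
abbrev CompΛ : Type := M₁.Λ ⊕ (M₂.Λ ⊕ (Bool × Option (M₂.Γ M₂.k₀)))

abbrev Compσ : Type := M₁.σ × M₂.σ × Option (M₂.Γ M₂.k₀)

/-- Halting of the first machine becomes a jump to the first copying loop. -/
def compStmt₁ : TM2.Stmt M₁.Γ M₁.Λ M₁.σ → TM2.Stmt (CompΓ M₁ M₂) (CompΛ M₁ M₂) (Compσ M₁ M₂)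
  | .push k f q => .push (.inl k) (fun s => f s.1) (compStmt₁ q)
  | .peek k f q => .peek (.inl k) (fun s o => (f s.1 o, s.2)) (compStmt₁ q)
  | .pop k f q => .pop (.inl k) (fun s o => (f s.1 o, s.2)) (compStmt₁ q)
  | .load f q => .load (fun s => (f s.1, s.2)) (compStmt₁ q)
  | .branch f q₁ q₂ => .branch (fun s => f s.1) (compStmt₁ q₁) (compStmt₁ q₂)
  | .goto f => .goto fun s => .inl (f s.1)
  | .halt => .goto fun _ => .inr (.inr (false, none))

def compStmt₂ : TM2.Stmt M₂.Γ M₂.Λ M₂.σ → TM2.Stmt (CompΓ M₁ M₂) (CompΛ M₁ M₂) (Compσ M₁ M₂)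
  | .push k f q => .push (.inr (.inl k)) (fun s => f s.2.1) (compStmt₂ q)
  | .peek k f q => .peek (.inr (.inl k)) (fun s o => (s.1, f s.2.1 o, s.2.2)) (compStmt₂ q)
  | .pop k f q => .pop (.inr (.inl k)) (fun s o => (s.1, f s.2.1 o, s.2.2)) (compStmt₂ q)
  | .load f q => .load (fun s => (s.1, f s.2.1, s.2.2)) (compStmt₂ q)
  | .branch f q₁ q₂ => .branch (fun s => f s.2.1) (compStmt₂ q₁) (compStmt₂ q₂)
  | .goto f => .goto fun s => .inr (.inl (f s.2.1))
  | .halt => .halt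

/-- The program of the composed machine. -/
def compProg : CompΛ M₁ M₂ → TM2.Stmt (CompΓ M₁ M₂) (CompΛ M₁ M₂) (Compσ M₁ M₂)
  | .inl l => compStmt₁ M₁ M₂ (M₁.m l)
  | .inr (.inl l) => compStmt₂ M₁ M₂ (M₂.m l)
  -- Moving a word from stack to stack reverses it; going through the auxiliary stack reverses it
  -- twice. The label remembers the popped symbol for the push that follows.
  | .inr (.inr (false, none)) =>
    .pop (.inl M₁.k₁) (fun s o => (s.1, s.2.1, o.map e)) <| .goto fun s =>
      match s.2.2 with
      | some x => .inr (.inr (false, some x))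
      | none => .inr (.inr (true, none))
  | .inr (.inr (false, some x)) =>
    .push (.inr (.inr ())) (fun _ => x) <| .goto fun _ => .inr (.inr (false, none))
  | .inr (.inr (true, none)) =>
    .pop (.inr (.inr ())) (fun s o => (s.1, s.2.1, o)) <| .goto fun s =>
      match s.2.2 with
      | some x => .inr (.inr (true, some x))
      | none => .inr (.inl M₂.main)
  | .inr (.inr (true, some x)) =>
    .push (.inr (.inl M₂.k₀)) (fun _ => x) <| .goto fun _ => .inr (.inr (true, none))

/-- The composed machine. -/
def compTM : FinTM2 :=
  haveI := M₁.kFin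
  haveI := M₂.kFin
  haveI := M₁.ΛFin
  haveI := M₂.ΛFin
  haveI := M₁.σFin
  haveI := M₂.σFin
  haveI := M₂.Γk₀Fin
  { K := M₁.K ⊕ (M₂.K ⊕ Unit)
    k₀ := .inl M₁.k₀
    k₁ := .inr (.inl M₂.k₁)
    Γ := CompΓ M₁ M₂
    Λ := CompΛ M₁ M₂
    main := .inl M₁.main
    σ := Compσ M₁ M₂
    initialState := (M₁.initialState, M₂.initialState, none)
    Γk₀Fin := M₁.Γk₀Fin
    m := compProg M₁ M₂ e }

variable {M₁ M₂}

/-- The stacks of the composed machine. -/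
def compStk (S : ∀ k, List (M₁.Γ k)) (T : ∀ k, List (M₂.Γ k)) (l : List (M₂.Γ M₂.k₀)) :
    ∀ k, List (CompΓ M₁ M₂ k)
  | .inl k => S k
  | .inr (.inl k) => T k
  | .inr (.inr _) => l

theorem update_compStk_inl (S : ∀ k, List (M₁.Γ k)) (T : ∀ k, List (M₂.Γ k))
    (l : List (M₂.Γ M₂.k₀)) (k : M₁.K) (x : List (M₁.Γ k)) :
    Function.update (compStk S T l) (.inl k) x = compStk (Function.update S k x) T l := by
  funext k'
  rcases k' with k' | k' | k'
  · by_cases h : k' = k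
    · subst h; simp [compStk]
    · simp [compStk, h]
  · simp [compStk]
  · simp [compStk]

theorem update_compStk_inr (S : ∀ k, List (M₁.Γ k)) (T : ∀ k, List (M₂.Γ k))
    (l : List (M₂.Γ M₂.k₀)) (k : M₂.K) (x : List (M₂.Γ k)) :
    Function.update (compStk S T l) (.inr (.inl k)) x =
      compStk S (Function.update T k x) l := by
  funext k'
  rcases k' with k' | k' | k'
  · simp [compStk]
  · by_cases h : k' = k
    · subst h; simp [compStk]
    · simp [compStk, h]
  · simp [compStk]

theorem update_compStk_aux (S : ∀ k, List (M₁.Γ k)) (T : ∀ k, List (M₂.Γ k))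
    (l x : List (M₂.Γ M₂.k₀)) :
    Function.update (compStk S T l) (.inr (.inr ())) x = compStk S T x := by
  funext k'
  rcases k' with k' | k' | k' <;> simp [compStk]

theorem compStmt₁_stepAux (T : ∀ k, List (M₂.Γ k)) (l : List (M₂.Γ M₂.k₀))
    (w : M₂.σ × Option (M₂.Γ M₂.k₀)) :
    ∀ (q : TM2.Stmt M₁.Γ M₁.Λ M₁.σ) (v : M₁.σ) (S : ∀ k, List (M₁.Γ k)),
      TM2.stepAux (compStmt₁ M₁ M₂ q) (v, w) (compStk S T l) =
        ⟨some ((TM2.stepAux q v S).l.elim (.inr (.inr (false, none))) .inl),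
          ((TM2.stepAux q v S).var, w), compStk (TM2.stepAux q v S).stk T l⟩
  | .push k f q, v, S => by
    simp only [compStmt₁, TM2.stepAux]
    rw [update_compStk_inl]
    exact compStmt₁_stepAux T l w q _ _
  | .peek k f q, v, S => by
    simp only [compStmt₁, TM2.stepAux]
    exact compStmt₁_stepAux T l w q _ _
  | .pop k f q, v, S => by
    simp only [compStmt₁, TM2.stepAux]
    rw [update_compStk_inl]
    exact compStmt₁_stepAux T l w q _ _
  | .load f q, v, S => by
    simp only [compStmt₁, TM2.stepAux]
    exact compStmt₁_stepAux T l w q _ _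
  | .branch f q₁ q₂, v, S => by
    simp only [compStmt₁, TM2.stepAux]
    cases f v
    · exact compStmt₁_stepAux T l w q₂ _ _
    · exact compStmt₁_stepAux T l w q₁ _ _
  | .goto f, v, S => rfl
  | .halt, v, S => rfl

theorem compStmt₂_stepAux (S : ∀ k, List (M₁.Γ k)) (l : List (M₂.Γ M₂.k₀)) (u : M₁.σ)
    (w : Option (M₂.Γ M₂.k₀)) :
    ∀ (q : TM2.Stmt M₂.Γ M₂.Λ M₂.σ) (v : M₂.σ) (T : ∀ k, List (M₂.Γ k)),
      TM2.stepAux (compStmt₂ M₁ M₂ q) (u, v, w) (compStk S T l) =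
        ⟨(TM2.stepAux q v T).l.map fun l => .inr (.inl l),
          (u, (TM2.stepAux q v T).var, w), compStk S (TM2.stepAux q v T).stk l⟩
  | .push k f q, v, T => by
    simp only [compStmt₂, TM2.stepAux]
    rw [update_compStk_inr]
    exact compStmt₂_stepAux S l u w q _ _
  | .peek k f q, v, T => by
    simp only [compStmt₂, TM2.stepAux]
    exact compStmt₂_stepAux S l u w q _ _
  | .pop k f q, v, T => by
    simp only [compStmt₂, TM2.stepAux]
    rw [update_compStk_inr]
    exact compStmt₂_stepAux S l u w q _ _
  | .load f q, v, T => by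
    simp only [compStmt₂, TM2.stepAux]
    exact compStmt₂_stepAux S l u w q _ _
  | .branch f q₁ q₂, v, T => by
    simp only [compStmt₂, TM2.stepAux]
    cases f v
    · exact compStmt₂_stepAux S l u w q₂ _ _
    · exact compStmt₂_stepAux S l u w q₁ _ _
  | .goto f, v, T => rfl
  | .halt, v, T => rfl

/-- A configuration of the composed machine. -/
abbrev compCfg (l : Option (CompΛ M₁ M₂)) (v : Compσ M₁ M₂) (S : ∀ k, List (M₁.Γ k))
    (T : ∀ k, List (M₂.Γ k)) (a : List (M₂.Γ M₂.k₀)) : (compTM M₁ M₂ e).Cfg :=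
  ⟨l, v, compStk S T a⟩

theorem compTM_step (l : CompΛ M₁ M₂) (v : Compσ M₁ M₂) (S : ∀ k, List (M₁.Γ k))
    (T : ∀ k, List (M₂.Γ k)) (a : List (M₂.Γ M₂.k₀)) :
    (compTM M₁ M₂ e).step (compCfg e (some l) v S T a) =
      some (TM2.stepAux (compProg M₁ M₂ e l) v (compStk S T a)) := rfl

theorem comp_runs₁ {n : ℕ} {a b : M₁.Cfg} (h : Runs M₁.step n a b) :
    Runs (compTM M₁ M₂ e).step n
      (compCfg e (some (a.l.elim (.inr (.inr (false, none))) .inl))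
        (a.var, M₂.initialState, none) a.stk (fun _ => []) [])
      (compCfg e (some (b.l.elim (.inr (.inr (false, none))) .inl))
        (b.var, M₂.initialState, none) b.stk (fun _ => []) []) := by
  refine Runs.simulate (f := M₁.step) (fun a : M₁.Cfg =>
    compCfg e (some (a.l.elim (.inr (.inr (false, none))) .inl))
        (a.var, M₂.initialState, none) a.stk (fun _ => []) []) ?_ h
  rintro ⟨l, v, S⟩ b h
  cases l with
  | none => cases h
  | some l =>
    cases Option.some.inj h
    exact congrArg some (compStmt₁_stepAux _ _ _ _ _ _)

theorem comp_runs₂ {n : ℕ} {a b : M₂.Cfg} (h : Runs M₂.step n a b) :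
    Runs (compTM M₁ M₂ e).step n
      (compCfg e (a.l.map fun l => .inr (.inl l))
        (M₁.initialState, a.var, none) (fun _ => []) a.stk [])
      (compCfg e (b.l.map fun l => .inr (.inl l))
        (M₁.initialState, b.var, none) (fun _ => []) b.stk []) := by
  refine Runs.simulate (f := M₂.step) (fun a : M₂.Cfg =>
    compCfg e (a.l.map fun l => .inr (.inl l))
        (M₁.initialState, a.var, none) (fun _ => []) a.stk []) ?_ h
  rintro ⟨l, v, S⟩ b h
  cases l with
  | none => cases h
  | some l =>
    cases Option.some.inj h
    exact congrArg some (compStmt₂_stepAux _ _ _ _ _ _ _)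

/-- A pop and a push per symbol, then a pop from the empty stack. That last pop resets the register
to `none`, as the final configuration must contain the initial state. -/
theorem comp_copy₁ (v₁ : M₁.σ) (v₂ : M₂.σ) : ∀ (l : List (M₁.Γ M₁.k₁)) (a : List (M₂.Γ M₂.k₀))
    (o : Option (M₂.Γ M₂.k₀)),
    Runs (compTM M₁ M₂ e).step (2 * l.length + 1)
      (compCfg e (some (.inr (.inr (false, none)))) (v₁, v₂, o)
        (Function.update (fun _ => []) M₁.k₁ l) (fun _ => []) a)
      (compCfg e (some (.inr (.inr (true, none)))) (v₁, v₂, none)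
        (fun _ => []) (fun _ => []) ((l.map e).reverse ++ a))
  | [], a, o => by
    refine Runs.single ?_
    rw [compTM_step]
    simp only [compProg, TM2.stepAux]
    rw [update_compStk_inl]
    simp [compStk]
    rfl
  | x :: l, a, o => by
    have h := comp_copy₁ v₁ v₂ l (e x :: a) (some (e x))
    have h' := Runs.head (a := compCfg e (some (.inr (.inr (false, none)))) (v₁, v₂, o)
        (Function.update (fun _ => []) M₁.k₁ (x :: l)) (fun _ => []) a) (b := ?_) ?_
      (Runs.head ?_ h)
    · simpa [mul_add, add_assoc] using h'
    · exact compCfg e (some (.inr (.inr (false, some (e x))))) (v₁, v₂, some (e x))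
        (Function.update (fun _ => []) M₁.k₁ l) (fun _ => []) a
    · rw [compTM_step]
      simp only [compProg, TM2.stepAux]
      rw [update_compStk_inl]
      simp [compStk]
      rfl
    · rw [compTM_step]
      simp only [compProg, TM2.stepAux]
      rw [update_compStk_aux]
      simp [compStk]
      rfl

theorem comp_copy₂ (v₁ : M₁.σ) (v₂ : M₂.σ) : ∀ (l a : List (M₂.Γ M₂.k₀))
    (o : Option (M₂.Γ M₂.k₀)),
    Runs (compTM M₁ M₂ e).step (2 * l.length + 1)
      (compCfg e (some (.inr (.inr (true, none)))) (v₁, v₂, o)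
        (fun _ => []) (Function.update (fun _ => []) M₂.k₀ a) l)
      (compCfg e (some (.inr (.inl M₂.main))) (v₁, v₂, none)
        (fun _ => []) (Function.update (fun _ => []) M₂.k₀ (l.reverse ++ a)) [])
  | [], a, o => by
    refine Runs.single ?_
    rw [compTM_step]
    simp only [compProg, TM2.stepAux]
    rw [update_compStk_aux]
    simp [compStk]
    rfl
  | x :: l, a, o => by
    have h := comp_copy₂ v₁ v₂ l (x :: a) (some x)
    have h' := Runs.head (a := compCfg e (some (.inr (.inr (true, none)))) (v₁, v₂, o)
        (fun _ => []) (Function.update (fun _ => []) M₂.k₀ a) (x :: l)) (b := ?_) ?_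
      (Runs.head ?_ h)
    · simpa [mul_add, add_assoc] using h'
    · exact compCfg e (some (.inr (.inr (true, some x)))) (v₁, v₂, some x)
        (fun _ => []) (Function.update (fun _ => []) M₂.k₀ a) l
    · rw [compTM_step]
      simp only [compProg, TM2.stepAux]
      rw [update_compStk_aux]
      simp [compStk]
      rfl
    · rw [compTM_step]
      simp only [compProg, TM2.stepAux]
      rw [update_compStk_inr]
      simp [compStk]
      rfl

theorem compStk_nil : compStk (M₁ := M₁) (M₂ := M₂) (fun _ => []) (fun _ => []) [] =
    fun _ => [] := by
  funext k
  rcases k with k | k | k <;> rfl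

theorem comp_outputs {l₁ : List (M₁.Γ M₁.k₀)} {l₂ : List (M₁.Γ M₁.k₁)}
    {l₃ : List (M₂.Γ M₂.k₁)} {m₁ m₂ : ℕ} (h₁ : Outputs M₁ l₁ l₂ m₁)
    (h₂ : Outputs M₂ (l₂.map e) l₃ m₂) :
    Outputs (compTM M₁ M₂ e) l₁ l₃ (m₁ + (4 * l₂.length + 2) + m₂) := by
  obtain ⟨n₁, hn₁, r₁⟩ := h₁
  obtain ⟨n₂, hn₂, r₂⟩ := h₂
  refine ⟨n₁ + ((2 * l₂.length + 1) + (2 * l₂.length + 1)) + n₂, by omega, ?_⟩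
  have r₁' := comp_runs₁ (M₂ := M₂) e r₁
  have r₂' := comp_runs₂ (M₁ := M₁) e r₂
  have c₁ := comp_copy₁ e M₁.initialState M₂.initialState l₂ [] none
  have c₂ := comp_copy₂ e M₁.initialState M₂.initialState (l₂.map e).reverse [] none
  have h₀ : (Function.update (fun _ => []) M₂.k₀ [] : ∀ k, List (M₂.Γ k)) = fun _ => [] :=
    Function.update_eq_self_iff.2 rfl
  simp only [List.append_nil, List.reverse_reverse, List.length_reverse, List.length_map,
    h₀] at c₁ c₂
  have h := (r₁'.trans (c₁.trans c₂)).trans r₂'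
  simp only [compCfg, ← update_compStk_inl, ← update_compStk_inr, compStk_nil] at h
  exact h

end comp

/-! ### Polynomial time is closed under composition. -/

theorem natPoly_eval_mono (p : Polynomial ℕ) {m n : ℕ} (h : m ≤ n) : p.eval m ≤ p.eval n := by
  rw [Polynomial.eval_eq_sum, Polynomial.eval_eq_sum]
  exact Finset.sum_le_sum fun i _ => Nat.mul_le_mul_left _ (Nat.pow_le_pow_left h i)

theorem PolyTime.comp {α β γ A B C : Type} {ea : α → List A} {eb : β → List B} {ec : γ → List C}
    {f : α → β} {g : β → γ} (hg : PolyTime eb ec g) (hf : PolyTime ea eb f) :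
    PolyTime ea ec (g ∘ f) := by
  obtain ⟨M₁, i₁, o₁, t₁, h₁⟩ := polyTime_iff.1 hf
  obtain ⟨M₂, i₂, o₂, t₂, h₂⟩ := polyTime_iff.1 hg
  obtain ⟨d, hd⟩ := exists_step_length_le M₁
  -- `L` bounds the length of the intermediate string; `4 * L + 2` pays for the two copying loops.
  let L : Polynomial ℕ := Polynomial.X + Polynomial.C d * t₁
  refine polyTime_iff.2 ⟨compTM M₁ M₂ (o₁.trans i₂.symm), i₁, o₂,
    t₁ + (4 * L + 2) + t₂.comp L, fun a => ?_⟩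
  have hlen : (eb (f a)).length ≤ L.eval (ea a).length := by
    obtain ⟨n, hn, r⟩ := h₁ a
    have := hd n _ _ r M₁.k₁
    simp only [Function.update_self, List.length_map] at this
    -- The output stack may be the input stack, and is then not empty at the start.
    have h2 : ((Function.update (fun _ => []) M₁.k₀ ((ea a).map i₁.symm) :
        ∀ k, List (M₁.Γ k)) M₁.k₁).length ≤ (ea a).length := by
      by_cases h : M₁.k₁ = M₁.k₀
      · rw [h]; simp
      · simp [h]
    have h3 : d * n ≤ d * t₁.eval (ea a).length := Nat.mul_le_mul_left _ hn
    simp only [L, Polynomial.eval_add, Polynomial.eval_X, Polynomial.eval_mul, Polynomial.eval_C]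
    omega
  have h := comp_outputs (o₁.trans i₂.symm) (h₁ a) (l₃ := (ec (g (f a))).map o₂.symm)
    (m₂ := t₂.eval (eb (f a)).length) (by
      have := h₂ (f a)
      rw [List.map_map]
      convert! this using 2
      funext x
      simp)
  obtain ⟨n, hn, r⟩ := h
  refine ⟨n, hn.trans ?_, r⟩
  have h4 := natPoly_eval_mono t₂ hlen
  simp only [Polynomial.eval_add, Polynomial.eval_mul, Polynomial.eval_comp, List.length_map,
    Polynomial.eval_ofNat]
  omega

/-- Computations are designed on raw strings; what they do outside the valid encodings is
irrelevant. -/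
theorem PolyTime.of_list {α β A B : Type} {ea : α → List A} {eb : β → List B} {f : α → β}
    (F : List A → List B) (hF : PolyTime (fun s => s : List A → List A) (fun s => s) F)
    (h : ∀ a, F (ea a) = eb (f a)) : PolyTime ea eb f := by
  obtain ⟨M, i, o, t, hM⟩ := polyTime_iff.1 hF
  exact polyTime_iff.2 ⟨M, i, o, t, fun a => by rw [← h]; exact hM (ea a)⟩

end FisherPCP

namespace FisherPCP

open Turing StateTransition

/-! ### Stack programs -/

/-- The working stacks of a stack program; the last one is the output. -/
inductive Reg
  | a
  | b
  | c
  | o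
  deriving DecidableEq

instance : Fintype Reg := ⟨{.a, .b, .c, .o}, by rintro (_ | _) <;> simp⟩

/-- A program that pops, in every step, one symbol from the input or from a working stack, pushes
symbols on the working stacks, and then changes its state or halts. -/
structure Prog (A B Q : Type) where
  start : Q
  src : Q → Option Reg
  next : Q → Option A → Option B → Option Q × List (Reg × B)

/-- A configuration of a stack program. -/
structure PConf (A B Q : Type) where
  q : Option Q
  inp : List A
  regs : Reg → List B

def pushAll {B : Type} : List (Reg × B) → (Reg → List B) → Reg → List B
  | [], R => R
  | (r, x) :: l, R => pushAll l (Function.update R r (x :: R r))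

namespace Prog

variable {A B Q : Type} (P : Prog A B Q)

def step : PConf A B Q → Option (PConf A B Q)
  | ⟨none, _, _⟩ => none
  | ⟨some q, s, R⟩ =>
    match P.src q with
    | none => some ⟨(P.next q s.head? none).1, s.tail, pushAll (P.next q s.head? none).2 R⟩
    | some r => some ⟨(P.next q none (R r).head?).1, s,
        pushAll (P.next q none (R r).head?).2 (Function.update R r (R r).tail)⟩

theorem step_inp {q : Q} (h : P.src q = none) (s : List A) (R : Reg → List B) :
    P.step ⟨some q, s, R⟩ =
      some ⟨(P.next q s.head? none).1, s.tail, pushAll (P.next q s.head? none).2 R⟩ := by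
  simp [step, h]

theorem step_reg {q : Q} {r : Reg} (h : P.src q = some r) (s : List A) (R : Reg → List B) :
    P.step ⟨some q, s, R⟩ = some ⟨(P.next q none (R r).head?).1, s,
        pushAll (P.next q none (R r).head?).2 (Function.update R r (R r).tail)⟩ := by
  simp [step, h]

abbrev StkΓ (A B : Type) : Option Reg → Type
  | none => A
  | some _ => B

abbrev TMΛ (A B Q : Type) : Type := Q ⊕ (Q × Option A × Option B)

def pushStmt {Λ σ : Type} : List (Reg × B) → TM2.Stmt (StkΓ A B) Λ σ → TM2.Stmt (StkΓ A B) Λ σ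
  | [], q => q
  | (r, x) :: l, q => .push (some r) (fun _ => x) (pushStmt l q)

/-- One program step takes two machine steps: pop into the local state, then act on it. The `load`
clears the local state, so that the machine halts in its initial state. -/
def tmProg : TMΛ A B Q → TM2.Stmt (StkΓ A B) (TMΛ A B Q) (Option A × Option B)
  | .inl q =>
    match P.src q with
    | none => .pop none (fun _ x => (x, none)) (.goto fun s => .inr (q, s))
    | some r => .pop (some r) (fun _ x => (none, x)) (.goto fun s => .inr (q, s))
  | .inr (q, x, y) => .load (fun _ => (none, none)) <| pushStmt (P.next q x y).2
    (match (P.next q x y).1 with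
      | none => .halt
      | some q' => .goto fun _ => .inl q')

/-- The Turing machine that runs a stack program. -/
def toTM [Fintype A] [Fintype B] [Fintype Q] : FinTM2 where
  K := Option Reg
  k₀ := none
  k₁ := some .o
  Γ := StkΓ A B
  Λ := TMΛ A B Q
  main := .inl P.start
  σ := Option A × Option B
  initialState := (none, none)
  Γk₀Fin := inferInstanceAs (Fintype A)
  m := P.tmProg

/-- The stacks of the Turing machine. -/
def stk (s : List A) (R : Reg → List B) : ∀ k, List (StkΓ A B k)
  | none => s
  | some r => R r

theorem update_stk_none (s t : List A) (R : Reg → List B) :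
    Function.update (stk s R) none t = stk t R := by
  funext k
  cases k <;> simp [stk]

theorem update_stk_some (s : List A) (R : Reg → List B) (r : Reg) (l : List B) :
    Function.update (stk s R) (some r) l = stk s (Function.update R r l) := by
  funext k
  rcases k with _ | k
  · simp [stk]
  · by_cases h : k = r
    · subst h; simp [stk]
    · simp [stk, h]

theorem stepAux_pushStmt {Λ σ : Type} (q : TM2.Stmt (StkΓ A B) Λ σ) (v : σ) (s : List A) :
    ∀ (l : List (Reg × B)) (R : Reg → List B),
      TM2.stepAux (pushStmt l q) v (stk s R) = TM2.stepAux q v (stk s (pushAll l R))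
  | [], R => rfl
  | (r, x) :: l, R => by
    simp only [pushStmt, TM2.stepAux, pushAll]
    rw [update_stk_some]
    exact stepAux_pushStmt q v s l _

variable [Fintype A] [Fintype B] [Fintype Q]

/-- The configuration of the Turing machine. -/
def tmCfg (c : PConf A B Q) : P.toTM.Cfg :=
  (⟨c.q.map .inl, (none, none), stk c.inp c.regs⟩ :
    TM2.Cfg (StkΓ A B) (TMΛ A B Q) (Option A × Option B))

theorem tm_act (q : Q) (x : Option A) (y : Option B) (v : Option A × Option B) (s : List A)
    (R : Reg → List B) :
    TM2.stepAux (P.tmProg (.inr (q, x, y))) v (stk s R) =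
      P.tmCfg ⟨(P.next q x y).1, s, pushAll (P.next q x y).2 R⟩ := by
  simp only [tmProg, TM2.stepAux]
  rw [stepAux_pushStmt]
  rcases h : (P.next q x y).1 with _ | q' <;> simp [tmCfg]

theorem tm_step {c c' : PConf A B Q} (h : P.step c = some c') :
    Runs P.toTM.step 2 (P.tmCfg c) (P.tmCfg c') := by
  obtain ⟨q, s, R⟩ := c
  rcases q with _ | q
  · cases h
  have key : ∀ (x : Option A) (y : Option B) (s' : List A) (R' : Reg → List B),
      TM2.stepAux (P.tmProg (.inl q)) (none, none) (stk s R) =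
        ⟨some (.inr (q, x, y)), (x, y), stk s' R'⟩ →
      c' = ⟨(P.next q x y).1, s', pushAll (P.next q x y).2 R'⟩ →
      Runs P.toTM.step 2 (P.tmCfg ⟨some q, s, R⟩) (P.tmCfg c') := by
    intro x y s' R' h₁ h₂
    refine Runs.head (b := (⟨some (.inr (q, x, y)), (x, y), stk s' R'⟩ :
      TM2.Cfg (StkΓ A B) (TMΛ A B Q) (Option A × Option B))) (congrArg some h₁) ?_
    refine Runs.single ?_
    rw [h₂]
    exact congrArg some (P.tm_act q x y (x, y) s' R')
  rcases hs : P.src q with _ | r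
  · rw [P.step_inp hs] at h
    refine key s.head? none s.tail R ?_ (Option.some.inj h).symm
    simp only [tmProg, hs, TM2.stepAux]
    rw [update_stk_none]
    rfl
  · rw [P.step_reg hs] at h
    refine key none (R r).head? s (Function.update R r (R r).tail) ?_ (Option.some.inj h).symm
    simp only [tmProg, hs, TM2.stepAux]
    rw [update_stk_some]
    rfl

/-- The stacks at the end of a computation. -/
def result (l : List B) : Reg → List B := Function.update (fun _ => []) .o l

theorem polyTime {α β : Type} {ea : α → List A} {eb : β → List B} {f : α → β}
    (t : Polynomial ℕ)
    (h : ∀ a, ∃ n ≤ t.eval (ea a).length,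
      Runs P.step n ⟨some P.start, ea a, fun _ => []⟩ ⟨none, [], result (eb (f a))⟩) :
    PolyTime ea eb f := by
  refine polyTime_iff.2 ⟨P.toTM, Equiv.refl _, Equiv.refl _, 2 * t, fun a => ?_⟩
  obtain ⟨n, hn, r⟩ := h a
  refine ⟨2 * n, by simpa using hn, ?_⟩
  have h' := Runs.simulate_mul P.tmCfg (fun a b => P.tm_step) r
  have e₁ : (Function.update (fun _ => []) P.toTM.k₀ ((ea a).map (Equiv.refl A).symm) :
      ∀ k, List (P.toTM.Γ k)) = stk (A := A) (B := B) (ea a) (fun _ => []) := by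
    funext k
    rcases k with _ | k <;> simp [toTM, stk]
  have e₂ : (Function.update (fun _ => []) P.toTM.k₁ ((eb (f a)).map (Equiv.refl B).symm) :
      ∀ k, List (P.toTM.Γ k)) = stk (A := A) (B := B) [] (result (eb (f a))) := by
    funext k
    rcases k with _ | k
    · simp [toTM, stk]
    · by_cases hk : k = .o
      · subst hk; simp [toTM, stk, result]
      · simp [toTM, stk, result, hk]
  exact Eq.trans (congrArg (fun S => (flip bind P.toTM.step)^[2 * n] (some
    (⟨some P.toTM.main, P.toTM.initialState, S⟩ : P.toTM.Cfg))) e₁) (Eq.trans h'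
    (congrArg (fun S => some (⟨none, P.toTM.initialState, S⟩ : P.toTM.Cfg)) e₂.symm))

end Prog

/-- The working stacks with the given contents. -/
def regs {B : Type} (a b c o : List B) : Reg → List B
  | .a => a
  | .b => b
  | .c => c
  | .o => o

section regs

variable {B : Type} (a b c o x : List B)

@[simp] theorem regs_a : regs a b c o .a = a := rfl
@[simp] theorem regs_b : regs a b c o .b = b := rfl
@[simp] theorem regs_c : regs a b c o .c = c := rfl
@[simp] theorem regs_o : regs a b c o .o = o := rfl

@[simp] theorem update_regs_a : Function.update (regs a b c o) .a x = regs x b c o := by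
  funext r; cases r <;> simp

@[simp] theorem update_regs_b : Function.update (regs a b c o) .b x = regs a x c o := by
  funext r; cases r <;> simp

@[simp] theorem update_regs_c : Function.update (regs a b c o) .c x = regs a b x o := by
  funext r; cases r <;> simp

@[simp] theorem update_regs_o : Function.update (regs a b c o) .o x = regs a b c x := by
  funext r; cases r <;> simp

theorem regs_nil : (fun _ => [] : Reg → List B) = regs [] [] [] [] := by
  funext r; cases r <;> rfl

theorem result_eq : Prog.result o = regs [] [] [] o := by
  unfold Prog.result
  rw [regs_nil, update_regs_o]

theorem pushAll_output (l : List B) :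
    pushAll (l.map fun x => (Reg.o, x)) (regs a b c o) = regs a b c (l.reverse ++ o) := by
  induction l generalizing o with
  | nil => rfl
  | cons y l ih => simp [pushAll, ih]

end regs

/-! ### Reversal -/

def revProg (A : Type) : Prog A A Unit where
  start := ()
  src _ := none
  next _ x _ := match x with
    | some x => (some (), [(.o, x)])
    | none => (none, [])

theorem revProg_runs {A : Type} : ∀ s o : List A,
    Runs (revProg A).step (s.length + 1) ⟨some (), s, regs [] [] [] o⟩
      ⟨none, [], regs [] [] [] (s.reverse ++ o)⟩
  | [], o => Runs.single (by rw [Prog.step_inp _ rfl]; rfl)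
  | x :: s, o => by
    refine Runs.head ?_ (by simpa using revProg_runs s (x :: o))
    rw [Prog.step_inp _ rfl]
    simp [revProg, pushAll]

theorem polyTime_reverse (A : Type) [Fintype A] :
    PolyTime (fun s => s : List A → List A) (fun s => s : List A → List A) List.reverse := by
  refine (revProg A).polyTime (Polynomial.X + 1) fun s => ⟨s.length + 1, by simp, ?_⟩
  rw [regs_nil, result_eq]
  simpa using revProg_runs s []

/-- A function is computable in polynomial time if a stack program outputs the reversed value. -/
theorem Prog.polyTime_of_reverse {A B Q : Type} [Fintype A] [Fintype B] [Fintype Q]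
    (P : Prog A B Q) {α : Type} {ea : α → List A} {f : α → List B} (t : Polynomial ℕ)
    (h : ∀ a, ∃ n ≤ t.eval (ea a).length,
      Runs P.step n ⟨some P.start, ea a, regs [] [] [] []⟩
        ⟨none, [], regs [] [] [] (f a).reverse⟩) :
    PolyTime ea (fun s => s) f := by
  have h₁ : PolyTime ea (fun s => s) fun a => (f a).reverse :=
    P.polyTime t fun a => by rw [regs_nil, result_eq]; exact h a
  have h₂ := (polyTime_reverse B).comp h₁
  simpa [Function.comp_def] using h₂

/-! ### Duplication of segments -/

/-- The role of a symbol in the duplication of segments. -/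
inductive SymClass
  | plain
  | sep
  | pass

/-- Output every segment of plain symbols that ends with a separator twice; `buf` is the beginning
of the current segment, in reverse order. Symbols of the third class are not repeated. -/
def dupSeg {A : Type} (cls : A → SymClass) : List A → List A → List A
  | _, [] => []
  | buf, x :: s =>
    match cls x with
    | .plain => x :: dupSeg cls (x :: buf) s
    | .sep => x :: (buf.reverse ++ x :: dupSeg cls [] s)
    | .pass => x :: dupSeg cls buf s

/-- `read` sends plain symbols to the output and to the buffer; `flip` and `copy` write the buffer
again, through a second stack to restore the order; `clear` empties the buffer at the end. -/
inductive DupState (A : Type)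
  | read
  | flip (x : A)
  | copy (x : A)
  | clear
  deriving Fintype

/-- The stack program for the duplication of segments. -/
def dupProg {A : Type} (cls : A → SymClass) : Prog A A (DupState A) where
  start := .read
  src
    | .read => none
    | .flip _ => some .b
    | .copy _ => some .c
    | .clear => some .b
  next
    | .read, some x, _ =>
      match cls x with
      | .plain => (some .read, [(.o, x), (.b, x)])
      | .sep => (some (.flip x), [(.o, x)])
      | .pass => (some .read, [(.o, x)])
    | .read, none, _ => (some .clear, [])
    | .flip x, _, some y => (some (.flip x), [(.c, y)])
    | .flip x, _, none => (some (.copy x), [])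
    | .copy x, _, some y => (some (.copy x), [(.o, y)])
    | .copy x, _, none => (some .read, [(.o, x)])
    | .clear, _, some _ => (some .clear, [])
    | .clear, _, none => (none, [])

section dup

variable {A : Type} (cls : A → SymClass)

theorem dupProg_clear (o : List A) : ∀ b : List A,
    Runs (dupProg cls).step (b.length + 1) ⟨some .clear, [], regs [] b [] o⟩
      ⟨none, [], regs [] [] [] o⟩
  | [] => Runs.single (by rw [Prog.step_reg _ (r := .b) rfl]; simp [dupProg, pushAll])
  | x :: b => by
    refine Runs.head ?_ (dupProg_clear o b)
    rw [Prog.step_reg _ (r := .b) rfl]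
    simp [dupProg, pushAll]

theorem dupProg_flip (x : A) (s o : List A) : ∀ b c : List A,
    Runs (dupProg cls).step (b.length + 1) ⟨some (.flip x), s, regs [] b c o⟩
      ⟨some (.copy x), s, regs [] [] (b.reverse ++ c) o⟩
  | [], c => Runs.single (by rw [Prog.step_reg _ (r := .b) rfl]; simp [dupProg, pushAll])
  | y :: b, c => by
    refine Runs.head ?_ (by simpa using dupProg_flip x s o b (y :: c))
    rw [Prog.step_reg _ (r := .b) rfl]
    simp [dupProg, pushAll]

theorem dupProg_copy (x : A) (s : List A) : ∀ c o : List A,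
    Runs (dupProg cls).step (c.length + 1) ⟨some (.copy x), s, regs [] [] c o⟩
      ⟨some .read, s, regs [] [] [] (x :: (c.reverse ++ o))⟩
  | [], o => Runs.single (by rw [Prog.step_reg _ (r := .c) rfl]; simp [dupProg, pushAll])
  | y :: c, o => by
    refine Runs.head ?_ (by simpa using dupProg_copy x s c (y :: o))
    rw [Prog.step_reg _ (r := .c) rfl]
    simp [dupProg, pushAll]

/-- The bound is a potential: every buffered symbol carries the two units that moving it to `c` and
then to the output costs. -/
theorem dupProg_runs : ∀ s b o : List A, ∃ n ≤ 4 * s.length + 2 * b.length + 2,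
    Runs (dupProg cls).step n ⟨some .read, s, regs [] b [] o⟩
      ⟨none, [], regs [] [] [] ((dupSeg cls b s).reverse ++ o)⟩
  | [], b, o => by
    refine ⟨b.length + 1 + 1, by omega, Runs.head ?_ (dupProg_clear cls o b)⟩
    rw [Prog.step_inp _ rfl]
    simp [dupProg, pushAll]
  | x :: s, b, o => by
    rcases h : cls x
    · obtain ⟨n, hn, r⟩ := dupProg_runs s (x :: b) (x :: o)
      refine ⟨n + 1, by simp at *; omega, Runs.head ?_ (by simpa [dupSeg, h] using r)⟩
      rw [Prog.step_inp _ rfl]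
      simp [dupProg, pushAll, h]
    · obtain ⟨n, hn, r⟩ := dupProg_runs s [] (x :: (b.reverse.reverse ++ x :: o))
      refine ⟨(b.length + 1) + ((b.reverse.length + 1) + n) + 1, by simp at *; omega,
        Runs.head ?_ ((by simpa using dupProg_flip cls x s (x :: o) b [] :
          Runs _ _ _ _).trans ((dupProg_copy cls x s b.reverse (x :: o)).trans
            (by simpa [dupSeg, h] using r)))⟩
      rw [Prog.step_inp _ rfl]
      simp [dupProg, pushAll, h]
    · obtain ⟨n, hn, r⟩ := dupProg_runs s b (x :: o)
      refine ⟨n + 1, by simp at *; omega, Runs.head ?_ (by simpa [dupSeg, h] using r)⟩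
      rw [Prog.step_inp _ rfl]
      simp [dupProg, pushAll, h]

theorem polyTime_dupSeg [Fintype A] :
    PolyTime (fun s => s : List A → List A) (fun s => s) (dupSeg cls []) := by
  refine (dupProg cls).polyTime_of_reverse (4 * Polynomial.X + 2) fun s => ?_
  obtain ⟨n, hn, r⟩ := dupProg_runs cls s [] []
  exact ⟨n, by simpa using hn, by simpa [dupProg] using r⟩

end dup

/-! ### Finite-state transducers -/

/-- The output of a transducer, which reads `x` in the state `q`, outputs `(δ q x).2` and changes
to the state `(δ q x).1`. -/
def transduce {A B Q : Type} (δ : Q → A → Q × List B) : Q → List A → List B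
  | _, [] => []
  | q, x :: s => (δ q x).2 ++ transduce δ (δ q x).1 s

def transProg {A B Q : Type} (δ : Q → A → Q × List B) (q₀ : Q) : Prog A B Q where
  start := q₀
  src _ := none
  next q x _ := match x with
    | some x => (some (δ q x).1, (δ q x).2.map fun y => (.o, y))
    | none => (none, [])

theorem transProg_runs {A B Q : Type} (δ : Q → A → Q × List B) (q₀ : Q) :
    ∀ (s : List A) (q : Q) (o : List B),
    Runs (transProg δ q₀).step (s.length + 1) ⟨some q, s, regs [] [] [] o⟩
      ⟨none, [], regs [] [] [] ((transduce δ q s).reverse ++ o)⟩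
  | [], q, o => Runs.single (by rw [Prog.step_inp _ rfl]; rfl)
  | x :: s, q, o => by
    have h := transProg_runs δ q₀ s (δ q x).1 ((δ q x).2.reverse ++ o)
    refine Runs.head ?_ (by simpa [transduce] using h)
    rw [Prog.step_inp _ rfl]
    simp [transProg, pushAll_output]

theorem polyTime_transduce {A B Q : Type} [Fintype A] [Fintype B] [Fintype Q]
    (δ : Q → A → Q × List B) (q₀ : Q) :
    PolyTime (fun s => s : List A → List A) (fun s => s) (transduce δ q₀) := by
  refine (transProg δ q₀).polyTime_of_reverse (Polynomial.X + 1) fun s => ⟨s.length + 1, by simp, ?_⟩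
  simpa [transProg] using transProg_runs δ q₀ s q₀ []

end FisherPCP

namespace FisherPCP

/-! ### Approximate equilibria of markets with one buyer for each good

Buyer `k` has the utility function `z k` for good `k`, and `10 ^ 8 * min (z j) (cap k j)` for every
other good `j`. -/

/-- The utility of the bundle `z` for buyer `k`. -/
noncomputable def goodUtil {K : Type*} [Fintype K] (cap : K → K → ℝ) (k : K) (z : K → ℝ) : ℝ :=
  z k + 10 ^ 8 * ∑ j, min (z j) (cap k j)

/-- The prices `p` and the bundles `x k` are an approximate equilibrium. -/
structure Eqm {K : Type*} [Fintype K] (cap : K → K → ℝ) (p : K → ℝ) (x : K → K → ℝ) (δ : ℝ) :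
    Prop where
  delta_nonneg : 0 ≤ δ
  delta_le : δ ≤ 1 / 10 ^ 24
  cap_nonneg : ∀ k j, 0 ≤ cap k j
  cap_self : ∀ k, cap k k = 0
  row : ∀ k, ∑ j, cap k j ≤ 2
  -- 443/500 = 0.371 + 0.515 lies just below 8/9, the least amount of a good that is sold.
  col : ∀ j, ∑ k, cap k j ≤ 443 / 500
  p_nonneg : ∀ j, 0 ≤ p j
  x_nonneg : ∀ k j, 0 ≤ x k j
  budget : ∀ k, ∑ j, p j * x k j ≤ 1
  opt : ∀ k z, (∀ j, 0 ≤ z j) → ∑ j, p j * z j ≤ 1 →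
    (1 - δ) * goodUtil cap k z ≤ goodUtil cap k (x k)
  clear_lo : ∀ j, 8 / 9 ≤ ∑ k, x k j
  clear_hi : ∀ j, ∑ k, x k j ≤ 10 / 9

/-- The part of an allocation that is useful to the buyers. -/
noncomputable def legit {K : Type*} [DecidableEq K] (cap x : K → K → ℝ) (k j : K) : ℝ :=
  if j = k then x k k else min (x k j) (cap k j)

/-- The amount of good `j` that is allocated to buyers to whom it is useless. -/
noncomputable def waste {K : Type*} [Fintype K] [DecidableEq K] (cap x : K → K → ℝ) (j : K) : ℝ :=
  ∑ k, (x k j - legit cap x k j)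

/-! ### Prices, waste and spending in approximate equilibria. -/

namespace Eqm

variable {K : Type*} [Fintype K] [DecidableEq K] {cap : K → K → ℝ} {p : K → ℝ} {x : K → K → ℝ}
  {δ : ℝ} (E : Eqm cap p x δ)

include E

omit [DecidableEq K] in
theorem x_le (k j : K) : x k j ≤ 10 / 9 :=
  (Finset.single_le_sum (f := fun k => x k j) (fun k _ => E.x_nonneg k j)
    (Finset.mem_univ k)).trans (E.clear_hi j)

omit [DecidableEq K] in
theorem util_le (k : K) : goodUtil cap k (x k) ≤ 3 * 10 ^ 8 := by
  have h₁ : ∑ j, min (x k j) (cap k j) ≤ 2 :=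
    (Finset.sum_le_sum fun j _ => min_le_right _ _).trans (E.row k)
  have h₂ := E.x_le k k
  unfold goodUtil
  linarith

omit [DecidableEq K] in
-- Turns the multiplicative error into an additive one: by `util_le` and `δ ≤ 1/2`, no affordable
-- bundle has utility above `6 * 10 ^ 8`.
theorem opt_add (k : K) {z : K → ℝ} (hz : ∀ j, 0 ≤ z j) (hb : ∑ j, p j * z j ≤ 1) :
    goodUtil cap k z ≤ goodUtil cap k (x k) + 6 * 10 ^ 8 * δ := by
  have h₁ := E.opt k z hz hb
  have h₂ := E.util_le k
  have h₃ := E.delta_nonneg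
  have h₄ : δ ≤ 1 / 2 := E.delta_le.trans (by norm_num)
  have h₅ : goodUtil cap k z ≤ 6 * 10 ^ 8 := by
    by_contra h
    push Not at h
    nlinarith
  nlinarith

/-- At a price of at most `10 ^ (-9)`, buyer `k` could afford `10 ^ 9` units of good `k`, far more
utility than `util_le` allows. -/
theorem lt_price (k : K) : 1 / 10 ^ 9 < p k := by
  by_contra h
  push Not at h
  have h₁ := E.opt_add k (z := fun j => if j = k then 10 ^ 9 else 0)
    (fun j => by positivity) (by simp; linarith)
  have h₂ := E.util_le k
  have h₃ := E.delta_le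
  have h₄ : goodUtil cap k (fun j => if j = k then 10 ^ 9 else 0) = 10 ^ 9 := by
    unfold goodUtil
    rw [Finset.sum_eq_zero]
    · simp
    · intro j _
      by_cases h : j = k
      · subst h; simp [E.cap_self]
      · simp [h, E.cap_nonneg]
  rw [h₄] at h₁
  norm_num at *
  linarith

theorem price_pos (k : K) : 0 < p k := lt_trans (by norm_num) (E.lt_price k)

theorem legit_nonneg (k j : K) : 0 ≤ legit cap x k j := by
  unfold legit
  split_ifs
  · exact E.x_nonneg _ _
  · exact le_min (E.x_nonneg _ _) (E.cap_nonneg _ _)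

omit E [Fintype K] in
theorem legit_le (k j : K) : legit cap x k j ≤ x k j := by
  unfold legit
  split_ifs with h
  · rw [h]
  · exact min_le_left _ _

omit E in
theorem waste_nonneg (j : K) : 0 ≤ waste cap x j :=
  Finset.sum_nonneg fun k _ => sub_nonneg.2 (legit_le k j)

/-- A buyer spends almost all the money on useful amounts. -/
theorem spend (k : K) : 1 - 6 * 10 ^ 8 * δ * p k ≤ ∑ j, p j * legit cap x k j := by
  set w := 1 - ∑ j, p j * legit cap x k j with hw
  have hp := E.price_pos k
  have hw₀ : 0 ≤ w := by
    have : ∑ j, p j * legit cap x k j ≤ ∑ j, p j * x k j :=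
      Finset.sum_le_sum fun j _ => mul_le_mul_of_nonneg_left (legit_le k j) (E.p_nonneg j)
    have := E.budget k
    linarith
  -- Drop the useless amounts and spend the money `w` thus freed, or left over, on good `k`: the
  -- utility grows by `w / p k`.
  have h₁ := E.opt_add k (z := fun j => legit cap x k j + if j = k then w / p k else 0)
    (fun j => by have := E.legit_nonneg k j; split_ifs <;> positivity) (by
      simp only [mul_add, Finset.sum_add_distrib, mul_ite, mul_zero, Finset.sum_ite_eq',
        Finset.mem_univ, if_true]
      rw [mul_div_cancel₀ _ hp.ne']
      linarith)
  have h₂ : goodUtil cap k (fun j => legit cap x k j + if j = k then w / p k else 0) =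
      goodUtil cap k (x k) + w / p k := by
    have h : ∀ j, min (legit cap x k j + if j = k then w / p k else 0) (cap k j) =
        min (x k j) (cap k j) := by
      intro j
      by_cases h : j = k
      · subst h
        have := E.x_nonneg j j
        have : 0 ≤ w / p j := by positivity
        simp only [legit, E.cap_self, if_true]
        rw [min_eq_right (by positivity), min_eq_right (by positivity)]
      · simp [legit, h]
    unfold goodUtil
    simp only [h]
    simp [legit]
    ring
  rw [h₂] at h₁
  have h₃ : w / p k ≤ 6 * 10 ^ 8 * δ := by linarith
  rw [div_le_iff₀ hp] at h₃
  linarith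

omit [DecidableEq K] in
-- The total budget is the number of buyers, and it pays for at least 8/9 of every good.
theorem sum_price_le : ∑ j, p j ≤ 9 / 8 * Fintype.card K := by
  have h₁ : ∑ j, p j * (8 / 9) ≤ ∑ j, p j * ∑ k, x k j :=
    Finset.sum_le_sum fun j _ => mul_le_mul_of_nonneg_left (E.clear_lo j) (E.p_nonneg j)
  have h₂ : ∑ j, p j * ∑ k, x k j ≤ Fintype.card K := by
    simp only [Finset.mul_sum]
    rw [Finset.sum_comm]
    exact (Finset.sum_le_sum fun k _ => E.budget k).trans (by simp)
  rw [← Finset.sum_mul] at h₁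
  linarith

/-- Wasted units cost more than `10 ^ (-9)` each, and by `spend` buyer `k` has at most `6 * 10 ^ 8 *
δ * p k` for them. With `sum_price_le` the constant is 6.75 · 10^17. -/
theorem sum_waste_le : ∑ j, waste cap x j ≤ 10 ^ 18 * δ * Fintype.card K := by
  have h₁ : ∑ j, 1 / 10 ^ 9 * waste cap x j ≤ ∑ j, p j * waste cap x j :=
    Finset.sum_le_sum fun j _ => mul_le_mul_of_nonneg_right (E.lt_price j).le (waste_nonneg j)
  have h₂ : ∑ j, p j * waste cap x j ≤ ∑ k, 6 * 10 ^ 8 * δ * p k := by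
    simp only [waste, Finset.mul_sum]
    rw [Finset.sum_comm]
    refine Finset.sum_le_sum fun k _ => ?_
    simp only [mul_sub, Finset.sum_sub_distrib]
    have := E.spend k
    have := E.budget k
    linarith
  rw [← Finset.mul_sum] at h₁ h₂
  have h₃ := mul_le_mul_of_nonneg_left E.sum_price_le
    (mul_nonneg (by norm_num : (0 : ℝ) ≤ 6 * 10 ^ 8) E.delta_nonneg)
  have h₄ : 0 ≤ δ * Fintype.card K := mul_nonneg E.delta_nonneg (Nat.cast_nonneg _)
  nlinarith

/-- At least 8/9 of good `k` is sold, and the other buyers can use at most 443/500 of it; all else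
is waste or goes to buyer `k`. -/
theorem supply_le (k : K) : 8 / 9 - 443 / 500 - waste cap x k ≤ x k k := by
  have h₁ : ∑ i, legit cap x i k ≤ ∑ i, ((if k = i then x k k else 0) + cap i k) :=
    Finset.sum_le_sum fun i _ => by
      unfold legit
      split_ifs with h
      · subst h; linarith [E.cap_nonneg k k]
      · linarith [min_le_right (x i k) (cap i k)]
  rw [Finset.sum_add_distrib, Finset.sum_ite_eq] at h₁
  have h₂ := E.col k
  have h₃ := E.clear_lo k
  have h₄ : waste cap x k = ∑ i, x i k - ∑ i, legit cap x i k := by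
    simp [waste]
  simp at h₁
  linarith

omit [DecidableEq K] in
theorem spend_le (k j : K) : p j * x k j ≤ 1 :=
  (Finset.single_le_sum (f := fun j => p j * x k j)
    (fun j _ => mul_nonneg (E.p_nonneg j) (E.x_nonneg k j)) (Finset.mem_univ j)).trans (E.budget k)

/-- Buyer `k` holds more than 1/500 of good `k`, by `supply_le`, and pays at most 1 for it. -/
theorem price_le {k : K} (hk : waste cap x k ≤ 1 / 10 ^ 5) : p k ≤ 500 := by
  have h₁ := E.supply_le k
  have h₂ := E.spend_le k k
  have h₃ := E.p_nonneg k
  norm_num at *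
  nlinarith

/-- A buyer whose own good is not very cheap buys almost all the useful amount of other goods. -/
theorem demand {k j : K} (hk : waste cap x k ≤ 1 / 10 ^ 5) (hj : waste cap x j ≤ 1 / 10 ^ 5)
    (ht : 1 / 2 ^ 17 ≤ p k) : cap k j - 1 / 10 ^ 5 ≤ x k j := by
  by_contra hlt
  push Not at hlt
  have hkj : k ≠ j := by
    rintro rfl
    have := E.cap_self k
    have := E.x_nonneg k k
    norm_num at *
    linarith
  have hpk := E.price_pos k
  have hpj := E.lt_price j
  have hpj₀ := E.price_pos j
  have hpj₁ := E.price_le hj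
  have hxk := E.supply_le k
  have hxkk := E.x_nonneg k k
  -- Move money `μ` from good `k` to good `j`, within what is spent on `k` and without reaching the
  -- cap on `j`. Per unit of money `k` yields at most 2^17 = 131072 and `j` at least 10^8/500 =
  -- 200000. As `μ ≥ 10 ^ (-14)`, the gain exceeds the error `6 * 10 ^ 8 * δ`.
  set μ := min (p k * x k k) (1 / 10 ^ 5 * p j) with hμ
  have hμ₀ : 0 ≤ μ := le_min (by positivity) (by positivity)
  have hμ₁ : μ / p k ≤ x k k := by
    rw [div_le_iff₀ hpk, mul_comm]; exact min_le_left _ _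
  have hμ₂ : μ / p j ≤ 1 / 10 ^ 5 := by
    rw [div_le_iff₀ hpj₀]; exact min_le_right _ _
  have hμ₃ : 1 / 10 ^ 14 ≤ μ := by
    refine le_min ?_ ?_
    · norm_num at *
      nlinarith
    · norm_num at *
      linarith
  have hμ₄ : 0 ≤ μ / p j := by positivity
  have h₁ := E.opt_add k (z := fun i => x k i + (if i = k then -(μ / p k) else 0) +
      if i = j then μ / p j else 0) (fun i => by
      have := E.x_nonneg k i
      by_cases h : i = k
      · subst h; simp [hkj]; linarith
      · simp only [h, if_false]; split_ifs <;> positivity) (by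
      simp only [mul_add, Finset.sum_add_distrib, mul_ite, mul_zero, Finset.sum_ite_eq',
        Finset.mem_univ, if_true, mul_neg]
      rw [mul_div_cancel₀ _ hpk.ne', mul_div_cancel₀ _ hpj₀.ne']
      linarith [E.budget k])
  have h₂ : goodUtil cap k (fun i => x k i + (if i = k then -(μ / p k) else 0) +
      if i = j then μ / p j else 0) = goodUtil cap k (x k) - μ / p k + 10 ^ 8 * (μ / p j) := by
    have h : ∀ i, min (x k i + (if i = k then -(μ / p k) else 0) +
      if i = j then μ / p j else 0) (cap k i) =
        min (x k i) (cap k i) + if i = j then μ / p j else 0 := by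
      intro i
      by_cases h : i = k
      · subst h
        simp only [E.cap_self, if_true, hkj, if_false, add_zero]
        rw [min_eq_right (by linarith), min_eq_right (by linarith)]
      · by_cases h' : i = j
        · subst h'
          simp only [h, if_false, if_true, add_zero]
          rw [min_eq_left (by linarith), min_eq_left (by linarith)]
        · simp [h, h']
    unfold goodUtil
    simp only [h, Finset.sum_add_distrib]
    simp [hkj]
    ring
  rw [h₂] at h₁
  have h₃ : μ / p k ≤ 2 ^ 17 * μ := by
    rw [div_le_iff₀ hpk]
    norm_num at *
    nlinarith
  have h₄ : μ ≤ 500 * (μ / p j) := by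
    rw [mul_div_assoc', le_div_iff₀ hpj₀]
    nlinarith
  have h₅ := E.delta_le
  norm_num at *
  linarith

/-- The money that buyer `k` spends on good `k`. -/
theorem alive {k : K} (hk : waste cap x k ≤ 1 / 10 ^ 5) :
    1 - 1 / 10 ^ 6 - ∑ j, p j * cap k j ≤ p k * x k k := by
  have h₁ := E.spend k
  have h₂ : ∑ j, p j * legit cap x k j ≤ ∑ j, ((if j = k then p k * x k k else 0) +
      p j * cap k j) := Finset.sum_le_sum fun j _ => by
    unfold legit
    split_ifs with h
    · subst h; linarith [mul_nonneg (E.p_nonneg j) (E.cap_nonneg j j)]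
    · linarith [mul_le_mul_of_nonneg_left (min_le_right (x k j) (cap k j)) (E.p_nonneg j)]
  rw [Finset.sum_add_distrib, Finset.sum_ite_eq'] at h₂
  simp only [Finset.mem_univ, if_true] at h₂
  have h₃ := E.price_le hk
  have h₄ := E.delta_le
  have h₅ := E.delta_nonneg
  have h₆ : δ * p k ≤ 1 / 10 ^ 24 * 500 := mul_le_mul h₄ h₃ (E.p_nonneg k) (by norm_num)
  norm_num at *
  linarith

theorem money_two {j k : K} (h : k ≠ j) :
    p j * x j j + p j * x k j ≤ 10 / 9 * p j := by
  have h₁ : ∑ i ∈ {j, k}, x i j ≤ ∑ i, x i j :=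
    Finset.sum_le_sum_of_subset_of_nonneg (Finset.subset_univ _) fun i _ _ => E.x_nonneg i j
  rw [Finset.sum_pair h.symm] at h₁
  nlinarith [E.clear_hi j, E.p_nonneg j]

theorem money_three {j k l : K} (h₁ : k ≠ j) (h₂ : l ≠ j) (h₃ : k ≠ l) :
    p j * x j j + p j * x k j + p j * x l j ≤ 10 / 9 * p j := by
  have h : ∑ i ∈ {j, k, l}, x i j ≤ ∑ i, x i j :=
    Finset.sum_le_sum_of_subset_of_nonneg (Finset.subset_univ _) fun i _ _ => E.x_nonneg i j
  rw [Finset.sum_insert (by simp [h₁.symm, h₂.symm]), Finset.sum_pair h₃] at h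
  nlinarith [E.clear_hi j, E.p_nonneg j]

/-- Otherwise `demand` gives buyer `k` almost 0.88 of good `j`. Then `p j` is below 1.137, less than
0.232 units are left for buyer `j`, and buyer `j` spends less than 0.263 on them. -/
theorem kill {j k : K} (hjk : k ≠ j) (hj : waste cap x j ≤ 1 / 10 ^ 5)
    (hk : waste cap x k ≤ 1 / 10 ^ 5) (hc : cap k j = 22 / 25) (hM : 279 / 1000 ≤ p j * x j j) :
    p k < 1 / 2 ^ 17 := by
  by_contra h
  push Not at h
  have h₁ := E.demand hk hj h
  rw [hc] at h₁
  have h₂ := mul_le_mul_of_nonneg_left h₁ (E.p_nonneg j)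
  have h₃ := E.money_two hjk
  have h₄ := E.spend_le k j
  norm_num at *
  linarith

end Eqm

/-! ### Gates of Pure-Circuit in approximate equilibria -/

/-- The value of a node with the goods `r` and `i`, where `T` recognises cheap goods. -/
def nodeVal {K : Type*} (T : K → Bool) (r i : K) : Val :=
  bif T r then .zero else bif T i then .one else .bot

/-- `T` recognises cheap goods. -/
structure CheapTest {K : Type*} (p : K → ℝ) (T : K → Bool) : Prop where
  -- Prices between the two bounds may be classified either way, which is what a comparison of
  -- binary lengths can achieve.
  of_lt : ∀ j, p j < 1 / 2 ^ 17 → T j = true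
  le_of : ∀ j, T j = true → p j ≤ 1 / 2 ^ 15

/-- The buyer of `k` consumes the good `j` only, up to the amount `c`. -/
structure Consumes {K : Type*} [Fintype K] (cap : K → K → ℝ) (p : K → ℝ) (k j : K) (c : ℝ) :
    Prop where
  ne : k ≠ j
  cap_eq : cap k j = c
  sum_eq : ∑ i, p i * cap k i = c * p j

/-- The goods `d`, `r`, `i` form a chain that ends in the node with the goods `r` and `i`. -/
structure Chain {K : Type*} [Fintype K] (cap x : K → K → ℝ) (p : K → ℝ) [DecidableEq K]
    (d r i : K) : Prop where
  waste_d : waste cap x d ≤ 1 / 10 ^ 5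
  waste_r : waste cap x r ≤ 1 / 10 ^ 5
  waste_i : waste cap x i ≤ 1 / 10 ^ 5
  d_r : Consumes cap p r d (22 / 25)
  r_i : Consumes cap p i r (22 / 25)

section

variable {K : Type*} [Fintype K] [DecidableEq K] {cap : K → K → ℝ} {p : K → ℝ} {x : K → K → ℝ}
  {δ : ℝ} {T : K → Bool}

/-- The first inverter of the chain: spending on `d` makes `r` cheap. -/
theorem Chain.zero_of_money {d r i : K} (h : Chain cap x p d r i) (E : Eqm cap p x δ)
    (hT : CheapTest p T) (hM : 279 / 1000 ≤ p d * x d d) : nodeVal T r i = .zero := by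
  have := hT.of_lt r (E.kill h.d_r.ne h.waste_d h.waste_r h.d_r.cap_eq hM)
  simp [nodeVal, this]

/-- With `d` cheap, buyer `r` spends nearly all its money on `r`. So `r` is not cheap, which must be
excluded because `nodeVal` tests `r` first, and `kill` makes `i` cheap. -/
theorem Chain.one_of_lt {d r i : K} (h : Chain cap x p d r i) (E : Eqm cap p x δ)
    (hT : CheapTest p T) (hd : p d < 1 / 2 ^ 17) : nodeVal T r i = .one := by
  have h₁ := E.alive h.waste_r
  rw [h.d_r.sum_eq] at h₁
  have h₂ : 999 / 1000 ≤ p r * x r r := by norm_num at *; linarith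
  have h₃ := hT.of_lt i (E.kill h.r_i.ne h.waste_r h.waste_i h.r_i.cap_eq (by linarith))
  have h₄ : T r = false := by
    by_contra hr
    have h₅ := hT.le_of r (by simpa using hr)
    have h₆ := E.x_le r r
    have h₇ := E.p_nonneg r
    have h₈ := mul_le_mul_of_nonneg_left h₆ h₇
    norm_num at *
    linarith
  simp [nodeVal, h₃, h₄]

omit [Fintype K] [DecidableEq K] in
theorem Chain.cheap_of_one {r i : K} (hT : CheapTest p T) (hv : nodeVal T r i = .one) :
    p i ≤ 1 / 2 ^ 15 := by
  refine hT.le_of i ?_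
  unfold nodeVal at hv
  cases h₁ : T r <;> cases h₂ : T i <;> simp_all

/-- A cheap `r` costs buyer `i` almost nothing, so its money goes to `i`; this is the signal that
the gate reading the node receives. -/
theorem Chain.money_of_zero {d r i : K} (h : Chain cap x p d r i) (E : Eqm cap p x δ)
    (hT : CheapTest p T) (hv : nodeVal T r i = .zero) : 9999 / 10000 ≤ p i * x i i := by
  have h₁ : p r ≤ 1 / 2 ^ 15 := by
    refine hT.le_of r ?_
    unfold nodeVal at hv
    cases h₁ : T r <;> cases h₂ : T i <;> simp_all
  have h₂ := E.alive h.waste_i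
  rw [h.r_i.sum_eq] at h₂
  norm_num at *
  linarith

/-- A NAND gate is satisfied. -/
theorem nand_sat {d₁ r₁ i₁ d₂ r₂ i₂ d r i : K} (E : Eqm cap p x δ) (hT : CheapTest p T)
    (h₁ : Chain cap x p d₁ r₁ i₁) (h₂ : Chain cap x p d₂ r₂ i₂) (h : Chain cap x p d r i)
    (n₁ : d ≠ i₁) (n₂ : d ≠ i₂) (c₁ : cap d i₁ = 22 / 25) (c₂ : cap d i₂ = 22 / 25)
    (hs : ∑ j, p j * cap d j = 22 / 25 * p i₁ + 22 / 25 * p i₂) :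
    (nodeVal T r₁ i₁ = .one ∧ nodeVal T r₂ i₂ = .one → nodeVal T r i = .zero) ∧
      (nodeVal T r₁ i₁ = .zero ∨ nodeVal T r₂ i₂ = .zero → nodeVal T r i = .one) := by
  constructor
  -- Both input goods are cheap, so buyer `d` keeps its money for `d`.
  · rintro ⟨v₁, v₂⟩
    have a₁ := Chain.cheap_of_one hT v₁
    have a₂ := Chain.cheap_of_one hT v₂
    have a := E.alive h.waste_d
    rw [hs] at a
    refine h.zero_of_money E hT ?_
    norm_num at *
    linarith
  -- A single input good on which its own buyer spends its money suffices to make `d` cheap.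
  · rintro (v | v)
    · have a := h₁.money_of_zero E hT v
      exact h.one_of_lt E hT (E.kill n₁ h₁.waste_i h.waste_d c₁ (by linarith))
    · have a := h₂.money_of_zero E hT v
      exact h.one_of_lt E hT (E.kill n₂ h₂.waste_i h.waste_d c₂ (by linarith))

/-- Even 10/9 units of such a cheap good `k` cost less than `10 ^ (-5)`, and good `j` is the only
other useful purchase that costs money. -/
theorem Consumes.money_of_lt {k j : K} {c : ℝ} (h : Consumes cap p k j c) (E : Eqm cap p x δ)
    (hk : waste cap x k ≤ 1 / 10 ^ 5) (ht : p k < 1 / 2 ^ 17) :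
    1 - 2 / 10 ^ 5 ≤ p j * x k j := by
  have h₁ := E.spend k
  have h₂ : ∑ i, p i * legit cap x k i ≤ p k * x k k + p j * x k j := by
    have h₃ : ∀ i, p i * legit cap x k i ≤ (if i = k then p k * x k k else 0) +
        if i = j then p j * x k j else 0 := by
      intro i
      unfold legit
      by_cases hi : i = k
      · subst hi; simp [h.ne]
      · by_cases hi' : i = j
        · subst hi'
          simpa [hi] using mul_le_mul_of_nonneg_left (min_le_left (x k i) (cap k i)) (E.p_nonneg i)
        -- The term for `j` alone already exhausts the sum in `sum_eq`.
        · have h₄ : p i * cap k i = 0 := by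
            have h₅ : ∑ l ∈ {j, i}, p l * cap k l ≤ ∑ l, p l * cap k l :=
              Finset.sum_le_sum_of_subset_of_nonneg (Finset.subset_univ _)
                fun l _ _ => mul_nonneg (E.p_nonneg l) (E.cap_nonneg k l)
            rw [Finset.sum_pair (Ne.symm hi'), h.sum_eq, h.cap_eq, mul_comm c] at h₅
            exact le_antisymm (by linarith) (mul_nonneg (E.p_nonneg i) (E.cap_nonneg k i))
          simp only [hi, hi', if_false, add_zero]
          rw [← h₄]
          exact mul_le_mul_of_nonneg_left (min_le_right _ _) (E.p_nonneg i)
    refine (Finset.sum_le_sum fun i _ => h₃ i).trans ?_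
    rw [Finset.sum_add_distrib]
    simp
  have h₃ := E.price_le hk
  have h₄ := E.delta_le
  have h₅ := E.delta_nonneg
  have h₆ : δ * p k ≤ 1 / 10 ^ 24 * 500 := mul_le_mul h₄ h₃ (E.p_nonneg k) (by norm_num)
  have h₇ := mul_le_mul_of_nonneg_left (E.x_le k k) (E.p_nonneg k)
  norm_num at *
  linarith

/-- A PURIFY gate is satisfied. -/
theorem purify_sat {d₁ r₁ i₁ y₂ d₂ r₂ i₂ y₃ d₃ r₃ i₃ : K} (E : Eqm cap p x δ)
    (hT : CheapTest p T) (h₁ : Chain cap x p d₁ r₁ i₁) (h₂ : Chain cap x p d₂ r₂ i₂)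
    (h₃ : Chain cap x p d₃ r₃ i₃) (w₂ : waste cap x y₂ ≤ 1 / 10 ^ 5)
    (w₃ : waste cap x y₃ ≤ 1 / 10 ^ 5) (hy : y₂ ≠ y₃) (c₂ : Consumes cap p y₂ i₁ (371 / 1000))
    (c₃ : Consumes cap p y₃ i₁ (515 / 1000)) (e₂ : Consumes cap p d₂ y₂ (22 / 25))
    (e₃ : Consumes cap p d₃ y₃ (22 / 25)) :
    (nodeVal T r₂ i₂ ≠ .bot ∨ nodeVal T r₃ i₃ ≠ .bot) ∧
      (nodeVal T r₁ i₁ ≠ .bot →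
        nodeVal T r₂ i₂ = nodeVal T r₁ i₁ ∧ nodeVal T r₃ i₃ = nodeVal T r₁ i₁) := by
  have a₂ := E.alive w₂
  rw [c₂.sum_eq] at a₂
  have a₃ := E.alive w₃
  rw [c₃.sum_eq] at a₃
  -- Buyers `d₂` and `d₃` pass the signal on: spending on `y` by its own buyer leads to output 1, a
  -- cheap `y` to output 0.
  have one₂ : 279 / 1000 ≤ p y₂ * x y₂ y₂ → nodeVal T r₂ i₂ = .one := fun h =>
    h₂.one_of_lt E hT (E.kill e₂.ne w₂ h₂.waste_d e₂.cap_eq h)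
  have one₃ : 279 / 1000 ≤ p y₃ * x y₃ y₃ → nodeVal T r₃ i₃ = .one := fun h =>
    h₃.one_of_lt E hT (E.kill e₃.ne w₃ h₃.waste_d e₃.cap_eq h)
  have zero₂ : p y₂ < 1 / 2 ^ 17 → nodeVal T r₂ i₂ = .zero := fun h => by
    have a := E.alive h₂.waste_d
    rw [e₂.sum_eq] at a
    exact h₂.zero_of_money E hT (by norm_num at *; linarith)
  have zero₃ : p y₃ < 1 / 2 ^ 17 → nodeVal T r₃ i₃ = .zero := fun h => by
    have a := E.alive h₃.waste_d
    rw [e₃.sum_eq] at a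
    exact h₃.zero_of_money E hT (by norm_num at *; linarith)
  have q₂ : 1 / 2 ^ 17 ≤ p y₂ → (371 / 1000 - 1 / 10 ^ 5) * p i₁ ≤ p i₁ * x y₂ i₁ := fun h => by
    have := E.demand w₂ h₁.waste_i h
    rw [c₂.cap_eq] at this
    have := mul_le_mul_of_nonneg_left this (E.p_nonneg i₁)
    linarith
  have q₃ : 1 / 2 ^ 17 ≤ p y₃ → (515 / 1000 - 1 / 10 ^ 5) * p i₁ ≤ p i₁ * x y₃ i₁ := fun h => by
    have := E.demand w₃ h₁.waste_i h
    rw [c₃.cap_eq] at this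
    have := mul_le_mul_of_nonneg_left this (E.p_nonneg i₁)
    linarith
  have s₂ := E.spend_le y₂ i₁
  have s₃ := E.spend_le y₃ i₁
  have hm := E.money_three c₂.ne c₃.ne hy
  constructor
  -- If `y₃` is not cheap, its buyer takes almost 0.515 of `i₁`, so `p i₁ ≤ 1 / 0.51499`. Then buyer
  -- `y₂` pays at most 0.371 / 0.51499 < 0.721 for `i₁` and keeps 0.279 for `y₂`; the threshold in
  -- `kill` is chosen for this.
  · rcases lt_or_ge (p y₃) (1 / 2 ^ 17) with h | h
    · right; rw [zero₃ h]; simp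
    · left
      rw [one₂]
      · simp
      · have := q₃ h
        norm_num at *
        linarith
  · intro hv
    rcases hv' : nodeVal T r₁ i₁
    · have hz := h₁.money_of_zero E hT hv'
      -- Otherwise `p i₁ < 1.95`. But buyer `i₁` spends almost 1 on `i₁`, and buyer `y₂` either
      -- takes almost 0.371 of it or, if `y₂` is cheap, spends almost 1 on it. Since only 10/9 are
      -- sold, `p i₁` would exceed 4 or 3.
      have t₃ : p y₃ < 1 / 2 ^ 17 := by
        by_contra h
        push Not at h
        have b₃ := q₃ h
        rcases lt_or_ge (p y₂) (1 / 2 ^ 17) with h' | h'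
        · have := c₂.money_of_lt E w₂ h'
          norm_num at *
          linarith
        · have := q₂ h'
          norm_num at *
          linarith
      -- Now buyers `i₁` and `y₃` both spend almost 1 on `i₁`. Were almost 0.371 of it sold to buyer
      -- `y₂`, then `p i₁ > 2.702`, but buyer `y₂` can only afford `p i₁ < 2.696`. This is the
      -- tightest estimate.
      have t₂ : p y₂ < 1 / 2 ^ 17 := by
        by_contra h
        push Not at h
        have b₂ := q₂ h
        have := c₃.money_of_lt E w₃ t₃
        norm_num at *
        linarith
      exact ⟨zero₂ t₂, zero₃ t₃⟩
    · have := Chain.cheap_of_one hT hv'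
      exact ⟨one₂ (by norm_num at *; linarith), one₃ (by norm_num at *; linarith)⟩
    · exact absurd hv' hv

end

/-! ### The market of a Pure-Circuit instance -/

/-- The function `x ↦ x`. -/
def linPLC : PLC := ⟨[], 1, by simp, by simp⟩

/-- The function `x ↦ 10 ^ 8 * min x c`. -/
def capPLC (c : ℚ≥0) (hc : 0 < c) : PLC := ⟨[(10 ^ 8, c)], 0, by simpa using hc, by simp⟩

theorem linPLC_value (x : ℝ) : linPLC.value x = x := by
  simp [PLC.value, linPLC, evalPieces]

theorem capPLC_value (c : ℚ≥0) (hc : 0 < c) (x : ℝ) :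
    (capPLC c hc).value x = 10 ^ 8 * min x c := by
  simp [PLC.value, capPLC, evalPieces]

theorem zeroPLC_value (x : ℝ) : PLC.zero.value x = 0 := by
  simp [PLC.value, PLC.zero, evalPieces]

/-- The length of the first piece. -/
def PLC.cap (f : PLC) : ℝ := match f.pieces with
  | [] => 0
  | q :: _ => q.2

@[simp] theorem linPLC_cap : linPLC.cap = 0 := rfl
@[simp] theorem capPLC_cap (c : ℚ≥0) (hc : 0 < c) : (capPLC c hc).cap = c := rfl
@[simp] theorem zeroPLC_cap : PLC.zero.cap = 0 := rfl

/-- The last slope as a real number. -/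
def PLC.lastR (f : PLC) : ℝ := (f.last : ℝ)

@[simp] theorem linPLC_lastR : linPLC.lastR = 1 := by simp [PLC.lastR, linPLC]
@[simp] theorem capPLC_lastR (c : ℚ≥0) (hc : 0 < c) : (capPLC c hc).lastR = 0 := by
  simp [PLC.lastR, capPLC]
@[simp] theorem zeroPLC_lastR : PLC.zero.lastR = 0 := by simp [PLC.lastR, PLC.zero]

/-- The utility functions that occur in the market. -/
inductive PLC.Basic : PLC → Prop
  | lin : PLC.Basic linPLC
  -- The lower bound exceeds 1/3, which turns sums of caps into degree bounds.
  | cap (c : ℚ≥0) (hc : 0 < c) (h : 371 / 1000 ≤ c) : PLC.Basic (capPLC c hc)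

/-- The caps 0.371 and 0.515 compete for one good and fill the bound 443/500; 0.88 is below it and
is used for inverters. -/
def mainCap : PLC := capPLC (22 / 25) (by norm_num)
def fstCap : PLC := capPLC (371 / 1000) (by norm_num)
def sndCap : PLC := capPLC (103 / 200) (by norm_num)

/-- A pattern for the utility functions of a buyer: for the three nodes of a gate, at most two goods
each. -/
abbrev Tpl : Type := Fin 6 → Option (Fin 4 × PLC)

/-- The patterns of the buyers for the two kinds of gates. -/
def tpl : Bool → Fin 8 → Option Tpl
  -- Goods 0, 1, 2, 3 of a node play the roles `r`, `i`, `d`, `y`. Entry `f` of a pattern concerns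
  -- node `f / 2` of the gate. Passes 0 to 3 create the buyers of goods 3, 2, 0, 1 of the last node,
  -- passes 4 to 7 those of the first output of PURIFY. NAND has no use for good 3, but that good
  -- needs a buyer too.
  | false, 0 => some ![none, none, none, none, some (3, linPLC), none]
  | false, 1 => some ![some (1, mainCap), none, some (1, mainCap), none, some (2, linPLC), none]
  | true, 0 => some ![some (1, sndCap), none, none, none, some (3, linPLC), none]
  | true, 1 => some ![none, none, none, none, some (3, mainCap), some (2, linPLC)]
  | _, 2 => some ![none, none, none, none, some (2, mainCap), some (0, linPLC)]
  | _, 3 => some ![none, none, none, none, some (0, mainCap), some (1, linPLC)]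
  | true, 4 => some ![some (1, fstCap), none, some (3, linPLC), none, none, none]
  | true, 5 => some ![none, none, some (3, mainCap), some (2, linPLC), none, none]
  | true, 6 => some ![none, none, some (2, mainCap), some (0, linPLC), none, none]
  | true, 7 => some ![none, none, some (0, mainCap), some (1, linPLC), none, none]
  | false, _ => none

/-- The good of kind `k` that belongs to the node `v`. -/
def good {n : ℕ} (v : Fin n) (k : Fin 4) : Fin (4 * n + 1) := ⟨4 * v + k, by omega⟩

/-- The good that belongs to no node. -/
def lastGood (n : ℕ) : Fin (4 * n + 1) := ⟨4 * n, by omega⟩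

theorem good_inj {n : ℕ} {v w : Fin n} {k l : Fin 4} : good v k = good w l ↔ v = w ∧ k = l := by
  simp only [good, Fin.ext_iff]
  omega

theorem good_ne_last {n : ℕ} (v : Fin n) (k : Fin 4) : good v k ≠ lastGood n := by
  simp only [good, lastGood, ne_eq, Fin.mk.injEq]
  omega

theorem eq_good_or_last {n : ℕ} (j : Fin (4 * n + 1)) : (∃ v k, j = good v k) ∨ j = lastGood n := by
  by_cases h : (j : ℕ) = 4 * n
  · right; ext; exact h
  · left
    refine ⟨⟨j / 4, by omega⟩, ⟨j % 4, by omega⟩, ?_⟩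
    ext
    simp only [good]
    omega

namespace Gate

variable {n : ℕ}

/-- Whether the gate is a PURIFY gate. -/
def isPurify : Gate n → Bool
  | nand _ _ _ => false
  | purify _ _ _ => true

/-- The nodes of a gate. -/
def node : Gate n → Fin 3 → Fin n
  | nand u v w => ![u, v, w]
  | purify u v w => ![u, v, w]

/-- The list of the utility functions of the buyer with the given pattern. -/
def tplUtility (g : Gate n) (t : Tpl) : List (Fin (4 * n + 1) × PLC) :=
  (List.finRange 6).filterMap fun f => (t f).map fun q =>
    (good (g.node ⟨f / 2, by omega⟩) q.1, q.2)

end Gate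

/-- The buyer with budget `1` and the given utility functions (for distinct goods). -/
def mkBuyer {m : ℕ} (l : List (Fin m × PLC)) : Buyer m :=
  if h : (l.map Prod.fst).Nodup then ⟨1, l, one_pos, h⟩ else ⟨1, [], one_pos, by simp⟩

theorem mkBuyer_budget {m : ℕ} (l : List (Fin m × PLC)) : (mkBuyer l).budget = 1 := by
  unfold mkBuyer; split_ifs <;> rfl

theorem mkBuyer_utility {m : ℕ} {l : List (Fin m × PLC)} (h : (l.map Prod.fst).Nodup) :
    (mkBuyer l).utility = l := by
  simp [mkBuyer, h]

/-- The list of the utility functions of the buyer of a gate in the given pass. -/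
def gateUtility {n : ℕ} (i : Fin 8) (g : Gate n) : Option (List (Fin (4 * n + 1) × PLC)) :=
  (tpl g.isPurify i).map g.tplUtility

/-- The buyers in the market of a Pure-Circuit instance. -/
def marketBuyers (C : PureCircuit) : List (Buyer (4 * C.n + 1)) :=
  -- This buyer keeps the market non-empty even if there are no nodes.
  mkBuyer [(lastGood C.n, linPLC)] ::
    (List.finRange 8).flatMap fun i => C.gates.filterMap fun g => (gateUtility i g).map mkBuyer

/-- The market of a Pure-Circuit instance. -/
def market (C : PureCircuit) : FisherMarket where
  numGoods := 4 * C.n + 1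
  buyers := marketBuyers C
  buyers_nonempty := by simp [marketBuyers]

/-! #### The utility functions of the buyers of a gate -/

section

variable {n : ℕ}

theorem gateUtility_nand (u v w : Fin n) (i : Fin 8) : gateUtility i (.nand u v w) =
    ![some [(good w 3, linPLC)],
      some [(good u 1, mainCap), (good v 1, mainCap), (good w 2, linPLC)],
      some [(good w 2, mainCap), (good w 0, linPLC)],
      some [(good w 0, mainCap), (good w 1, linPLC)], none, none, none, none] i := by
  fin_cases i <;> rfl

theorem gateUtility_purify (u v w : Fin n) (i : Fin 8) : gateUtility i (.purify u v w) =
    ![some [(good u 1, sndCap), (good w 3, linPLC)],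
      some [(good w 3, mainCap), (good w 2, linPLC)],
      some [(good w 2, mainCap), (good w 0, linPLC)],
      some [(good w 0, mainCap), (good w 1, linPLC)],
      some [(good u 1, fstCap), (good v 3, linPLC)],
      some [(good v 3, mainCap), (good v 2, linPLC)],
      some [(good v 2, mainCap), (good v 0, linPLC)],
      some [(good v 0, mainCap), (good v 1, linPLC)]] i := by
  fin_cases i <;> rfl

/-- The properties of the list of the utility functions of a buyer. -/
structure GoodUtility {m : ℕ} (l : List (Fin m × PLC)) : Prop where
  nodup : (l.map Prod.fst).Nodup
  lin : (l.map fun e => e.2.lastR).sum = 1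
  cap : (l.map fun e => e.2.cap).sum ≤ 2
  length : l.length ≤ 3
  basic : ∀ e ∈ l, e.2.Basic

theorem goodUtility_gate {g : Gate n} (hg : (g.inputs ++ g.outputs).Nodup) {i : Fin 8}
    {l : List (Fin (4 * n + 1) × PLC)} (h : gateUtility i g = some l) : GoodUtility l := by
  have b₁ : linPLC.Basic := .lin
  have b₂ : mainCap.Basic := .cap _ _ (by rw [div_le_div_iff₀] <;> norm_num)
  have b₃ : fstCap.Basic := .cap _ _ le_rfl
  have b₄ : sndCap.Basic := .cap _ _ (by rw [div_le_div_iff₀] <;> norm_num)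
  rcases g with ⟨u, v, w⟩ | ⟨u, v, w⟩
  · rw [gateUtility_nand] at h
    simp [Gate.inputs, Gate.outputs] at hg
    fin_cases i <;> simp at h <;> subst h <;> constructor <;>
      simp [good_inj, hg, mainCap, capPLC_cap, b₁] <;> (try norm_num) <;> simp_all [mainCap]
  · rw [gateUtility_purify] at h
    simp [Gate.inputs, Gate.outputs] at hg
    fin_cases i <;> simp at h <;> subst h <;> constructor <;>
      simp [good_inj, hg, mainCap, fstCap, sndCap, capPLC_cap, b₁] <;> (try norm_num) <;>
      simp_all [mainCap, fstCap, sndCap]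

theorem goodUtility_last : GoodUtility [(lastGood n, linPLC)] := by
  have b₁ : linPLC.Basic := .lin
  constructor <;> simp [b₁]

end

theorem exists_of_mem_buyers {C : PureCircuit} {b : Buyer (4 * C.n + 1)}
    (hb : b ∈ marketBuyers C) : b.budget = 1 ∧ GoodUtility b.utility := by
  simp only [marketBuyers, List.mem_cons, List.mem_flatMap, List.mem_filterMap, Option.map_eq_some_iff]
    at hb
  rcases hb with rfl | ⟨i, _, g, hg, l, hl, rfl⟩
  · exact ⟨mkBuyer_budget _, by
      rw [mkBuyer_utility goodUtility_last.nodup]; exact goodUtility_last⟩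
  · have h := goodUtility_gate (C.distinct g hg) hl
    exact ⟨mkBuyer_budget _, by rw [mkBuyer_utility h.nodup]; exact h⟩

theorem exists_buyer {C : PureCircuit} {g : Gate C.n} (hg : g ∈ C.gates) {i : Fin 8}
    {l : List (Fin (4 * C.n + 1) × PLC)} (h : gateUtility i g = some l) :
    ∃ b ∈ marketBuyers C, b.utility = l := by
  refine ⟨mkBuyer l, ?_, mkBuyer_utility (goodUtility_gate (C.distinct g hg) h).nodup⟩
  simp only [marketBuyers, List.mem_cons, List.mem_flatMap, List.mem_filterMap, Option.map_eq_some_iff]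
  exact Or.inr ⟨i, List.mem_finRange i, g, hg, l, h, rfl⟩

/-! #### Sums over the buyers -/

/-- The sum of `ψ` over the utility functions for good `j`. -/
noncomputable def entrySum {m : ℕ} (ψ : PLC → ℝ) (j : Fin m) (l : List (Fin m × PLC)) : ℝ :=
  (l.map fun e => if e.1 = j then ψ e.2 else 0).sum

theorem entrySum_eq_zero {m : ℕ} (ψ : PLC → ℝ) (j : Fin m) :
    ∀ l : List (Fin m × PLC), j ∉ l.map Prod.fst → entrySum ψ j l = 0
  | [], _ => rfl
  | e :: l, h => by
    simp only [List.map_cons, List.mem_cons, not_or] at h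
    have := entrySum_eq_zero ψ j l h.2
    simp [entrySum, Ne.symm h.1] at this ⊢
    exact this

/-- Reduces sums over the market to sums over lists of entries; applied with `ψ` the last slope and
the cap. -/
theorem apply_lookup {m : ℕ} (ψ : PLC → ℝ) (h₀ : ψ PLC.zero = 0) (j : Fin m) :
    ∀ l : List (Fin m × PLC), (l.map Prod.fst).Nodup →
      ψ ((l.lookup j).getD PLC.zero) = entrySum ψ j l
  | [], _ => by simp [h₀, entrySum]
  | e :: l, h => by
    simp only [List.map_cons, List.nodup_cons] at h
    obtain ⟨k, f⟩ := e
    by_cases hk : j = k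
    · subst hk
      have := entrySum_eq_zero ψ j l h.1
      simp [entrySum] at this ⊢
      exact this
    · have := apply_lookup ψ h₀ j l h.2
      have hb : (j == k) = false := by simpa using hk
      simp [entrySum, List.lookup_cons, hb, Ne.symm hk] at this ⊢
      exact this

theorem sum_entrySum {m : ℕ} (ψ : PLC → ℝ) (p : Fin m → ℝ) :
    ∀ l : List (Fin m × PLC), ∑ j, p j * entrySum ψ j l = (l.map fun e => p e.1 * ψ e.2).sum
  | [] => by simp [entrySum]
  | e :: l => by
    have := sum_entrySum ψ p l
    simp only [entrySum] at this
    simp [entrySum, mul_add, Finset.sum_add_distrib, this]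

theorem sum_map_filterMap {α β : Type*} (f : α → Option β) (φ : β → ℝ) : ∀ l : List α,
    ((l.filterMap f).map φ).sum = (l.map fun a => ((f a).map φ).getD 0).sum
  | [] => rfl
  | a :: l => by
    have := sum_map_filterMap f φ l
    rcases h : f a with _ | b <;> simp [h, this]

theorem sum_map_flatMap_filterMap {α β γ : Type*} (f : α → β → Option γ) (φ : γ → ℝ)
    (m : List β) : ∀ l : List α, ((l.flatMap fun a => m.filterMap (f a)).map φ).sum =
      (m.map fun b => (l.map fun a => ((f a b).map φ).getD 0).sum).sum
  | [] => by simp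
  | a :: l => by
    simp only [List.flatMap_cons, List.map_append, List.sum_append,
      sum_map_flatMap_filterMap f φ m l, sum_map_filterMap, List.map_cons, List.sum_cons]
    rw [List.sum_map_add]

/-- The sum of `ψ` over the utility functions of the buyers of a gate for good `j`. -/
noncomputable def gateSum {n : ℕ} (ψ : PLC → ℝ) (j : Fin (4 * n + 1)) (g : Gate n) : ℝ :=
  ((List.finRange 8).map fun i => ((gateUtility i g).map (entrySum ψ j)).getD 0).sum

/-- The utility functions in the market of a Pure-Circuit instance. -/
def marketUtil (C : PureCircuit) (i : Fin (marketBuyers C).length) (j : Fin (4 * C.n + 1)) : PLC :=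
  (((marketBuyers C).get i).utility.lookup j).getD PLC.zero

theorem apply_util (C : PureCircuit) (ψ : PLC → ℝ) (h₀ : ψ PLC.zero = 0) (i : Fin (marketBuyers C).length)
    (j : Fin (4 * C.n + 1)) :
    ψ (marketUtil C i j) = entrySum ψ j ((marketBuyers C).get i).utility := by
  rw [marketUtil]
  exact apply_lookup ψ h₀ j _ ((marketBuyers C).get i).nodup

theorem sum_buyers (C : PureCircuit) (ψ : PLC → ℝ) (h₀ : ψ PLC.zero = 0) (j : Fin (4 * C.n + 1)) :
    ∑ i, ψ (marketUtil C i j) =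
      entrySum ψ j [(lastGood C.n, linPLC)] + (C.gates.map (gateSum ψ j)).sum := by
  simp only [apply_util C ψ h₀]
  have h₁ : ∑ i : Fin (marketBuyers C).length, entrySum ψ j ((marketBuyers C).get i).utility =
      ((marketBuyers C).map fun b => entrySum ψ j b.utility).sum := by
    rw [← Fin.sum_univ_fun_getElem]
    rfl
  rw [h₁]
  unfold marketBuyers
  simp only [List.map_cons, List.sum_cons]
  rw [mkBuyer_utility goodUtility_last.nodup]
  congr 1
  refine (sum_map_flatMap_filterMap (fun (i : Fin 8) g => (gateUtility i g).map mkBuyer)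
    (fun b => entrySum ψ j b.utility) C.gates (List.finRange 8)).trans ?_
  congr 1
  refine List.map_congr_left fun g hg => ?_
  unfold gateSum
  congr 1
  refine List.map_congr_left fun i _ => ?_
  rcases h : gateUtility i g with _ | l
  · rfl
  · simp [mkBuyer_utility (goodUtility_gate (C.distinct g hg) h).nodup]

/-! #### The sums for a given good -/

section

variable {n : ℕ}

theorem gateSum_last (ψ : PLC → ℝ) (g : Gate n) : gateSum ψ (lastGood n) g = 0 := by
  rcases g with ⟨u, v, w⟩ | ⟨u, v, w⟩
  · simp [gateSum, gateUtility_nand, entrySum, good_ne_last, List.finRange_succ]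
  · simp [gateSum, gateUtility_purify, entrySum, good_ne_last, List.finRange_succ]

/-- A gate creates the buyers of all four goods of its output nodes, and no others. -/
theorem gateSum_lastR (v : Fin n) (k : Fin 4) (g : Gate n) :
    gateSum PLC.lastR (good v k) g = (g.outputs.count v : ℕ) := by
  rcases g with ⟨a, b, c⟩ | ⟨a, b, c⟩
  · fin_cases k <;> simp [gateSum, gateUtility_nand, entrySum, good_inj, mainCap, Gate.outputs,
      List.finRange_succ, List.count_cons]
  · fin_cases k <;> simp [gateSum, gateUtility_purify, entrySum, good_inj, mainCap, fstCap, sndCap,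
      Gate.outputs, List.finRange_succ, List.count_cons, add_comm]

/-- Good 1 of a node is consumed by the gate that reads the node, the other goods within the gate
that outputs it. PURIFY attains the bound at its input. -/
theorem gateSum_cap (v : Fin n) (k : Fin 4) (g : Gate n) :
    gateSum PLC.cap (good v k) g ≤
      443 / 500 * ((if k = 1 then g.inputs.count v else g.outputs.count v) : ℕ) := by
  rcases g with ⟨a, b, c⟩ | ⟨a, b, c⟩
  · fin_cases k <;> simp [gateSum, gateUtility_nand, entrySum, good_inj, mainCap, Gate.outputs,
      Gate.inputs, List.finRange_succ, List.count_cons] <;> split_ifs <;> norm_num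
  · fin_cases k <;> simp [gateSum, gateUtility_purify, entrySum, good_inj, mainCap, fstCap, sndCap,
      Gate.outputs, Gate.inputs, List.finRange_succ, List.count_cons] <;> split_ifs <;> norm_num

end

theorem sum_count_outputs (C : PureCircuit) (v : Fin C.n) :
    (C.gates.map fun g => g.outputs.count v).sum = 1 := by
  rw [← C.output_once v, List.count_flatMap]
  rfl

theorem sum_count_inputs {C : PureCircuit} (hC : C.InputOnce) (v : Fin C.n) :
    (C.gates.map fun g => g.inputs.count v).sum = 1 := by
  rw [← hC v, List.count_flatMap]
  rfl

theorem cast_list_sum {α : Type*} (f : α → ℕ) (l : List α) :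
    (l.map fun a => (f a : ℝ)).sum = ((l.map f).sum : ℕ) := by
  induction l with
  | nil => simp
  | cons a l ih => simp [ih]

theorem sum_lastR (C : PureCircuit) (j : Fin (4 * C.n + 1)) :
    ∑ i, (marketUtil C i j).lastR = 1 := by
  rw [sum_buyers C PLC.lastR zeroPLC_lastR]
  rcases eq_good_or_last (n := C.n) j with ⟨v, k, rfl⟩ | rfl
  · have h : C.gates.map (gateSum PLC.lastR (good v k)) =
        C.gates.map fun g => ((g.outputs.count v : ℕ) : ℝ) :=
      List.map_congr_left fun g _ => gateSum_lastR v k g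
    rw [h, cast_list_sum, sum_count_outputs]
    simpa [entrySum] using (good_ne_last v k).symm
  · have h : C.gates.map (gateSum PLC.lastR (lastGood C.n)) = C.gates.map fun _ => 0 :=
      List.map_congr_left fun g _ => gateSum_last _ g
    rw [h]
    simp [entrySum]

theorem sum_cap {C : PureCircuit} (hC : C.InputOnce) (j : Fin (4 * C.n + 1)) :
    ∑ i, (marketUtil C i j).cap ≤ 443 / 500 := by
  rw [sum_buyers C PLC.cap zeroPLC_cap]
  rcases eq_good_or_last (n := C.n) j with ⟨v, k, rfl⟩ | rfl
  · have h := List.sum_le_sum (l := C.gates) (f := gateSum PLC.cap (good v k))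
      (g := fun g => 443 / 500 *
        (((if k = 1 then g.inputs.count v else g.outputs.count v) : ℕ) : ℝ))
      fun g _ => gateSum_cap v k g
    rw [List.sum_map_mul_left, cast_list_sum] at h
    have h₂ : (C.gates.map fun g => if k = 1 then g.inputs.count v else g.outputs.count v).sum =
        1 := by
      by_cases hk : k = 1
      · simpa [hk] using sum_count_inputs hC v
      · simpa [hk] using sum_count_outputs C v
    rw [h₂] at h
    simp [entrySum]
    simpa using h
  · have h : C.gates.map (gateSum PLC.cap (lastGood C.n)) = C.gates.map fun _ => 0 :=
      List.map_congr_left fun g _ => gateSum_last _ g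
    rw [h]
    simp [entrySum]
    norm_num

/-! #### The correspondence of buyers and goods -/

theorem market_buyer (C : PureCircuit) (i : Fin (marketBuyers C).length) :
    ((marketBuyers C).get i).budget = 1 ∧ GoodUtility ((marketBuyers C).get i).utility :=
  exists_of_mem_buyers (List.get_mem (marketBuyers C) i)

theorem util_cases (C : PureCircuit) (i : Fin (marketBuyers C).length) (j : Fin (4 * C.n + 1)) :
    marketUtil C i j = PLC.zero ∨ (marketUtil C i j).Basic := by
  rw [marketUtil]
  rcases h : List.lookup j ((marketBuyers C).get i).utility with _ | f
  · exact Or.inl rfl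
  · obtain ⟨e, he, -, rfl⟩ : ∃ e ∈ ((marketBuyers C).get i).utility, e.1 = j ∧ e.2 = f := by
      rw [List.lookup_eq_some_iff] at h
      obtain ⟨l₁, l₂, h, -⟩ := h
      exact ⟨(j, f), by rw [h]; simp, rfl, rfl⟩
    exact Or.inr ((market_buyer C i).2.basic e he)

theorem sum_util (C : PureCircuit) (ψ : PLC → ℝ) (h₀ : ψ PLC.zero = 0) (i : Fin (marketBuyers C).length)
    (p : Fin (4 * C.n + 1) → ℝ) :
    ∑ j, p j * ψ (marketUtil C i j) =
      (((marketBuyers C).get i).utility.map fun e => p e.1 * ψ e.2).sum := by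
  simp only [apply_util C ψ h₀]
  exact sum_entrySum ψ p _

theorem exists_eq_ite {ι : Type*} [Fintype ι] [DecidableEq ι] {a : ι → ℝ}
    (h : ∀ i, a i = 0 ∨ a i = 1) (hs : ∑ i, a i = 1) : ∃ i, ∀ j, a j = if j = i then 1 else 0 := by
  obtain ⟨i, hi⟩ : ∃ i, a i = 1 := by
    by_contra hn
    push Not at hn
    rw [Finset.sum_eq_zero fun i _ => (h i).resolve_right (hn i)] at hs
    norm_num at hs
  refine ⟨i, fun j => ?_⟩
  by_cases hj : j = i
  · simp [hj, hi]
  · rcases h j with h' | h'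
    · simp [h', hj]
    · have h₁ : ∑ k ∈ {i, j}, a k ≤ ∑ k, a k :=
        Finset.sum_le_sum_of_subset_of_nonneg (Finset.subset_univ _)
          fun k _ _ => by rcases h k with h | h <;> simp [h]
      rw [Finset.sum_pair (Ne.symm hj), hi, h', hs] at h₁
      norm_num at h₁

/-- A permutation matrix: the positions of the ones in rows and in columns define inverse maps. -/
theorem exists_equiv_of_sum {ι κ : Type*} [Fintype ι] [Fintype κ] [DecidableEq ι] [DecidableEq κ]
    {a : ι → κ → ℝ} (h : ∀ i j, a i j = 0 ∨ a i j = 1) (hr : ∀ i, ∑ j, a i j = 1)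
    (hc : ∀ j, ∑ i, a i j = 1) : ∃ e : ι ≃ κ, ∀ i j, a i j = if j = e i then 1 else 0 := by
  choose f hf using fun i => exists_eq_ite (h i) (hr i)
  choose g hg using fun j => exists_eq_ite (fun i => h i j) (hc j)
  have h₁ : ∀ i, g (f i) = i := fun i => by
    have := hf i (f i)
    rw [hg] at this
    by_contra hne
    simp [Ne.symm hne] at this
  have h₂ : ∀ j, f (g j) = j := fun j => by
    have := hg j (g j)
    rw [hf] at this
    by_contra hne
    simp [Ne.symm hne] at this
  exact ⟨⟨f, g, h₁, h₂⟩, hf⟩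

theorem lastR_cases (C : PureCircuit) (i : Fin (marketBuyers C).length) (j : Fin (4 * C.n + 1)) :
    (marketUtil C i j).lastR = 0 ∨ (marketUtil C i j).lastR = 1 := by
  rcases util_cases C i j with h | h
  · rw [h]; simp
  · generalize marketUtil C i j = f at h
    cases h <;> simp

/-- Identifies buyers with goods, as `Eqm` presupposes. -/
theorem exists_owner (C : PureCircuit) : ∃ e : Fin (marketBuyers C).length ≃ Fin (4 * C.n + 1),
    ∀ i j, (marketUtil C i j).lastR = if j = e i then 1 else 0 := by
  refine exists_equiv_of_sum (κ := Fin (4 * C.n + 1)) (lastR_cases C) (fun i => ?_)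
    (sum_lastR C)
  have h := sum_util C PLC.lastR zeroPLC_lastR i fun _ => 1
  simp only [one_mul] at h
  exact h.trans (market_buyer C i).2.lin

/-- The good whose utility function for buyer `i` is linear. -/
noncomputable def owner (C : PureCircuit) : Fin (marketBuyers C).length ≃ Fin (4 * C.n + 1) :=
  (exists_owner C).choose

theorem owner_spec (C : PureCircuit) (i : Fin (marketBuyers C).length) (j : Fin (4 * C.n + 1)) :
    (marketUtil C i j).lastR = if j = owner C i then 1 else 0 :=
  (exists_owner C).choose_spec i j

/-- The useful amount of good `j` for the buyer of good `k`. -/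
noncomputable def marketCap (C : PureCircuit) (k j : Fin (4 * C.n + 1)) : ℝ :=
  (marketUtil C ((owner C).symm k) j).cap

theorem util_owner (C : PureCircuit) (i : Fin (marketBuyers C).length) :
    marketUtil C i (owner C i) = linPLC := by
  have h := owner_spec C i (owner C i)
  rcases util_cases C i (owner C i) with h' | h'
  · rw [h'] at h; simp at h
  · generalize marketUtil C i (owner C i) = f at h h'
    cases h'
    · rfl
    · simp at h

theorem util_value (C : PureCircuit) (i : Fin (marketBuyers C).length) (j : Fin (4 * C.n + 1)) {x : ℝ}
    (hx : 0 ≤ x) : (marketUtil C i j).value x =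
      (if j = owner C i then x else 0) + 10 ^ 8 * min x (marketCap C (owner C i) j) := by
  by_cases hj : j = owner C i
  · subst hj
    simp [marketCap, util_owner, linPLC_value, hx]
  · have h := owner_spec C i j
    simp only [marketCap, Equiv.symm_apply_apply, hj, if_false, zero_add]
    rcases util_cases C i j with h' | h'
    · rw [h', zeroPLC_value]; simp [hx]
    · generalize marketUtil C i j = f at h h'
      cases h'
      · simp [hj] at h
      · rw [capPLC_value, capPLC_cap]

theorem sum_util_value (C : PureCircuit) (i : Fin (marketBuyers C).length)
    {z : Fin (4 * C.n + 1) → ℝ} (hz : ∀ j, 0 ≤ z j) :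
    ∑ j, (marketUtil C i j).value (z j) = goodUtil (marketCap C) (owner C i) z := by
  unfold goodUtil
  rw [Finset.sum_congr rfl fun j _ => util_value C i j (hz j), Finset.sum_add_distrib,
    Finset.mul_sum]
  simp

theorem market_budget (C : PureCircuit) (i : (market C).Buyers) : (market C).budget i = 1 :=
  (market_buyer C i).1

/-- Approximate equilibria of the market of a Pure-Circuit instance. -/
theorem market_equilibrium {C : PureCircuit} {ε δ : ℝ} {p : Fin (4 * C.n + 1) → ℝ}
    {x : Fin (marketBuyers C).length → Fin (4 * C.n + 1) → ℝ}
    (h : (market C).IsApproxEquilibrium ε δ p x) :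
    (∀ j, 0 ≤ p j) ∧ (∀ i j, 0 ≤ x i j) ∧ (∀ i, ∑ j, p j * x i j ≤ 1) ∧
      (∀ i (z : Fin (4 * C.n + 1) → ℝ), (∀ j, 0 ≤ z j) → ∑ j, p j * z j ≤ 1 →
        (1 - δ) * ∑ j, (marketUtil C i j).value (z j) ≤
          ∑ j, (marketUtil C i j).value (x i j)) ∧ ∀ j, |∑ i, x i j - 1| ≤ ε := by
  have hb : ∀ i, ((market C).budget i : ℝ) = 1 := fun i =>
    (congrArg _ (market_budget C i)).trans NNRat.cast_one
  exact ⟨h.1, fun i => (h.2.1 i).1.1, fun i => (h.2.1 i).1.2.trans (hb i).le,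
    fun i z hz hz' => (h.2.1 i).2 z ⟨hz, hz'.trans (hb i).ge⟩, h.2.2⟩

theorem cap_nonneg (f : PLC) : 0 ≤ f.cap := by
  unfold PLC.cap
  split
  · exact le_rfl
  · exact NNRat.cast_nonneg _

theorem market_eqm {C : PureCircuit} (hC : C.InputOnce) {ε δ : ℝ} (hε : ε ≤ 1 / 9) (hδ₀ : 0 ≤ δ)
    (hδ : δ ≤ 1 / 10 ^ 24) {p : Fin (4 * C.n + 1) → ℝ}
    {x : Fin (marketBuyers C).length → Fin (4 * C.n + 1) → ℝ}
    (h : (market C).IsApproxEquilibrium ε δ p x) :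
    Eqm (marketCap C) p (fun k => x ((owner C).symm k)) δ := by
  obtain ⟨hp, hx, hb, ho, hc⟩ := market_equilibrium h
  have hsum : ∀ j, ∑ k, x ((owner C).symm k) j = ∑ i, x i j := fun j =>
    Equiv.sum_comp (owner C).symm fun i => x i j
  refine ⟨hδ₀, hδ, fun k j => cap_nonneg _, fun k => ?_, fun k => ?_, fun j => ?_, hp,
    fun k j => hx _ j, fun k => hb _, fun k z hz hz' => ?_, fun j => ?_, fun j => ?_⟩
  · have := util_owner C ((owner C).symm k)
    rw [Equiv.apply_symm_apply] at this
    simp [marketCap, this]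
  · have h := sum_util C PLC.cap zeroPLC_cap ((owner C).symm k) fun _ => 1
    simp only [one_mul] at h
    exact h.le.trans (market_buyer C _).2.cap
  · exact (Equiv.sum_comp (owner C).symm fun i => (marketUtil C i j).cap).le.trans
      (sum_cap hC j)
  · have h := ho ((owner C).symm k) z hz hz'
    rw [sum_util_value C _ hz, sum_util_value C _ (hx _), Equiv.apply_symm_apply] at h
    exact h
  · rw [hsum]
    linarith [(abs_le.1 (hc j)).1]
  · rw [hsum]
    linarith [(abs_le.1 (hc j)).2]

/-! #### The family of these markets is simple -/

theorem PLC.Basic.slopes {f : PLC} (h : f.Basic) : ∀ s ∈ f.slopes, s = 0 ∨ s = 1 ∨ s = 10 ^ 8 := by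
  cases h <;> simp [PLC.slopes, linPLC, capPLC]

theorem zero_slopes : ∀ s ∈ PLC.zero.slopes, s = 0 := by
  simp [PLC.slopes, PLC.zero]

theorem PLC.Basic.linearCapped {f : PLC} (h : f.Basic) : f.IsLinearCapped := by
  cases h with
  | lin => exact ⟨1, by norm_num, Or.inl fun x _ => by simp [linPLC_value]⟩
  | cap c hc =>
    refine ⟨10 ^ 8, by norm_num, Or.inr ⟨10 ^ 8 * c, by positivity, fun x _ => ?_⟩⟩
    rw [capPLC_value, mul_min_of_nonneg _ _ (by norm_num)]

theorem zero_not_nonZero : ¬PLC.zero.NonZero := by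
  rintro ⟨x, -, h⟩
  exact h (zeroPLC_value x)

/-- This weight counts non-zero utility functions from above. Its sum is at most 1 + 3 · 2 for a
buyer and 1 + 3 · 0.886 < 4 for a good. -/
theorem PLC.Basic.one_le {f : PLC} (h : f.Basic) : 1 ≤ f.lastR + 3 * f.cap := by
  cases h with
  | lin => simp
  | cap c hc h =>
    have : ((371 / 1000 : ℚ≥0) : ℝ) ≤ c := by exact_mod_cast h
    simp at this ⊢
    linarith

theorem ncard_le_sum {ι : Type*} [Fintype ι] {s : Set ι} {φ : ι → ℝ} (h₀ : ∀ i, 0 ≤ φ i)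
    (h₁ : ∀ i ∈ s, 1 ≤ φ i) : (s.ncard : ℝ) ≤ ∑ i, φ i := by
  classical
  have h : s = (Finset.univ.filter (· ∈ s) : Finset ι) := by ext; simp
  rw [h, Set.ncard_coe_finset, Finset.cast_card]
  refine (Finset.sum_le_sum fun i hi => h₁ i (by simpa using hi)).trans ?_
  exact Finset.sum_le_sum_of_subset_of_nonneg (Finset.filter_subset _ _) fun i _ _ => h₀ i

theorem lastR_nonneg (f : PLC) : 0 ≤ f.lastR := NNRat.cast_nonneg _

theorem one_le_of_nonZero {C : PureCircuit} {i : Fin (marketBuyers C).length}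
    {j : Fin (4 * C.n + 1)} (h : (marketUtil C i j).NonZero) :
    1 ≤ (marketUtil C i j).lastR + 3 * (marketUtil C i j).cap := by
  rcases util_cases C i j with h' | h'
  · rw [h'] at h
    exact absurd h zero_not_nonZero
  · exact h'.one_le

theorem lastR_add_cap_nonneg (f : PLC) : 0 ≤ f.lastR + 3 * f.cap := by
  have := lastR_nonneg f
  have := cap_nonneg f
  positivity

theorem market_buyer_degree (C : PureCircuit) (i : Fin (marketBuyers C).length) :
    {j | (marketUtil C i j).NonZero}.ncard ≤ 7 := by
  have h := ncard_le_sum (s := {j | (marketUtil C i j).NonZero})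
    (φ := fun j => (marketUtil C i j).lastR + 3 * (marketUtil C i j).cap)
    (fun j => lastR_add_cap_nonneg _) fun j hj => one_le_of_nonZero hj
  rw [Finset.sum_add_distrib, ← Finset.mul_sum] at h
  have h₁ := sum_util C PLC.lastR zeroPLC_lastR i fun _ => 1
  have h₂ := sum_util C PLC.cap zeroPLC_cap i fun _ => 1
  simp only [one_mul] at h₁ h₂
  rw [h₁, h₂, (market_buyer C i).2.lin] at h
  have h₃ := (market_buyer C i).2.cap
  have : (({j | (marketUtil C i j).NonZero}.ncard : ℕ) : ℝ) ≤ (7 : ℕ) := by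
    push_cast
    linarith
  exact_mod_cast this

theorem market_good_degree {C : PureCircuit} (hC : C.InputOnce) (j : Fin (4 * C.n + 1)) :
    {i | (marketUtil C i j).NonZero}.ncard ≤ 4 := by
  have h := ncard_le_sum (s := {i | (marketUtil C i j).NonZero})
    (φ := fun i => (marketUtil C i j).lastR + 3 * (marketUtil C i j).cap)
    (fun i => lastR_add_cap_nonneg _) fun i hi => one_le_of_nonZero hi
  rw [Finset.sum_add_distrib, ← Finset.mul_sum, sum_lastR] at h
  have h₃ := sum_cap hC j
  have : (({i | (marketUtil C i j).NonZero}.ncard : ℕ) : ℝ) ≤ (4 : ℕ) := by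
    push_cast
    linarith
  exact_mod_cast this

theorem market_slopes (C : PureCircuit) (i : Fin (marketBuyers C).length)
    (j : Fin (4 * C.n + 1)) : ∀ s ∈ (marketUtil C i j).slopes, s ≠ 0 → s = 1 ∨ s = 10 ^ 8 := by
  intro s hs h
  rcases util_cases C i j with hj | hj
  · rw [hj] at hs
    exact absurd (zero_slopes s hs) h
  · exact (hj.slopes s hs).resolve_left h

theorem market_linearCapped (C : PureCircuit) (i : Fin (marketBuyers C).length)
    (j : Fin (4 * C.n + 1)) : (marketUtil C i j).IsLinearCapped := by
  rcases util_cases C i j with h | h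
  · rw [h]
    exact ⟨0, le_rfl, Or.inl fun x _ => by simp [zeroPLC_value]⟩
  · exact h.linearCapped

theorem market_isLinearPos (C : PureCircuit) (i : Fin (marketBuyers C).length) :
    (marketUtil C i (owner C i)).IsLinearPos :=
  ⟨1, one_pos, fun x _ => by rw [util_owner, linPLC_value, one_mul]⟩

theorem market_isSimple {C : PureCircuit} (hC : C.InputOnce) :
    (market C).IsSimple 7 4 (10 ^ 8) where
  linear_capped := market_linearCapped C
  budget_one := market_budget C
  buyer_degree := market_buyer_degree C
  good_degree := market_good_degree hC
  slope_ratio i j j' s hs s' hs' h h' := by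
    rcases market_slopes C i j s hs h with rfl | rfl <;>
      rcases market_slopes C i j' s' hs' h' with rfl | rfl <;> norm_num
  nonsatiated i := ⟨owner C i, market_isLinearPos C i⟩

/-! ### Assignments from approximate equilibria -/

section

variable {C : PureCircuit}

/-- The entry list of a gate's buyer has its linear function at `b`, which identifies that buyer as
the owner of `b`. -/
theorem market_row {g : Gate C.n} (hg : g ∈ C.gates) {i : Fin 8}
    {l : List (Fin (4 * C.n + 1) × PLC)} (h : gateUtility i g = some l) {b : Fin (4 * C.n + 1)}
    (hb : entrySum PLC.lastR b l = 1) :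
    (∀ j, marketCap C b j = entrySum PLC.cap j l) ∧
      ∀ p : Fin (4 * C.n + 1) → ℝ,
        ∑ j, p j * marketCap C b j = (l.map fun e => p e.1 * e.2.cap).sum := by
  obtain ⟨B, hB, rfl⟩ := exists_buyer hg h
  obtain ⟨k, rfl⟩ := List.get_of_mem hB
  have hk : owner C k = b := by
    have h₁ := owner_spec C k b
    rw [apply_util C PLC.lastR zeroPLC_lastR, hb] at h₁
    by_contra hne
    simp [Ne.symm hne] at h₁
  have hc : ∀ j, marketCap C b j = (marketUtil C k j).cap := fun j => by
    rw [marketCap, ← hk, Equiv.symm_apply_apply]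
  exact ⟨fun j => by rw [hc, apply_util C PLC.cap zeroPLC_cap],
    fun p => by simp only [hc]; exact sum_util C PLC.cap zeroPLC_cap k p⟩

theorem market_consumes {g : Gate C.n} (hg : g ∈ C.gates) {i : Fin 8} {a b : Fin (4 * C.n + 1)}
    {f : PLC} (h : gateUtility i g = some [(a, f), (b, linPLC)]) (hf : f.lastR = 0)
    (p : Fin (4 * C.n + 1) → ℝ) : Consumes (marketCap C) p b a f.cap := by
  have hn := (goodUtility_gate (C.distinct g hg) h).nodup
  have hab : a ≠ b := by simpa using hn
  obtain ⟨h₁, h₂⟩ := market_row hg h (b := b) (by simp [entrySum, hf])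
  exact ⟨hab.symm, by simp [h₁, entrySum, hab.symm], by simp [h₂, mul_comm]⟩

theorem mainCap_cap : mainCap.cap = 22 / 25 := by simp [mainCap]
theorem fstCap_cap : fstCap.cap = 371 / 1000 := by simp [fstCap]
theorem sndCap_cap : sndCap.cap = 515 / 1000 := by simp [sndCap]; norm_num
theorem mainCap_lastR : mainCap.lastR = 0 := capPLC_lastR _ _
theorem fstCap_lastR : fstCap.lastR = 0 := capPLC_lastR _ _
theorem sndCap_lastR : sndCap.lastR = 0 := capPLC_lastR _ _

theorem exists_output (C : PureCircuit) (v : Fin C.n) : ∃ g ∈ C.gates, v ∈ g.outputs := by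
  have h : v ∈ C.gates.flatMap Gate.outputs := by
    rw [← List.count_pos_iff, C.output_once v]
    exact one_pos
  simpa using h

theorem market_chain_consumes (p : Fin (4 * C.n + 1) → ℝ) (v : Fin C.n) :
    Consumes (marketCap C) p (good v 0) (good v 2) (22 / 25) ∧
      Consumes (marketCap C) p (good v 1) (good v 0) (22 / 25) := by
  obtain ⟨g, hg, hv⟩ := exists_output C v
  rw [← mainCap_cap]
  rcases g with ⟨a, b, c⟩ | ⟨a, b, c⟩
  · obtain rfl : v = c := by simpa [Gate.outputs] using hv
    exact ⟨market_consumes hg (i := 2) (gateUtility_nand _ _ _ _) mainCap_lastR p,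
      market_consumes hg (i := 3) (gateUtility_nand _ _ _ _) mainCap_lastR p⟩
  · obtain rfl | rfl : v = b ∨ v = c := by simpa [Gate.outputs] using hv
    · exact ⟨market_consumes hg (i := 6) (gateUtility_purify _ _ _ _) mainCap_lastR p,
        market_consumes hg (i := 7) (gateUtility_purify _ _ _ _) mainCap_lastR p⟩
    · exact ⟨market_consumes hg (i := 2) (gateUtility_purify _ _ _ _) mainCap_lastR p,
        market_consumes hg (i := 3) (gateUtility_purify _ _ _ _) mainCap_lastR p⟩

variable {p : Fin (4 * C.n + 1) → ℝ} {x : Fin (4 * C.n + 1) → Fin (4 * C.n + 1) → ℝ} {δ : ℝ}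

/-- The waste of the goods of a node. -/
noncomputable def nodeWaste (C : PureCircuit)
    (x : Fin (4 * C.n + 1) → Fin (4 * C.n + 1) → ℝ) (v : Fin C.n) : ℝ :=
  ∑ k, waste (marketCap C) x (good v k)

theorem nodeWaste_nonneg (v : Fin C.n) : 0 ≤ nodeWaste C x v :=
  Finset.sum_nonneg fun _ _ => Eqm.waste_nonneg _

theorem waste_le_nodeWaste (v : Fin C.n) (k : Fin 4) :
    waste (marketCap C) x (good v k) ≤ nodeWaste C x v :=
  Finset.single_le_sum (f := fun k => waste (marketCap C) x (good v k))
    (fun _ _ => Eqm.waste_nonneg _) (Finset.mem_univ k)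

theorem market_chain {v : Fin C.n} (h : nodeWaste C x v ≤ 1 / 10 ^ 5) :
    Chain (marketCap C) x p (good v 2) (good v 0) (good v 1) :=
  have hw := fun k => (waste_le_nodeWaste v k).trans h
  have hc := market_chain_consumes p v
  ⟨hw 2, hw 0, hw 1, hc.1, hc.2⟩

/-- A gate is satisfied if the goods of its nodes are not wasted. -/
theorem gate_sat (E : Eqm (marketCap C) p x δ) {T : Fin (4 * C.n + 1) → Bool}
    (hT : CheapTest p T) {g : Gate C.n} (hg : g ∈ C.gates)
    (h : ∀ v ∈ g.inputs ++ g.outputs, nodeWaste C x v ≤ 1 / 10 ^ 5) :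
    g.Sat fun v => nodeVal T (good v 0) (good v 1) := by
  have hd := C.distinct g hg
  rcases g with ⟨u, v, w⟩ | ⟨u, v, w⟩
  · simp only [Gate.inputs, Gate.outputs, List.cons_append, List.nil_append, List.mem_cons,
      List.not_mem_nil, or_false, forall_eq_or_imp, forall_eq] at h
    have hr := market_row hg (i := 1) (gateUtility_nand u v w 1) (b := good w 2)
      (by simp [entrySum, good_inj])
    have huv : u ≠ v := by
      simp [Gate.inputs, Gate.outputs] at hd; exact hd.1.1
    refine nand_sat E hT (market_chain h.1) (market_chain h.2.1) (market_chain h.2.2)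
      (by simp [good_inj]) (by simp [good_inj]) ?_ ?_ ?_
    · rw [hr.1]; simp [entrySum, good_inj, mainCap_cap, huv.symm]
    · rw [hr.1]; simp [entrySum, good_inj, mainCap_cap, huv]
    · rw [hr.2]; simp [mainCap_cap, mul_comm]
  · simp only [Gate.inputs, Gate.outputs, List.cons_append, List.nil_append, List.mem_cons,
      List.not_mem_nil, or_false, forall_eq_or_imp, forall_eq] at h
    have hvw : v ≠ w := by
      simp [Gate.inputs, Gate.outputs] at hd; exact hd.2
    have c₂ := market_consumes hg (i := 4) (gateUtility_purify u v w 4) fstCap_lastR p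
    have c₃ := market_consumes hg (i := 0) (gateUtility_purify u v w 0) sndCap_lastR p
    have e₂ := market_consumes hg (i := 5) (gateUtility_purify u v w 5) mainCap_lastR p
    have e₃ := market_consumes hg (i := 1) (gateUtility_purify u v w 1) mainCap_lastR p
    rw [fstCap_cap] at c₂
    rw [sndCap_cap] at c₃
    rw [mainCap_cap] at e₂ e₃
    exact purify_sat E hT (market_chain h.1) (market_chain h.2.1) (market_chain h.2.2)
      ((waste_le_nodeWaste v 3).trans h.2.1) ((waste_le_nodeWaste w 3).trans h.2.2)
      (by simp [good_inj, hvw]) c₂ c₃ e₂ e₃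

/-! #### The number of satisfied gates -/

theorem list_sum_nodes {n : ℕ} (φ : Fin n → ℝ) (l : List (Fin n)) :
    (l.map φ).sum = ∑ v, (l.count v : ℕ) * φ v := by
  induction l with
  | nil => simp
  | cons a l ih =>
    simp only [List.map_cons, List.sum_cons, ih, List.count_cons, Nat.cast_add, add_mul,
      Finset.sum_add_distrib]
    rw [add_comm]
    congr 1
    simp

theorem sum_map_flatMap {α β : Type*} (f : α → List β) (φ : β → ℝ) (l : List α) :
    ((l.flatMap f).map φ).sum = (l.map fun a => ((f a).map φ).sum).sum := by
  induction l with
  | nil => simp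
  | cons a l ih => simp [ih]

/-- Every node occurs once as an input and once as an output. -/
theorem sum_gates_nodeWaste (hC : C.InputOnce) (φ : Fin C.n → ℝ) :
    (C.gates.map fun g => ((g.inputs ++ g.outputs).map φ).sum).sum = 2 * ∑ v, φ v := by
  have h₁ : (C.gates.map fun g => (g.inputs.map φ).sum).sum = ∑ v, φ v := by
    rw [← sum_map_flatMap, list_sum_nodes]
    simp [hC _]
  have h₂ : (C.gates.map fun g => (g.outputs.map φ).sum).sum = ∑ v, φ v := by
    rw [← sum_map_flatMap, list_sum_nodes]
    simp [C.output_once]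
  simp only [List.map_append, List.sum_append]
  rw [List.sum_map_add, h₁, h₂]
  ring

theorem sum_nodeWaste_le (x : Fin (4 * C.n + 1) → Fin (4 * C.n + 1) → ℝ) :
    ∑ v, nodeWaste C x v ≤ ∑ j, waste (marketCap C) x j := by
  unfold nodeWaste
  rw [← Fintype.sum_prod_type' fun (v : Fin C.n) (k : Fin 4) => waste (marketCap C) x (good v k)]
  refine le_of_eq_of_le (Finset.sum_map Finset.univ ⟨fun q : Fin C.n × Fin 4 => good q.1 q.2, fun q r h => by
    obtain ⟨h₁, h₂⟩ := good_inj.1 h; exact Prod.ext h₁ h₂⟩ (waste (marketCap C) x)).symm ?_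
  exact Finset.sum_le_sum_of_subset_of_nonneg (Finset.subset_univ _)
    fun _ _ _ => Eqm.waste_nonneg _

theorem countP_le_of_sum {α : Type*} (P : α → Bool) (φ : α → ℝ) {t : ℝ} (l : List α)
    (h₀ : ∀ a ∈ l, 0 ≤ φ a) (h₁ : ∀ a ∈ l, P a = true → t ≤ φ a) :
    t * (l.countP P : ℕ) ≤ (l.map φ).sum := by
  induction l with
  | nil => simp
  | cons a l ih =>
    have ih := ih (fun b hb => h₀ b (by simp [hb])) fun b hb => h₁ b (by simp [hb])
    have ha := h₀ a (by simp)
    have ha' := h₁ a (by simp)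
    rcases hP : P a
    · simp [hP]; linarith
    · have := ha' hP
      simp [hP]; linarith

theorem n_le_gates (C : PureCircuit) : C.n ≤ 2 * C.gates.length := by
  have h : ∀ l : List (Gate C.n), (l.flatMap Gate.outputs).length ≤ 2 * l.length := by
    intro l
    induction l with
    | nil => simp
    | cons g l ih =>
      have : g.outputs.length ≤ 2 := by cases g <;> simp [Gate.outputs]
      simp only [List.flatMap_cons, List.length_append, List.length_cons]
      omega
  have h₁ : ((C.gates.flatMap Gate.outputs).map fun _ => (1 : ℝ)).sum = C.n := by
    rw [list_sum_nodes]
    simp [C.output_once]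
  have h₂ : (C.gates.flatMap Gate.outputs).length = C.n := by
    have : ((C.gates.flatMap Gate.outputs).length : ℝ) = C.n := by rw [← h₁]; simp
    exact_mod_cast this
  have h₃ := h C.gates
  omega

/-- Most gates are satisfied. -/
theorem sat_fraction (hC : C.InputOnce) (E : Eqm (marketCap C) p x δ)
    {T : Fin (4 * C.n + 1) → Bool} (hT : CheapTest p T) {δc : ℝ} (hδ : δ * 10 ^ 25 ≤ δc) :
    (1 - δc) * C.gates.length ≤
      (C.gates.countP fun g => decide (g.Sat fun v => nodeVal T (good v 0) (good v 1)) : ℕ) := by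
  set P : Gate C.n → Bool := fun g => decide (g.Sat fun v => nodeVal T (good v 0) (good v 1))
  rcases Nat.eq_zero_or_pos C.gates.length with h₀ | h₀
  · simp [h₀]
  have hW : ∀ l : List (Fin C.n), ∀ a ∈ l.map (nodeWaste C x), 0 ≤ a := fun l a ha => by
    obtain ⟨v, -, rfl⟩ := List.mem_map.1 ha
    exact nodeWaste_nonneg v
  -- Markov's inequality: by `gate_sat`, the nodes of an unsatisfied gate have total waste at least
  -- `10 ^ (-5)`.
  have h₁ := countP_le_of_sum (fun g => !P g)
    (fun g => ((g.inputs ++ g.outputs).map (nodeWaste C x)).sum) (t := 1 / 10 ^ 5) C.gates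
    (fun g _ => List.sum_nonneg (hW _)) (fun g hg hn => by
      by_contra hlt
      push Not at hlt
      have hs := gate_sat E hT hg fun v hv => by
        refine le_trans (List.single_le_sum (hW _) _
          (List.mem_map_of_mem hv)) hlt.le
      simp [P, hs] at hn)
  rw [sum_gates_nodeWaste hC] at h₁
  have h₂ := sum_nodeWaste_le x
  have h₃ := E.sum_waste_le
  have h₄ := List.length_eq_countP_add_countP P (l := C.gates)
  have h₅ : (C.gates.countP fun g => !P g) = C.gates.countP fun g => decide ¬P g = true := by
    congr 1; funext g; cases P g <;> simp
  rw [← h₅] at h₄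
  -- Here a gate must exist. The unsatisfied fraction is at most 10^5 · 2 · 10^18 · 9 · `δ`, hence
  -- below `10 ^ 25 * δ`.
  have h₆ : 4 * C.n + 1 ≤ 9 * C.gates.length := by
    have := n_le_gates C
    omega
  have h₇ : ((4 * C.n + 1 : ℕ) : ℝ) ≤ 9 * C.gates.length := by exact_mod_cast h₆
  rw [Fintype.card_fin] at h₃
  have h₈ := mul_le_mul_of_nonneg_left h₇ (mul_nonneg (by norm_num : (0 : ℝ) ≤ 10 ^ 18)
    E.delta_nonneg)
  have h₉ : (C.gates.length : ℝ) = (C.gates.countP P : ℕ) + (C.gates.countP fun g => !P g : ℕ) := by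
    exact_mod_cast h₄
  have hL : (0 : ℝ) ≤ C.gates.length := Nat.cast_nonneg _
  have h₁₀ := mul_le_mul_of_nonneg_right hδ hL
  have h₁₁ := mul_nonneg E.delta_nonneg hL
  norm_num at *
  linarith

end

/-! ### The market is computable in polynomial time -/

/-! #### Numbers -/

theorem encodeNat_bit (b : Bool) {x : ℕ} (h : x ≠ 0) :
    Computability.encodeNat (Nat.bit b x) = b :: Computability.encodeNat x := by
  unfold Computability.encodeNat
  rw [← Num.ofNat'_eq, ← Num.ofNat'_eq, Num.ofNat'_bit]
  rcases hx : Num.ofNat' x with _ | p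
  · rw [Num.ofNat'_eq] at hx
    have := congrArg (fun z : Num => (z : ℕ)) hx
    simp only [Num.to_of_nat] at this
    exact absurd this h
  · cases b <;> rfl

theorem encodeNat_ne_nil {x : ℕ} (h : x ≠ 0) : Computability.encodeNat x ≠ [] := fun hn =>
  h (Computability.encodingNatBool.encode_injective (hn.trans (rfl : [] = Computability.encodeNat 0)))

/-- The two lowest digits of `4 * x + k`. -/
def lowBits (k : Fin 4) : List Γ' := [Γ'.bit (k.val.testBit 0), Γ'.bit (k.val.testBit 1)]

/-- Digits are written from the lowest one, so two are put in front. This fails for `x = 0`, which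
has no digits. -/
theorem natCode_four_mul_add {x : ℕ} (h : x ≠ 0) (k : Fin 4) :
    Code.nat.enc (4 * x + k) = lowBits k ++ Code.nat.enc x := by
  have h₁ : 4 * x + k = Nat.bit (k.val.testBit 0) (Nat.bit (k.val.testBit 1) x) := by
    fin_cases k <;> simp [Nat.bit, Nat.testBit] <;> omega
  simp only [Code.nat]
  rw [h₁, encodeNat_bit _ (by simp [h]), encodeNat_bit _ h]
  rfl

/-! #### Computations of transducers -/

/-- The transducer reads `s` in state `q`, outputs `o` and ends in state `r`. -/
def Steps {A B Q : Type} (δ : Q → A → Q × List B) (q : Q) (s : List A) (r : Q) (o : List B) :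
    Prop := ∀ t, transduce δ q (s ++ t) = o ++ transduce δ r t

section

variable {A B Q : Type} {δ : Q → A → Q × List B}

theorem Steps.nil (q : Q) : Steps δ q [] q [] := fun _ => rfl

theorem Steps.single {q r : Q} {x : A} {o : List B} (h : δ q x = (r, o)) :
    Steps δ q [x] r o := fun t => by simp [transduce, h]

theorem Steps.append {q r u : Q} {s t : List A} {o o' : List B} (h : Steps δ q s r o)
    (h' : Steps δ r t u o') : Steps δ q (s ++ t) u (o ++ o') := fun z => by
  rw [List.append_assoc, h, h', List.append_assoc]

theorem Steps.cons {q r u : Q} {x : A} {t : List A} {o o' : List B} (h : δ q x = (r, o))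
    (h' : Steps δ r t u o') : Steps δ q (x :: t) u (o ++ o') :=
  (Steps.single h).append h'

theorem Steps.flatMap {α : Type} {q : Q} {f : α → List A} {g : α → List B} :
    ∀ l : List α, (∀ a ∈ l, Steps δ q (f a) q (g a)) → Steps δ q (l.flatMap f) q (l.flatMap g)
  | [], _ => Steps.nil q
  | a :: l, h => by
    simp only [List.flatMap_cons]
    exact (h a (by simp)).append (Steps.flatMap l fun b hb => h b (by simp [hb]))

theorem Steps.transduce_eq {q r : Q} {s : List A} {o : List B} (h : Steps δ q s r o) :
    transduce δ q s = o := by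
  simpa [transduce] using h []

end

/-- What is written for a number `x`: nothing, or the number `4 * x + k` between two strings. -/
abbrev NumOut : Type := Option (List Γ' × Fin 4 × List Γ')

/-- The string that is written for the number `x`. -/
def NumOut.result (e : NumOut) (x : ℕ) : List Γ' :=
  match e with
  | none => []
  | some (p, k, s) => p ++ Code.nat.enc (4 * x + k) ++ s

/-- The string that is written when a digit is read; `fresh` if this is the first digit. -/
def NumOut.onBit (e : NumOut) (fresh b : Bool) : List Γ' :=
  match e with
  | none => []
  | some (p, k, _) => (if fresh then p ++ lowBits k else []) ++ [Γ'.bit b]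

/-- The string that is written when the end of the number is read; `fresh` if there were no
digits. -/
def NumOut.onComma (e : NumOut) (fresh : Bool) : List Γ' :=
  match e with
  | none => []
  | some (p, k, s) => (if fresh then p ++ Code.nat.enc k else [Γ'.comma]) ++ s

/-- In state `st true` nothing has been written yet, so the case `x = 0` is recognised at the comma
before any low digits are committed. -/
theorem steps_num {Q : Type} {δ : Q → Γ' → Q × List Γ'} {st : Bool → Q} {r : Q} (e : NumOut)
    {z : List Γ'} (hb : ∀ fr b, δ (st fr) (Γ'.bit b) = (st false, e.onBit fr b))
    (hc : ∀ fr, δ (st fr) Γ'.comma = (r, e.onComma fr ++ z)) (x : ℕ) :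
    Steps δ (st true) (Code.nat.enc x) r (e.result x ++ z) := by
  have h₁ : ∀ l : List Bool, Steps δ (st false) (l.map Γ'.bit ++ [Γ'.comma]) r
      ((if e = none then [] else l.map Γ'.bit) ++ (e.onComma false ++ z)) := by
    intro l
    induction l with
    | nil => simpa using Steps.single (hc false)
    | cons b l ih =>
      have := Steps.cons (hb false b) ih
      rcases e with _ | ⟨p, k, s⟩ <;> simpa [NumOut.onBit] using this
  rcases eq_or_ne x 0 with rfl | hx
  · have := Steps.single (hc true)
    rcases e with _ | ⟨p, k, s⟩ <;> simpa [NumOut.onComma, NumOut.result, Code.nat,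
      Computability.encodeNat, Computability.encodeNum] using this
  · obtain ⟨b, l, hl⟩ := List.exists_cons_of_ne_nil (encodeNat_ne_nil hx)
    have := Steps.cons (hb true b) (h₁ l)
    rcases e with _ | ⟨p, k, s⟩
    · simpa [NumOut.onBit, NumOut.onComma, NumOut.result, Code.nat, hl] using this
    · simp only [NumOut.result, natCode_four_mul_add hx]
      simpa [NumOut.onBit, NumOut.onComma, Code.nat, hl] using this

/-! #### The duplication of the input -/

/-- An instance has a single closing bracket, at its end, so this class repeats whole instances;
`commaClass` repeats single numbers. -/
def ketClass : Γ' → SymClass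
  | .ket => .sep
  | _ => .plain

def commaClass : Γ' → SymClass
  | .comma => .sep
  | .bit _ => .plain
  | _ => .pass

theorem dupSeg_plain {A : Type} (cls : A → SymClass) : ∀ (l buf s : List A),
    (∀ x ∈ l, cls x = .plain) → dupSeg cls buf (l ++ s) = l ++ dupSeg cls (l.reverse ++ buf) s
  | [], _, _, _ => rfl
  | x :: l, buf, s, h => by
    have h₁ := dupSeg_plain cls l (x :: buf) s fun y hy => h y (by simp [hy])
    simp [dupSeg, h x (by simp), h₁]

theorem dupSeg_segment {A : Type} (cls : A → SymClass) (l s : List A) {y : A}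
    (h : ∀ x ∈ l, cls x = .plain) (hy : cls y = .sep) :
    dupSeg cls [] (l ++ y :: s) = (l ++ [y]) ++ (l ++ [y]) ++ dupSeg cls [] s := by
  rw [dupSeg_plain cls l _ _ h]
  simp [dupSeg, hy]

theorem dupSeg_bits (l : List Bool) (s : List Γ') :
    dupSeg commaClass [] (l.map Γ'.bit ++ Γ'.comma :: s) =
      (l.map Γ'.bit ++ [Γ'.comma]) ++ (l.map Γ'.bit ++ [Γ'.comma]) ++ dupSeg commaClass [] s :=
  dupSeg_segment _ _ _ (fun x hx => by
    obtain ⟨b, -, rfl⟩ := List.mem_map.1 hx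
    rfl) rfl

theorem dupSeg_natCode (x : ℕ) (s : List Γ') : dupSeg commaClass [] (Code.nat.enc x ++ s) =
    Code.nat.enc x ++ Code.nat.enc x ++ dupSeg commaClass [] s := by
  simpa [Code.nat] using dupSeg_bits (Computability.encodeNat x) s

theorem dupSeg_pow (w : List Γ') (h : ∀ x ∈ w, ketClass x = .plain) : ∀ k,
    dupSeg ketClass [] (List.replicate k (w ++ [Γ'.ket])).flatten =
      (List.replicate (2 * k) (w ++ [Γ'.ket])).flatten
  | 0 => rfl
  | k + 1 => by
    rw [List.replicate_succ, List.flatten_cons, List.append_assoc, List.singleton_append,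
      dupSeg_segment _ _ _ h rfl, dupSeg_pow w h k, mul_add, mul_one, List.replicate_succ,
      List.replicate_succ]
    simp

theorem encList_eq {α : Type} (e : α → List Γ') (l : List α) :
    encList e l = (l.flatMap fun a => Γ'.bra :: e a) ++ [Γ'.ket] := by
  induction l with
  | nil => rfl
  | cons a l ih => simp [encList, ih]

/-! #### The transducer that writes the market -/

/-- `i` is the pass. `hdr` reads the two copies of the number of nodes, `field` the six node numbers
of a gate; `retag` skips the gate tag, which is repeated along with the first number. -/
inductive MState
  | hdr (i : Fin 8) (again fresh : Bool)
  | top (i : Fin 8)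
  | tag (i : Fin 8)
  | field (i : Fin 8) (T : Bool) (f : Fin 6) (fresh : Bool)
  | retag (i : Fin 8) (T : Bool)
  deriving Fintype

namespace MState

/-- What is written for the number of nodes. -/
def hdrOut (i : Fin 8) (again : Bool) : NumOut :=
  -- The first copy of `n` yields the number `4 * n + 1` of goods, the second one the index `4 * n`
  -- in the buyer of the last good.
  if i = 0 then
    if again then
      some (Γ'.bra :: (Code.nnrat.enc 1 ++ [Γ'.bra]), 0, PLC.code.enc linPLC ++ [Γ'.ket])
    else some ([], 1, [])
  else none

/-- What is written for a node of a gate. -/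
def fieldOut (i : Fin 8) (T : Bool) (f : Fin 6) : NumOut :=
  (tpl T i).bind fun t => (t f).map fun q => ([Γ'.bra], q.1, PLC.code.enc q.2)

def startOut (i : Fin 8) (T : Bool) : List Γ' :=
  if (tpl T i).isSome then Γ'.bra :: Code.nnrat.enc 1 else []

def endOut (i : Fin 8) (T : Bool) : List Γ' :=
  if (tpl T i).isSome then [Γ'.ket] else []

def step : MState → Γ' → MState × List Γ'
  | hdr i a fr, .bit b => (hdr i a false, (hdrOut i a).onBit fr b)
  | hdr i a fr, .comma => (if a then top i else hdr i true true, (hdrOut i a).onComma fr ++ [])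
  | top i, .bra => (tag i, [])
  | top i, .ket => (hdr (i + 1) false true, if i = 7 then [Γ'.ket] else [])
  | tag i, .bit T => (field i T 0 true, startOut i T)
  | field i T f fr, .bit b => (field i T f false, (fieldOut i T f).onBit fr b)
  | field i T f fr, .comma =>
    (if f = 0 then retag i T else if f = 5 then top i else field i T (f + 1) true,
      (fieldOut i T f).onComma fr ++ if f = 5 then endOut i T else [])
  | retag i T, .bit _ => (field i T 1 true, [])
  | q, _ => (q, [])

end MState

open MState in
theorem steps_hdr (i : Fin 8) (n : ℕ) : Steps MState.step (hdr i false true)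
    (Code.nat.enc n ++ Code.nat.enc n) (top i)
    ((hdrOut i false).result n ++ (hdrOut i true).result n) := by
  have h₁ := steps_num (st := hdr i false) (δ := MState.step) (hdrOut i false)
    (fun _ _ => rfl) (fun _ => rfl) n
  have h₂ := steps_num (st := hdr i true) (δ := MState.step) (hdrOut i true)
    (fun _ _ => rfl) (fun _ => rfl) n
  simpa using h₁.append h₂

/-- The nodes of a gate as a string, with repetitions. -/
def gateInput {n : ℕ} (g : Gate n) : List Γ' :=
  Γ'.bra :: Γ'.bit g.isPurify :: (Code.nat.enc (g.node 0) ++ Γ'.bit g.isPurify ::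
    (Code.nat.enc (g.node 0) ++ (Code.nat.enc (g.node 1) ++ (Code.nat.enc (g.node 1) ++
      (Code.nat.enc (g.node 2) ++ Code.nat.enc (g.node 2))))))

open MState in
/-- What is written for a gate. -/
def gateOutput {n : ℕ} (i : Fin 8) (g : Gate n) : List Γ' :=
  startOut i g.isPurify ++ (((List.finRange 6).flatMap fun f =>
    (fieldOut i g.isPurify f).result (g.node ⟨f / 2, by omega⟩)) ++ endOut i g.isPurify)

open MState in
theorem steps_gate {n : ℕ} (i : Fin 8) (g : Gate n) :
    Steps MState.step (top i) (gateInput g) (top i) (gateOutput i g) := by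
  set T := g.isPurify with hT
  have h : ∀ f x, Steps MState.step (field i T f true) (Code.nat.enc x)
      (if f = 0 then retag i T else if f = 5 then top i else field i T (f + 1) true)
      ((fieldOut i T f).result x ++ if f = 5 then MState.endOut i T else []) := fun f x =>
    steps_num (st := field i T f) (δ := MState.step) (fieldOut i T f)
      (fun _ _ => rfl) (fun _ => rfl) x
  have h' := Steps.cons (δ := MState.step) (q := top i) (x := Γ'.bra) rfl <|
    Steps.cons (x := Γ'.bit T) rfl <|
    (h 0 (g.node 0)).append <| Steps.cons (x := Γ'.bit T) rfl <| (h 1 (g.node 0)).append <|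
    (h 2 (g.node 1)).append <| (h 3 (g.node 1)).append <| (h 4 (g.node 2)).append
    (h 5 (g.node 2))
  simpa [gateInput, gateOutput, List.finRange_succ, ← hT] using h'

/-- The string of an instance, with repetitions. -/
def passInput (C : PureCircuit) : List Γ' :=
  Code.nat.enc C.n ++ Code.nat.enc C.n ++ (C.gates.flatMap gateInput ++ [Γ'.ket])

/-- What is written in a pass over an instance. -/
def passOutput (C : PureCircuit) (i : Fin 8) : List Γ' :=
  (MState.hdrOut i false).result C.n ++ (MState.hdrOut i true).result C.n ++
    (C.gates.flatMap (gateOutput i) ++ if i = 7 then [Γ'.ket] else [])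

theorem steps_pass (C : PureCircuit) (i : Fin 8) :
    Steps MState.step (.hdr i false true) (passInput C) (.hdr (i + 1) false true)
      (passOutput C i) :=
  (steps_hdr i C.n).append ((Steps.flatMap C.gates fun g _ => steps_gate i g).append
    (Steps.single rfl))

theorem steps_passes (C : PureCircuit) :
    Steps MState.step (.hdr 0 false true) (List.replicate 8 (passInput C)).flatten
      (.hdr 0 false true) ((List.finRange 8).flatMap (passOutput C)) := by
  have h := (steps_pass C 0).append <| (steps_pass C 1).append <| (steps_pass C 2).append <|
    (steps_pass C 3).append <| (steps_pass C 4).append <| (steps_pass C 5).append <|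
    (steps_pass C 6).append <| steps_pass C 7
  simpa [List.finRange_succ, List.replicate_succ] using h

theorem dupSeg_gate {n : ℕ} (g : Gate n) (s : List Γ') :
    dupSeg commaClass [] (Γ'.bra :: ((Code.bool.prod (Code.nat.prod (Code.nat.prod Code.nat))).enc
      g.data ++ s)) = gateInput g ++ dupSeg commaClass [] s := by
  have hT : ∀ (T : Bool) (x : ℕ) (s : List Γ'),
      dupSeg commaClass [] (Γ'.bit T :: (Code.nat.enc x ++ s)) =
        Γ'.bit T :: (Code.nat.enc x ++ Γ'.bit T :: (Code.nat.enc x ++ dupSeg commaClass [] s)) :=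
    fun T x s => by simpa [Code.nat] using dupSeg_bits (T :: Computability.encodeNat x) s
  have hb : ∀ s, dupSeg commaClass [] (Γ'.bra :: s) = Γ'.bra :: dupSeg commaClass [] s :=
    fun _ => rfl
  rcases g with ⟨u, v, w⟩ | ⟨u, v, w⟩ <;>
    simp [Code.prod, Code.bool, Gate.data, hb, hT, dupSeg_natCode, gateInput, Gate.isPurify,
      Gate.node]

theorem dupSeg_gates {n : ℕ} (s : List Γ') : ∀ l : List (Gate n),
    dupSeg commaClass [] (encList (Code.bool.prod (Code.nat.prod (Code.nat.prod Code.nat))).enc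
      (l.map Gate.data) ++ s) = l.flatMap gateInput ++ [Γ'.ket] ++ dupSeg commaClass [] s
  | [] => rfl
  | g :: l => by
    simp only [List.map_cons, encList, List.cons_append, List.append_assoc, dupSeg_gate,
      dupSeg_gates s l, List.flatMap_cons]

theorem dupSeg_instance (C : PureCircuit) (s : List Γ') :
    dupSeg commaClass [] (PureCircuit.code.enc C ++ s) =
      passInput C ++ dupSeg commaClass [] s := by
  have h := dupSeg_gates s C.gates
  simp only [PureCircuit.code, Code.map, PureCircuit.data, passInput]
  rw [Code.prod]
  simp only [Code.list, List.append_assoc, dupSeg_natCode]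
  rw [h]
  simp

theorem dupSeg_instances (C : PureCircuit) : ∀ k,
    dupSeg commaClass [] (List.replicate k (PureCircuit.code.enc C)).flatten =
      (List.replicate k (passInput C)).flatten
  | 0 => rfl
  | k + 1 => by
    rw [List.replicate_succ, List.flatten_cons, dupSeg_instance, dupSeg_instances C k]
    rfl

theorem natCode_plain (x : ℕ) : ∀ y ∈ Code.nat.enc x, ketClass y = .plain := by
  intro y hy
  simp only [Code.nat, List.mem_append, List.mem_map, List.mem_singleton] at hy
  rcases hy with ⟨b, -, rfl⟩ | rfl <;> rfl

theorem instance_eq (C : PureCircuit) : ∃ w : List Γ', PureCircuit.code.enc C = w ++ [Γ'.ket] ∧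
    ∀ x ∈ w, ketClass x = .plain := by
  refine ⟨Code.nat.enc C.n ++ (C.gates.map Gate.data).flatMap fun a =>
    Γ'.bra :: (Code.bool.prod (Code.nat.prod (Code.nat.prod Code.nat))).enc a, ?_, ?_⟩
  · simp only [PureCircuit.code, Code.map, PureCircuit.data]
    rw [Code.prod]
    simp only [Code.list, encList_eq, ← List.append_assoc]
  simp only [List.mem_append, List.mem_flatMap, List.mem_map, List.mem_cons, Code.prod, Code.bool]
  rintro x (h | ⟨d, -, rfl | (h | h) | h | h | h⟩)
  · exact natCode_plain _ x h
  · rfl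
  · subst h; rfl
  · cases h
  · exact natCode_plain _ x h
  · exact natCode_plain _ x h
  · exact natCode_plain _ x h

/-! #### The string of the market -/

/-- The code of a buyer. -/
def buyerCode : Code (ℚ≥0 × List (ℕ × PLC)) := Code.nnrat.prod (Code.nat.prod PLC.code).list

theorem mkBuyer_data {m : ℕ} {l : List (Fin m × PLC)} (h : (l.map Prod.fst).Nodup) :
    (mkBuyer l).data = (1, l.map fun e => ((e.1 : ℕ), e.2)) := by
  simp [mkBuyer, h, Buyer.data]

theorem flatMap_filterMap {α β γ : Type*} (f : α → Option β) (φ : β → List γ) : ∀ l : List α,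
    (l.filterMap f).flatMap φ = l.flatMap fun a => ((f a).map φ).getD []
  | [] => rfl
  | a :: l => by
    have := flatMap_filterMap f φ l
    rcases h : f a with _ | b <;> simp [h, this]

theorem gateOutput_eq {n : ℕ} {g : Gate n} (hg : (g.inputs ++ g.outputs).Nodup) (i : Fin 8) :
    gateOutput i g = (((gateUtility i g).map mkBuyer).map
      fun b => Γ'.bra :: buyerCode.enc b.data).getD [] := by
  rcases h : tpl g.isPurify i with _ | t
  · simp [gateUtility, gateOutput, h, MState.startOut, MState.endOut, MState.fieldOut,
      NumOut.result]
  · have hu : gateUtility i g = some (g.tplUtility t) := by simp [gateUtility, h]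
    have hn := (goodUtility_gate hg hu).nodup
    rw [hu]
    simp only [Option.map_some, Option.getD_some, mkBuyer_data hn, gateOutput, MState.startOut,
      MState.endOut, MState.fieldOut, h, Option.isSome_some, if_true, Option.bind_some, buyerCode]
    rw [Code.prod]
    simp only [Code.list, encList_eq, Gate.tplUtility, List.cons_append]
    congr 3
    rw [List.flatMap_map, flatMap_filterMap]
    refine congrArg₂ _ (funext fun f => ?_) rfl
    rcases t f with _ | ⟨k, φ⟩
    · rfl
    · simp [NumOut.result, Code.prod, good]

/-- `marketBuyers` lists the buyers pass by pass, the order in which the transducer writes them. -/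
theorem passOutputs_eq (C : PureCircuit) :
    (List.finRange 8).flatMap (passOutput C) = FisherMarket.code.enc (market C) := by
  have h₁ : ∀ i, C.gates.flatMap (gateOutput i) =
      (C.gates.filterMap fun g => (gateUtility i g).map mkBuyer).flatMap
        fun b => Γ'.bra :: buyerCode.enc b.data := fun i => by
    rw [flatMap_filterMap]
    exact List.flatMap_congr fun g hg => gateOutput_eq (C.distinct g hg) i
  have h₂ : FisherMarket.code.enc (market C) = Code.nat.enc (4 * C.n + 1) ++
      (((marketBuyers C).flatMap fun b => Γ'.bra :: buyerCode.enc b.data) ++ [Γ'.ket]) := by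
    simp only [FisherMarket.code, Code.map, FisherMarket.data]
    rw [Code.prod]
    simp only [Code.list, encList_eq, List.flatMap_map]
    rfl
  rw [h₂, marketBuyers, List.flatMap_cons, mkBuyer_data goodUtility_last.nodup, List.flatMap_assoc]
  simp only [← h₁]
  simp [passOutput, List.finRange_succ, MState.hdrOut, NumOut.result, buyerCode, Code.prod,
    Code.list, encList, lastGood]

theorem exists_polyTime_market : ∃ F : List Γ' → List Γ', PolyTime (fun s => s) (fun s => s) F ∧
    ∀ C, F (PureCircuit.code.enc C) = FisherMarket.code.enc (market C) := by
  -- Three doublings give the eight copies for the eight passes; then every number is doubled, since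
  -- a node may contribute two goods to a buyer.
  have h := (polyTime_transduce MState.step (.hdr 0 false true)).comp <|
    (polyTime_dupSeg commaClass).comp <| (polyTime_dupSeg ketClass).comp <|
    (polyTime_dupSeg ketClass).comp (polyTime_dupSeg ketClass)
  refine ⟨_, h, fun C => ?_⟩
  obtain ⟨w, hw, hp⟩ := instance_eq C
  have h₁ : PureCircuit.code.enc C = (List.replicate 1 (w ++ [Γ'.ket])).flatten := by simp [hw]
  simp only [Function.comp_apply]
  rw [h₁, dupSeg_pow w hp, dupSeg_pow w hp, dupSeg_pow w hp, ← hw, dupSeg_instances,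
    (steps_passes C).transduce_eq, passOutputs_eq]

/-! ### The assignment is computable in polynomial time -/

/-! #### Cheap prices -/

/-- Whether the denominator has at least 16 binary digits more than the numerator. -/
def isCheap (q : ℚ≥0) : Bool :=
  decide ((Computability.encodeNat q.num).length + 16 ≤ (Computability.encodeNat q.den).length)

theorem length_encodeNat (x : ℕ) : (Computability.encodeNat x).length = x.size := by
  induction x using Nat.binaryRec with
  | zero => rfl
  | bit b x ih =>
    rcases eq_or_ne x 0 with rfl | h
    · cases b <;> rfl
    · rw [encodeNat_bit b h, Nat.size_bit (by simp [h]), List.length_cons, ih]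

/-- Positivity matters: 0 = 0/1 has lengths 0 and 1 and is not recognised as cheap. -/
theorem isCheap_of_lt {q : ℚ≥0} (h₀ : 0 < q) (h : (q : ℝ) < 1 / 2 ^ 17) : isCheap q = true := by
  have hd : (0 : ℝ) < q.den := by exact_mod_cast q.den_pos
  rw [← NNRat.num_div_den q] at h
  push_cast at h
  rw [div_lt_div_iff₀ hd (by positivity)] at h
  have h' : q.num * 2 ^ 17 < q.den := by
    have : ((q.num * 2 ^ 17 : ℕ) : ℝ) < (q.den : ℕ) := by push_cast; linarith
    exact_mod_cast this
  have hn : 0 < q.num := NNRat.num_pos.2 h₀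
  have hs : 0 < q.num.size := Nat.size_pos.2 hn
  have h₁ : 2 ^ (q.num.size - 1) ≤ q.num := Nat.lt_size.1 (by omega)
  have h₂ : 2 ^ (q.num.size - 1 + 17) ≤ q.den := by
    rw [pow_add]
    exact (Nat.mul_le_mul_right _ h₁).trans h'.le
  have h₃ := Nat.lt_size.2 h₂
  simp only [isCheap, length_encodeNat, decide_eq_true_eq]
  omega

theorem le_of_isCheap {q : ℚ≥0} (h : isCheap q = true) : (q : ℝ) ≤ 1 / 2 ^ 15 := by
  have hd : (0 : ℝ) < q.den := by exact_mod_cast q.den_pos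
  simp only [isCheap, length_encodeNat, decide_eq_true_eq] at h
  have h₁ := Nat.lt_size_self q.num
  have h₂ : 2 ^ (q.num.size + 15) ≤ q.den := Nat.lt_size.1 (by omega)
  rw [pow_add] at h₂
  have h₃ : q.num * 2 ^ 15 ≤ q.den := (Nat.mul_le_mul_right _ h₁.le).trans h₂
  have h₄ : ((q.num * 2 ^ 15 : ℕ) : ℝ) ≤ (q.den : ℕ) := by exact_mod_cast h₃
  rw [← NNRat.num_div_den q]
  push_cast at h₄ ⊢
  rw [div_le_div_iff₀ hd (by positivity)]
  linarith

/-! #### Reading the values of the nodes -/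

/-- The value of a node, given whether its two goods are cheap. -/
def cheapVal (s t : Bool) : Val := bif s then .zero else bif t then .one else .bot

/-- The values that are read from a list of prices, in blocks of four; `pos` is the position in the
current block, and `fl` tells whether its first price is cheap. -/
def readVals : Fin 4 → Bool → List ℚ≥0 → List Val
  | _, _, [] => []
  | pos, fl, q :: l => (if pos = 1 then [cheapVal fl (isCheap q)] else []) ++
      readVals (pos + 1) (if pos = 0 then isCheap q else fl) l

theorem readVals_four (fl : Bool) (a b c d : ℚ≥0) (l : List ℚ≥0) :
    readVals 0 fl (a :: b :: c :: d :: l) =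
      cheapVal (isCheap a) (isCheap b) :: readVals 0 (isCheap a) l := rfl

/-- The last of the `4 * n + 1` prices stands at position 0 of an unfinished block and writes
nothing. -/
theorem readVals_spec : ∀ (n : ℕ) (fl : Bool) (l : List ℚ≥0), l.length = 4 * n + 1 →
    (readVals 0 fl l).length = n ∧ ∀ v < n, (readVals 0 fl l).getD v .bot =
      cheapVal (isCheap (l.getD (4 * v) 0)) (isCheap (l.getD (4 * v + 1) 0))
  | 0, fl, [a], _ => ⟨rfl, by simp⟩
  | n + 1, fl, a :: b :: c :: d :: l, h => by
    obtain ⟨h₁, h₂⟩ := readVals_spec n (isCheap a) l (by simpa [mul_add] using h)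
    rw [readVals_four]
    refine ⟨by simp [h₁], fun v hv => ?_⟩
    rcases v with _ | v
    · simp
    · simpa [mul_add] using h₂ v (by omega)

/-! #### The stack program -/

/-- The symbol of a value. -/
def Val.sym : Val → Γ'
  | zero => Γ'.bit false
  | one => Γ'.bit true
  | bot => Γ'.blank

theorem valCode_enc (v : Val) : Val.code.enc v = [v.sym] := by cases v <;> rfl

/-- The number `x`, or `16` if `x > 16`. -/
def sat16 (x : ℕ) : Fin 17 := ⟨min x 16, by omega⟩

/-- After each denominator digit, `dec` removes one mark of the numerator; once the marks are used
up, `e` counts the excess, stopping at 16. `clr` removes the remaining marks. -/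
inductive ReadState
  | top (pos : Fin 4) (fl : Bool)
  | num (pos : Fin 4) (fl : Bool)
  | den (pos : Fin 4) (fl : Bool) (e : Fin 17)
  | dec (pos : Fin 4) (fl : Bool) (e : Fin 17)
  | clr (pos : Fin 4) (fl : Bool) (e : Fin 17)
  | done
  deriving Fintype

open ReadState in
/-- The stack program that reads prices and writes the values of the nodes. It counts the digits of
a numerator with the stack `c`. The symbols of the first component of the input are replaced by
`thru`. -/
def readProg {B : Type} (w : Γ' → B) (thru : Γ' → List B) : Prog (Γ' ⊕ Γ') B ReadState where
  start := top 0 false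
  src
    | top _ _ => none
    | num _ _ => none
    | den _ _ _ => none
    | dec _ _ _ => some .c
    | clr _ _ _ => some .c
    | done => none
  next
    | top pos fl, some (.inl x), _ => (some (top pos fl), (thru x).map fun y => (.o, y))
    | top pos fl, some (.inr .bra), _ => (some (num pos fl), [])
    | top _ _, some (.inr .ket), _ => (some done, [(.o, w .ket)])
    | num pos fl, some (.inr (.bit _)), _ => (some (num pos fl), [(.c, w .comma)])
    | num pos fl, some (.inr .comma), _ => (some (den pos fl (sat16 0)), [])
    | den pos fl e, some (.inr (.bit _)), _ => (some (dec pos fl e), [])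
    | den pos fl e, some (.inr .comma), _ => (some (clr pos fl e), [])
    | dec pos fl e, _, some _ => (some (den pos fl e), [])
    | dec pos fl e, _, none => (some (den pos fl (sat16 (e + 1))), [])
    | clr pos fl e, _, some _ => (some (clr pos fl e), [])
    | clr pos fl e, _, none =>
      (some (top (pos + 1) (if pos = 0 then decide (e = 16) else fl)),
        (if pos = 1 then [w .bra, w (cheapVal fl (decide (e = 16))).sym] else []).map
          fun y => (.o, y))
    | done, some _, _ => (some done, [])
    | _, _, _ => (none, [])

section

variable {B : Type} (w : Γ' → B) (thru : Γ' → List B)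

theorem readProg_thru (s : List (Γ' ⊕ Γ')) : ∀ (l : List Γ') (o : List B),
    Runs (readProg w thru).step l.length ⟨some (.top 0 false), l.map .inl ++ s, regs [] [] [] o⟩
      ⟨some (.top 0 false), s, regs [] [] [] ((l.flatMap thru).reverse ++ o)⟩
  | [], o => Runs.refl _ _
  | x :: l, o => by
    refine Runs.head ?_ (by simpa using readProg_thru s l ((thru x).reverse ++ o))
    rw [Prog.step_inp _ rfl]
    simp [readProg, pushAll_output]

theorem readProg_num (pos : Fin 4) (fl : Bool) (s : List (Γ' ⊕ Γ')) (o : List B) :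
    ∀ (l : List Bool) (k : ℕ), Runs (readProg w thru).step (l.length + 1)
      ⟨some (.num pos fl), l.map (fun b => .inr (.bit b)) ++ .inr .comma :: s,
        regs [] [] (List.replicate k (w .comma)) o⟩
      ⟨some (.den pos fl (sat16 0)), s, regs [] [] (List.replicate (k + l.length) (w .comma)) o⟩
  | [], k => Runs.single (by rw [Prog.step_inp _ rfl]; rfl)
  | b :: l, k => by
    refine Runs.head ?_ (by
      simpa [add_assoc, add_comm, add_left_comm] using readProg_num pos fl s o l (k + 1))
    rw [Prog.step_inp _ rfl]
    simp [readProg, pushAll, List.replicate_succ]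

/-- Of the two truncated differences at most one is non-zero: the excess digits of the denominator,
or the marks left over. -/
theorem readProg_den (pos : Fin 4) (fl : Bool) (s : List (Γ' ⊕ Γ')) (o : List B) :
    ∀ (l : List Bool) (k e : ℕ), Runs (readProg w thru).step (2 * l.length + 1)
      ⟨some (.den pos fl (sat16 e)), l.map (fun b => .inr (.bit b)) ++ .inr .comma :: s,
        regs [] [] (List.replicate k (w .comma)) o⟩
      ⟨some (.clr pos fl (sat16 (e + (l.length - k)))), s,
        regs [] [] (List.replicate (k - l.length) (w .comma)) o⟩
  | [], k, e => Runs.single (by rw [Prog.step_inp _ rfl]; simp [readProg, pushAll])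
  | b :: l, 0, e => by
    have h := readProg_den pos fl s o l 0 (e + 1)
    have hs : sat16 (sat16 e + 1) = sat16 (e + 1) := by
      simp only [sat16, Fin.mk.injEq]
      omega
    refine Runs.head (b := ⟨some (.dec pos fl (sat16 e)),
      l.map (fun b => .inr (.bit b)) ++ .inr .comma :: s, regs [] [] [] o⟩) ?_
      (Runs.head ?_ (by simpa [add_assoc, add_comm, add_left_comm] using h))
    · rw [Prog.step_inp _ rfl]
      simp [readProg, pushAll]
    · rw [Prog.step_reg _ (r := .c) rfl]
      simp [readProg, pushAll, hs]
  | b :: l, k + 1, e => by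
    have h := readProg_den pos fl s o l k e
    refine Runs.head (b := ⟨some (.dec pos fl (sat16 e)),
      l.map (fun b => .inr (.bit b)) ++ .inr .comma :: s,
      regs [] [] (List.replicate (k + 1) (w .comma)) o⟩) ?_
      (Runs.head ?_ (by simpa using h))
    · rw [Prog.step_inp _ rfl]
      simp [readProg, pushAll]
    · rw [Prog.step_reg _ (r := .c) rfl]
      simp [readProg, pushAll, List.replicate_succ]

/-- What is written after the price with cheapness `t`. -/
def priceOut (pos : Fin 4) (fl t : Bool) : List B :=
  if pos = 1 then [w .bra, w (cheapVal fl t).sym] else []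

theorem readProg_clr (pos : Fin 4) (fl : Bool) (e : Fin 17) (s : List (Γ' ⊕ Γ')) (o : List B) :
    ∀ k : ℕ, Runs (readProg w thru).step (k + 1)
      ⟨some (.clr pos fl e), s, regs [] [] (List.replicate k (w .comma)) o⟩
      ⟨some (.top (pos + 1) (if pos = 0 then decide (e = 16) else fl)), s,
        regs [] [] [] ((priceOut w pos fl (decide (e = 16))).reverse ++ o)⟩
  | 0 => by
    refine Runs.single ?_
    rw [Prog.step_reg _ (r := .c) rfl]
    simp only [readProg, List.replicate_zero, regs_c, List.head?_nil, List.tail_nil, update_regs_c,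
      pushAll_output]
    rfl
  | k + 1 => by
    refine Runs.head ?_ (readProg_clr pos fl e s o k)
    rw [Prog.step_reg _ (r := .c) rfl]
    simp [readProg, pushAll, List.replicate_succ]

theorem readProg_price (pos : Fin 4) (fl : Bool) (q : ℚ≥0) (s : List (Γ' ⊕ Γ')) (o : List B) :
    ∃ n ≤ 4 * (Code.nnrat.enc q).length + 4, Runs (readProg w thru).step n
      ⟨some (.top pos fl), .inr .bra :: ((Code.nnrat.enc q).map .inr ++ s), regs [] [] [] o⟩
      ⟨some (.top (pos + 1) (if pos = 0 then isCheap q else fl)), s,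
        regs [] [] [] ((priceOut w pos fl (isCheap q)).reverse ++ o)⟩ := by
  set a := Computability.encodeNat q.num with ha
  set b := Computability.encodeNat q.den with hb
  have he : (Code.nnrat.enc q).map (Sum.inr : Γ' → Γ' ⊕ Γ') ++ s =
      a.map (fun b => .inr (.bit b)) ++ .inr .comma ::
        (b.map (fun b => .inr (.bit b)) ++ .inr .comma :: s) := by
    simp [Code.nnrat, Code.map, Code.prod, Code.nat, ← ha, ← hb, Function.comp_def]
  have hl : (Code.nnrat.enc q).length = a.length + b.length + 2 := by
    simp [Code.nnrat, Code.map, Code.prod, Code.nat, ← ha, ← hb]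
    omega
  have ht : isCheap q = decide (sat16 (0 + (b.length - a.length)) = 16) := by
    simp only [isCheap, sat16, Fin.ext_iff, ← ha, ← hb]
    congr 1
    simp
    omega
  rw [he, ht]
  have h₁ := readProg_num w thru pos fl (b.map (fun b => .inr (.bit b)) ++ .inr .comma :: s) o a 0
  rw [zero_add] at h₁
  have h := h₁.trans ((readProg_den w thru pos fl s o b a.length 0).trans
    (readProg_clr w thru pos fl _ s o _))
  refine ⟨_, ?_, Runs.head ?_ h⟩
  · omega
  · rw [Prog.step_inp _ rfl]
    simp [readProg, pushAll]

theorem readProg_prices (s : List (Γ' ⊕ Γ')) : ∀ (l : List ℚ≥0) (pos : Fin 4) (fl : Bool)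
    (o : List B), ∃ n ≤ 4 * (Code.nnrat.list.enc l).length, Runs (readProg w thru).step n
      ⟨some (.top pos fl), (Code.nnrat.list.enc l).map .inr ++ s, regs [] [] [] o⟩
      ⟨some .done, s, regs [] [] []
        (((Val.code.list.enc (readVals pos fl l)).map w).reverse ++ o)⟩
  | [], pos, fl, o => ⟨1, by simp [Code.list, encList], Runs.single (by
      rw [Prog.step_inp _ rfl]
      simp [readProg, pushAll, Code.list, encList, readVals])⟩
  | q :: l, pos, fl, o => by
    obtain ⟨n, hn, h⟩ := readProg_price w thru pos fl q ((Code.nnrat.list.enc l).map .inr ++ s) o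
    obtain ⟨m, hm, h'⟩ := readProg_prices s l (pos + 1) (if pos = 0 then isCheap q else fl)
      ((priceOut w pos fl (isCheap q)).reverse ++ o)
    refine ⟨n + m, ?_, ?_⟩
    · simp only [Code.list, encList, List.length_cons, List.length_append] at hm ⊢
      omega
    · have h₂ : (Val.code.list.enc (readVals pos fl (q :: l))).map w =
          priceOut w pos fl (isCheap q) ++ (Val.code.list.enc
            (readVals (pos + 1) (if pos = 0 then isCheap q else fl) l)).map w := by
        by_cases hp : pos = 1
        · simp [readVals, hp, priceOut, Code.list, encList, valCode_enc]
        · simp [readVals, hp, priceOut]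
      rw [h₂, List.reverse_append, List.append_assoc]
      simp only [Code.list, encList, List.map_cons, List.map_append, List.cons_append,
        List.append_assoc] at h h' ⊢
      exact h.trans h'

theorem readProg_done (o : List B) : ∀ s : List (Γ' ⊕ Γ'),
    Runs (readProg w thru).step (s.length + 1) ⟨some .done, s, regs [] [] [] o⟩
      ⟨none, [], regs [] [] [] o⟩
  | [] => Runs.single (by rw [Prog.step_inp _ rfl]; rfl)
  | x :: s => by
    refine Runs.head ?_ (readProg_done o s)
    rw [Prog.step_inp _ rfl]
    simp [readProg, pushAll]

end

/-- The values of the nodes for the given prices, after a copy of the first component. -/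
theorem polyTime_readVals {α B : Type} [Fintype B] (ea : Computability.Encoding α Γ')
    (w : Γ' → B) (thru : Γ' → List B) :
    PolyTime (Computability.encodingProd ea
        (Code.nnrat.list.prod Code.nnrat.list.list).toEncoding).encode (fun s => s)
      fun a : α × (List ℚ≥0 × List (List ℚ≥0)) => (ea.encode a.1).flatMap thru ++
        (Val.code.list.enc (readVals 0 false a.2.1)).map w := by
  refine (readProg w thru).polyTime_of_reverse (4 * Polynomial.X + 1) fun ⟨a, y⟩ => ?_
  have he : (Computability.encodingProd ea
      (Code.nnrat.list.prod Code.nnrat.list.list).toEncoding).encode (a, y) =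
      (ea.encode a).map .inl ++ ((Code.nnrat.list.enc y.1).map .inr ++
        (Code.nnrat.list.list.enc y.2).map .inr) := by
    simp [Computability.encodingProd, Code.toEncoding, Code.prod]
  obtain ⟨n, hn, h⟩ := readProg_prices w thru ((Code.nnrat.list.list.enc y.2).map .inr) y.1 0 false
    (((ea.encode a).flatMap thru).reverse ++ [])
  have hr := (readProg_thru w thru _ _ []).trans (h.trans (readProg_done w thru _ _))
  rw [List.append_nil] at hr
  rw [he, List.reverse_append]
  refine ⟨_, ?_, hr⟩
  simp
  omega

/-! ### The reduction -/

/-- The markets of the Pure-Circuit instances in which every node is the input to exactly one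
gate. -/
def marketFamily : Set FisherMarket := {M | ∃ C : PureCircuit, C.InputOnce ∧ M = market C}

theorem isSimpleFamily_marketFamily : IsSimpleFamily marketFamily :=
  ⟨7, 4, 10 ^ 8, by rintro _ ⟨C, hC, rfl⟩; exact market_isSimple hC⟩

/-- The market of an instance. -/
def toMarket (δc ε δ : ℝ) (C : (pureCircuit δc).Inst) : (fisherEquilibrium marketFamily ε δ).Inst :=
  ⟨market C.1, C.1, C.2, rfl⟩

theorem polyTime_toMarket (δc ε δ : ℝ) :
    PolyTime (pureCircuit δc).instEnc.encode (fisherEquilibrium marketFamily ε δ).instEnc.encode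
      (toMarket δc ε δ) := by
  obtain ⟨F, hF, h⟩ := exists_polyTime_market
  exact PolyTime.of_list F hF fun C => h C.1

theorem PolyTime.of_encode {α β A B : Type} {ea : α → List A} {eb : β → List B} {f : α → β}
    {F : α → List B} (hF : PolyTime ea (fun s => s) F) (h : ∀ a, F a = eb (f a)) :
    PolyTime ea eb f := by
  obtain ⟨M, i, o, t, hM⟩ := polyTime_iff.1 hF
  exact polyTime_iff.2 ⟨M, i, o, t, fun a => by rw [← h]; exact hM a⟩

theorem isSol_readVals {ε δc : ℝ} (hε : ε ≤ 1 / 9) (hδ₀ : 0 < δc) (hδ₁ : δc ≤ 1)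
    (C : (pureCircuit δc).Inst) (y : List ℚ≥0 × List (List ℚ≥0))
    (h : (fisherEquilibrium marketFamily ε (δc / 10 ^ 25)).IsSol (toMarket δc ε _ C) y) :
    (pureCircuit δc).IsSol C (readVals 0 false y.1) := by
  obtain ⟨C, hC⟩ := C
  obtain ⟨hl, -, -, he⟩ := h
  obtain ⟨h₁, h₂⟩ := readVals_spec C.n false y.1 hl
  refine ⟨h₁, ?_⟩
  have E := market_eqm hC hε (by positivity) (by norm_num; linarith) he
  set T : Fin (4 * C.n + 1) → Bool := fun j => isCheap (y.1.getD j 0) with hT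
  -- Equilibrium prices are positive, which excludes the zero price that `isCheap` misjudges.
  have hT' : CheapTest (fun j : Fin (4 * C.n + 1) => ((y.1.getD j 0 : ℚ≥0) : ℝ)) T :=
    ⟨fun j hj => isCheap_of_lt (by exact_mod_cast E.price_pos j) hj, fun j hj => le_of_isCheap hj⟩
  have hs := sat_fraction hC E hT' (δc := δc) (by norm_num)
  have hv : (fun v : Fin C.n => (readVals 0 false y.1).getD v .bot) =
      fun v => nodeVal T (good v 0) (good v 1) := funext fun v => h₂ v v.2
  exact hv ▸ hs

theorem reduces_market {ε δc : ℝ} (hε : ε ≤ 1 / 9) (hδ₀ : 0 < δc) (hδ₁ : δc ≤ 1) :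
    Reduces (pureCircuit δc) (fisherEquilibrium marketFamily ε (δc / 10 ^ 25)) := by
  refine ⟨toMarket δc ε _, fun a => readVals 0 false a.2.1, polyTime_toMarket _ _ _, ?_,
    fun C y h => isSol_readVals hε hδ₀ hδ₁ C y h⟩
  refine PolyTime.of_encode
    (polyTime_readVals (pureCircuit δc).instEnc (fun x => x) fun _ => []) fun a => ?_
  simp [pureCircuit, Code.toEncoding]

/-- The values are read from the prices without the circuit, so the backward map need not recompute
`f I`; it copies the instance of `A`, reads the values and applies `g`. -/
theorem Reduces.trans_market {A : SearchProblem} {ε δc : ℝ} (hε : ε ≤ 1 / 9) (hδ₀ : 0 < δc)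
    (hδ₁ : δc ≤ 1) (hA : Reduces A (pureCircuit δc)) :
    Reduces A (fisherEquilibrium marketFamily ε (δc / 10 ^ 25)) := by
  obtain ⟨f, g, hf, hg, h⟩ := hA
  have hr : PolyTime (Computability.encodingProd A.instEnc
        (fisherEquilibrium marketFamily ε (δc / 10 ^ 25)).solEnc).encode
      (Computability.encodingProd A.instEnc (pureCircuit δc).solEnc).encode
      fun a => (a.1, readVals 0 false a.2.1) := by
    refine PolyTime.of_encode
      (polyTime_readVals A.instEnc (B := Γ' ⊕ Γ') .inr fun x => [.inl x]) fun a => ?_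
    simp [pureCircuit, Code.toEncoding, Computability.encodingProd, ← List.map_eq_flatMap]
  exact ⟨toMarket δc ε _ ∘ f, _, (polyTime_toMarket _ _ _).comp hf, hg.comp hr,
    fun I y hy => h I _ (isSol_readVals hε hδ₀ hδ₁ (f I) y hy)⟩

end FisherPCP

theorem mainTheorem2 (ε : ℝ) (hε₀ : 0 ≤ ε) (hε : ε < 1 / 9) :
    (∀ δc : ℝ, 0 < δc → δc ≤ 1 →
      ∃ δ : ℝ, 0 < δ ∧ δ ≤ 1 ∧ ∃ F : Set FisherPCP.FisherMarket, FisherPCP.IsSimpleFamily F ∧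
        FisherPCP.Reduces (FisherPCP.pureCircuit δc) (FisherPCP.fisherEquilibrium F ε δ)) ∧
    (FisherPCP.PCPforPPAD →
      ∃ δ : ℝ, 0 < δ ∧ δ ≤ 1 ∧ ∃ F : Set FisherPCP.FisherMarket, FisherPCP.IsSimpleFamily F ∧
        FisherPCP.PPADHard (FisherPCP.fisherEquilibrium F ε δ)) := by
  have hδ : ∀ δc : ℝ, 0 < δc → δc ≤ 1 → 0 < δc / 10 ^ 25 ∧ δc / 10 ^ 25 ≤ 1 := fun δc h₀ h₁ =>
    ⟨by positivity, by norm_num; linarith⟩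
  constructor
  · intro δc h₀ h₁
    exact ⟨_, (hδ δc h₀ h₁).1, (hδ δc h₀ h₁).2, _, FisherPCP.isSimpleFamily_marketFamily,
      FisherPCP.reduces_market hε.le h₀ h₁⟩
  · rintro ⟨δc, h₀, h₁, hard⟩
    exact ⟨_, (hδ δc h₀ h₁).1, (hδ δc h₀ h₁).2, _, FisherPCP.isSimpleFamily_marketFamily,
      fun A hA => (hard A hA).trans_market hε.le h₀ h₁⟩
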